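/- Let $d\in\mathbb N$, let $\omega=[0,1]^d$ and $\Omega=[0,1]\times\omega$, with time $t\in[0,1]$ as first coordinate, and let $\Gamma_0=\{0\}\times\omega$, $\Gamma_1=\{1\}\times\omega$, $\Gamma=\Gamma_0\cup\Gamma_1$. Consider one of two settings: the cube $\omega$ itself, or $\omega$ with periodic boundary conditions in all $d$ dimensions (the torus). Let $V$ be the space of Lipschitz vector fields $v\in W^{1,\infty}(\omega)^d$ that vanish on $\partial\omega$ (in the first setting) or are periodic (in the second), and let $u\in L^2([0,1],V)$, i.e. $u$ is measurable in time, $u(\cdot,t)\in V$ for almost every $t$, and $t\mapsto\|u(\cdot,t)\|_{W^{1,\infty}(\omega)}$ is in $L^2(0,1)$. Write $\mathbf b\cdot\nabla_t f=\partial_t f+u\cdot\nabla f$, in the sense of distributions: $g=\mathbf b\cdot\nabla_t f$ means $\int_\Omega f\,(\partial_t\varphi+u\cdot\nabla\varphi+\varphi\,\mathrm{div}\,u)=-\int_\Omega g\,\varphi$ for all test functions $\varphi$ that are smooth with compact support in the interior of $\Omega$ (in $(0,1)$ times the torus in the periodic setting). Let $$G=\{f\in L^2(\Omega):\ \mathbf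 b\cdot\nabla_t f\in L^2(\Omega)\},\qquad \|f\|_G^2=\|f\|_{L^2(\Omega)}^2+\|\mathbf b\cdot\nabla_t f\|_{L^2(\Omega)}^2 .$$ The trace $f|_{\Gamma}=(f|_{\Gamma_0},f|_{\Gamma_1})\in L^2(\Gamma_0)\times L^2(\Gamma_1)$ of $f\in G$ is understood as the continuous extension, with respect to $\|\cdot\|_G$, of the restriction of functions in $C^\infty(\bar\Omega)$ (periodic in space in the periodic setting). Let $\mathring G=\{v\in G: v|_{\Gamma}=0\}$. Then for all $I_0\in L^2(\Gamma_0)$ and $I_1\in L^2(\Gamma_1)$ the problem $$\text{minimize }\ J(I)=\tfrac12\|\mathbf b\cdot\nabla_t I\|_{L^2(\Omega)}^2\quad\text{over } I\in G \text{ with } I|_{\Gamma_0}=I_0,\ I|_{\Gamma_1}=I_1$$ has exactly one minimizer. For every admissible $I$ and every $v\in\mathring G$, the function $I+sv$ is admissible for all $s\in\mathbb R$ and $\frac{d}{ds}\big|_{s=0}J(I+sv)=a(I,v)$ with $a(I,v)=\int_\Omega(\mathbf b\cdot\nabla_t I)(\mathbf b\cdot\nabla_t v)$. An admissible $I$ is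 the minimizer if and only if it satisfies the first-order optimality conditions $$a(I,v)=0\qquad\text{for all } v\in\mathring G .$$ -/

import Mathlib

open MeasureTheory Filter Topology
open scoped NNReal ENNReal ContDiff

namespace Metamorphosis

noncomputable section

/-- The two settings for the spatial domain `[0,1]^d`: the plain cube, or the cube with periodic
boundary conditions in all `d` dimensions (the flat torus). -/
inductive Setting where
  | cube
  | periodic

/-- The spatial domain `ω = [0,1]^d`; in the periodic setting it is a fundamental domain. -/
def spaceDomain (d : ℕ) : Set (Fin d → ℝ) := Set.Icc 0 1

/-- The space-time domain `Ω = [0,1] × ω`; the first coordinate is time. -/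
def spaceTime (d : ℕ) : Set (ℝ × (Fin d → ℝ)) := Set.Icc (0 : ℝ) 1 ×ˢ spaceDomain d

/-- Lebesgue measure on `ω`. -/
def muSpace (d : ℕ) : Measure (Fin d → ℝ) := volume.restrict (spaceDomain d)

/-- Lebesgue measure on `Ω`. -/
def muSpaceTime (d : ℕ) : Measure (ℝ × (Fin d → ℝ)) := volume.restrict (spaceTime d)

/-- `L²(ω)`, which is also `L²(Γ₀)` and `L²(Γ₁)`. -/
abbrev L2Space (d : ℕ) : Type := Lp ℝ 2 (muSpace d)

/-- `L²(Ω)`. -/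
abbrev L2SpaceTime (d : ℕ) : Type := Lp ℝ 2 (muSpaceTime d)

/-- Invariance under integer translations. -/
def IntPeriodic {d : ℕ} {E : Type*} (v : (Fin d → ℝ) → E) : Prop :=
  ∀ (n : Fin d → ℤ) (x : Fin d → ℝ), v (x + fun i => (n i : ℝ)) = v x

/-- The set on which a spatial vector field is given: the closed cube, or all of `ℝ^d` for periodic
fields. -/
def fieldDomain (d : ℕ) : Setting → Set (Fin d → ℝ)
  | .cube => spaceDomain d
  | .periodic => Set.univ

/-- The boundary condition on a spatial vector field: zero on `∂ω`, or periodicity. -/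
def FieldBoundary {d : ℕ} : Setting → ((Fin d → ℝ) → (Fin d → ℝ)) → Prop
  | .cube, v => ∀ x ∈ frontier (spaceDomain d), v x = 0
  | .periodic, v => IntPeriodic v

/-- `u ∈ L²([0,1], V)` for the space `V` of Lipschitz vector fields `W^{1,∞}(ω)^d` that vanish on
`∂ω` (cube) or are periodic: `u` is measurable in time, and for almost every `t` the field `u t` is
in `V` with norm at most `K t`, where `K ∈ L²(0,1)`. -/
structure IsVelocity {d : ℕ} (S : Setting) (u : ℝ → (Fin d → ℝ) → (Fin d → ℝ)) : Prop where
  measurable : ∀ x ∈ fieldDomain d S,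
    AEStronglyMeasurable (fun t => u t x) (volume.restrict (Set.Icc (0 : ℝ) 1))
  lipschitz : ∃ K : ℝ → ℝ≥0,
    MemLp (fun t => (K t : ℝ)) 2 (volume.restrict (Set.Icc (0 : ℝ) 1)) ∧
    ∀ᵐ t ∂(volume.restrict (Set.Icc (0 : ℝ) 1)),
      LipschitzOnWith (K t) (u t) (fieldDomain d S) ∧
      (∀ x ∈ fieldDomain d S, ‖u t x‖ ≤ K t) ∧
      FieldBoundary S (u t)

/-- The (almost everywhere defined) divergence of a Lipschitz vector field. -/
def divergence {d : ℕ} (v : (Fin d → ℝ) → (Fin d → ℝ)) (x : Fin d → ℝ) : ℝ :=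
  ∑ i : Fin d, fderiv ℝ v x (Pi.single i 1) i

/-- The classical derivative `b · ∇ₜ p = ∂ₜ p + u · ∇ p`. -/
def classicalStreamDeriv {d : ℕ} (u : ℝ → (Fin d → ℝ) → (Fin d → ℝ))
    (p : ℝ × (Fin d → ℝ) → ℝ) (z : ℝ × (Fin d → ℝ)) : ℝ :=
  fderiv ℝ p z (1, u z.1 z.2)

/-- Test functions: smooth with compact support in the open space-time domain (which in the
periodic setting is `(0,1)` times the torus). -/
def IsTest {d : ℕ} : Setting → (ℝ × (Fin d → ℝ) → ℝ) → Prop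
  | .cube, φ => ContDiff ℝ ∞ φ ∧ HasCompactSupport φ ∧ tsupport φ ⊆ interior (spaceTime d)
  | .periodic, φ => ContDiff ℝ ∞ φ ∧ (∀ t : ℝ, IntPeriodic fun x => φ (t, x)) ∧
      ∃ a b : ℝ, 0 < a ∧ b < 1 ∧ ∀ t ∉ Set.Icc a b, ∀ x, φ (t, x) = 0

/-- Functions smooth up to the boundary, `C^∞(Ω̄)`: restrictions of smooth functions, which are
periodic in space in the periodic setting. -/
def IsSmoothUpToBoundary {d : ℕ} : Setting → (ℝ × (Fin d → ℝ) → ℝ) → Prop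
  | .cube, p => ContDiff ℝ ∞ p
  | .periodic, p => ContDiff ℝ ∞ p ∧ ∀ t : ℝ, IntPeriodic fun x => p (t, x)

/-- `b · ∇ₜ f = g` in the sense of distributions:
`∫ f divₜ(b φ) = - ∫ g φ` for all test functions `φ`, where
`divₜ(b φ) = ∂ₜ φ + u · ∇ φ + φ div u`. -/
def IsWeakStreamDeriv {d : ℕ} (S : Setting) (u : ℝ → (Fin d → ℝ) → (Fin d → ℝ))
    (f g : L2SpaceTime d) : Prop :=
  ∀ φ : ℝ × (Fin d → ℝ) → ℝ, IsTest S φ →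
    ∫ z, f z * (classicalStreamDeriv u φ z + φ z * divergence (u z.1) z.2) ∂(muSpaceTime d) =
      - ∫ z, g z * φ z ∂(muSpaceTime d)

/-- The graph space `G(b; Ω)`: the `f ∈ L²(Ω)` with `b · ∇ₜ f ∈ L²(Ω)`. -/
def graphSpace {d : ℕ} (S : Setting) (u : ℝ → (Fin d → ℝ) → (Fin d → ℝ)) :
    Set (L2SpaceTime d) :=
  {f | ∃ g : L2SpaceTime d, IsWeakStreamDeriv S u f g}

open Classical in
/-- `b · ∇ₜ f` for `f` in the graph space (and `0` for other `f`). -/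
def streamDeriv {d : ℕ} (S : Setting) (u : ℝ → (Fin d → ℝ) → (Fin d → ℝ))
    (f : L2SpaceTime d) : L2SpaceTime d :=
  if h : ∃ g : L2SpaceTime d, IsWeakStreamDeriv S u f g then h.choose else 0

/-- The trace of `f` on `Γ = Γ₀ ∪ Γ₁` is `(h₀, h₁)`, in the sense of the continuous extension, in
the graph norm, of the restriction operator on `C^∞(Ω̄)` with values in `L²(Γ)`: there are
functions `p n`, smooth up to the boundary, that converge to `f` in the graph norm and whose
restrictions to `t = 0` and `t = 1` converge in `L²` to `h₀` and `h₁`. -/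
def HasTrace {d : ℕ} (S : Setting) (u : ℝ → (Fin d → ℝ) → (Fin d → ℝ))
    (f : L2SpaceTime d) (h₀ h₁ : L2Space d) : Prop :=
  ∃ p : ℕ → ℝ × (Fin d → ℝ) → ℝ,
    (∀ n, IsSmoothUpToBoundary S (p n)) ∧
    Tendsto (fun n => eLpNorm (fun z => p n z - f z) 2 (muSpaceTime d)) atTop (𝓝 0) ∧
    Tendsto (fun n => eLpNorm (fun z => classicalStreamDeriv u (p n) z - streamDeriv S u f z) 2
      (muSpaceTime d)) atTop (𝓝 0) ∧
    Tendsto (fun n => eLpNorm (fun x => p n (0, x) - h₀ x) 2 (muSpace d)) atTop (𝓝 0) ∧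
    Tendsto (fun n => eLpNorm (fun x => p n (1, x) - h₁ x) 2 (muSpace d)) atTop (𝓝 0)

/-- The admissible images: `I ∈ G(b; Ω)` with `I = I₀` on `Γ₀` and `I = I₁` on `Γ₁`. -/
def admissible {d : ℕ} (S : Setting) (u : ℝ → (Fin d → ℝ) → (Fin d → ℝ))
    (I₀ I₁ : L2Space d) : Set (L2SpaceTime d) :=
  {I | I ∈ graphSpace S u ∧ HasTrace S u I I₀ I₁}

/-- The energy inner product `⟨f, g⟩ = ∫_Ω (b · ∇ₜ f) (b · ∇ₜ g)`. -/
def energyInner {d : ℕ} (S : Setting) (u : ℝ → (Fin d → ℝ) → (Fin d → ℝ))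
    (f g : L2SpaceTime d) : ℝ :=
  inner ℝ (streamDeriv S u f) (streamDeriv S u g)

/-- The objective `½ ‖b · ∇ₜ I‖²` with the norm of `L²(Ω)`. -/
def objective {d : ℕ} (S : Setting) (u : ℝ → (Fin d → ℝ) → (Fin d → ℝ))
    (I : L2SpaceTime d) : ℝ :=
  1 / 2 * ‖streamDeriv S u I‖ ^ 2

end

end Metamorphosis

namespace Metamorphosis

/-! ### The cube and its measure -/

section Cube

variable {d : ℕ}

/-! Write D for `b · ∇ₜ`. Minimizing ½‖DI‖² over images with given traces is a least-norm problem in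
a Hilbert space, and orthogonal projection solves it. This needs three facts about `traceGraph`, the
closure in L² of the quadruples (p, Dp, p(0,·), p(1,·)) with p smooth up to the boundary.

1. The second component is the weak derivative of the first and is determined by it
(`isWeakStreamDeriv_of_mem`, `IsWeakStreamDeriv.unique`). Hence admissibility is membership in a
closed linear space, and D is linear there.

2. A Poincaré inequality holds: the first component is controlled by the second and the initial
trace (`exists_poincare`). The divergence theorem has no lateral boundary term because the velocity
vanishes on the boundary or is periodic. Applied to p², it gives an integral inequality for ∫
p(t,·)², to which Grönwall's inequality applies with a coefficient in L²(0,1).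

3. Every pair of traces occurs (`exists_extension`). This is the main difficulty. A datum carried
along the exact flow would not be smooth in general, while traces are defined through smooth
functions. Instead `exists_approx_transport` builds a smooth p with p(0,·) equal to a smooth datum
and Dp as small as desired: the velocity is averaged over N time steps and mollified in space, and
the datum is composed with the maps x ↦ x - σ(t) w_k(x). Multiplication by 1 - t removes the trace
on Γ₁. The graph norm of the result is bounded by the L² norm of the datum, so completeness extends
the construction from the dense set of smooth data to L²(Γ₀). Time reversal handles Γ₁.

By the Poincaré inequality the derivatives of zero-trace functions form a closed subspace.
Subtracting from any admissible function a zero-trace function whose derivative is the projection of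
its own derivative yields the minimizer. Pythagoras gives the equivalence with the first-order
conditions, and the Poincaré inequality gives uniqueness. -/

lemma interior_spaceDomain : interior (spaceDomain d) = Set.univ.pi fun _ => Set.Ioo (0 : ℝ) 1 := by
  have : spaceDomain d = Set.univ.pi fun _ => Set.Icc (0 : ℝ) 1 := by
    ext x; simp [spaceDomain, Pi.le_def]
  rw [this, interior_pi_set Set.finite_univ]
  simp [interior_Icc]

lemma measurableSet_spaceDomain : MeasurableSet (spaceDomain d) := measurableSet_Icc

lemma isCompact_spaceDomain : IsCompact (spaceDomain d) := isCompact_Icc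

lemma isCompact_spaceTime : IsCompact (spaceTime d) := isCompact_Icc.prod isCompact_spaceDomain

lemma mem_spaceDomain {x : Fin d → ℝ} : x ∈ spaceDomain d ↔ ∀ i, x i ∈ Set.Icc (0 : ℝ) 1 := by
  simp [spaceDomain, Pi.le_def, forall_and]

lemma mem_interior_spaceDomain {x : Fin d → ℝ} :
    x ∈ interior (spaceDomain d) ↔ ∀ i, x i ∈ Set.Ioo (0 : ℝ) 1 := by
  rw [interior_spaceDomain]; simp [Set.mem_pi]

lemma convex_spaceDomain : Convex ℝ (spaceDomain d) := convex_Icc 0 1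

lemma volume_frontier_spaceDomain : volume (frontier (spaceDomain d)) = 0 :=
  convex_spaceDomain.addHaar_frontier volume

/-- Almost every point of the cube is interior. -/
lemma ae_mem_interior : ∀ᵐ x ∂(muSpace d), x ∈ interior (spaceDomain d) := by
  have h : ∀ᵐ x ∂(volume : Measure (Fin d → ℝ)), x ∉ frontier (spaceDomain d) :=
    measure_eq_zero_iff_ae_notMem.1 volume_frontier_spaceDomain
  rw [muSpace, ae_restrict_iff' measurableSet_spaceDomain]
  filter_upwards [h] with x hx hxd
  by_contra hc
  exact hx ⟨subset_closure hxd, hc⟩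

/-- Lebesgue measure on the unit time interval. -/
noncomputable abbrev muTime : Measure ℝ := volume.restrict (Set.Icc (0 : ℝ) 1)

lemma muSpaceTime_eq_prod : muSpaceTime d = muTime.prod (muSpace d) := by
  rw [muSpaceTime, spaceTime, Measure.volume_eq_prod, muTime, muSpace, Measure.prod_restrict]

instance : IsProbabilityMeasure muTime := ⟨by simp⟩

instance : IsProbabilityMeasure (muSpace d) := ⟨by
  simp [muSpace, spaceDomain, Real.volume_Icc_pi]⟩

instance : IsProbabilityMeasure (muSpaceTime d) := by
  rw [muSpaceTime_eq_prod]; infer_instance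

lemma ae_spaceTime_of_ae_time {P : ℝ → Prop} (h : ∀ᵐ t ∂muTime, P t) :
    ∀ᵐ z ∂(muSpaceTime d), P z.1 := by
  rw [muSpaceTime_eq_prod]
  exact Measure.quasiMeasurePreserving_fst.ae h

lemma ae_spaceTime_of_ae_space {P : (Fin d → ℝ) → Prop} (h : ∀ᵐ x ∂(muSpace d), P x) :
    ∀ᵐ z ∂(muSpaceTime d), P z.2 := by
  rw [muSpaceTime_eq_prod]
  exact Measure.quasiMeasurePreserving_snd.ae h

/-- The nearest-point map onto the cube. -/
noncomputable def clamp (x : Fin d → ℝ) : Fin d → ℝ :=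
  fun i => (Set.projIcc (0 : ℝ) 1 zero_le_one (x i) : ℝ)

lemma clamp_mem (x : Fin d → ℝ) : clamp x ∈ spaceDomain d :=
  mem_spaceDomain.2 fun i => (Set.projIcc (0 : ℝ) 1 zero_le_one (x i)).2

lemma clamp_of_mem {x : Fin d → ℝ} (hx : x ∈ spaceDomain d) : clamp x = x := by
  funext i
  simp only [clamp]
  rw [Set.projIcc_of_mem zero_le_one (mem_spaceDomain.1 hx i)]

lemma lipschitzWith_clamp : LipschitzWith 1 (clamp (d := d)) := by
  refine LipschitzWith.of_dist_le_mul fun x y => ?_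
  rw [NNReal.coe_one, one_mul]
  refine (dist_pi_le_iff dist_nonneg).2 fun i => ?_
  have := (LipschitzWith.projIcc (zero_le_one (α := ℝ))).dist_le_mul (x i) (y i)
  simp only [NNReal.coe_one, one_mul] at this
  exact this.trans (dist_le_pi_dist x y i)

/-- A coordinate outside (0,1) is sent to 0 or 1. Hence a field that vanishes on the boundary, once
extended through `clamp`, vanishes everywhere outside the interior. -/
lemma clamp_mem_frontier {x : Fin d → ℝ} (hx : x ∉ interior (spaceDomain d)) :
    clamp x ∈ frontier (spaceDomain d) := by
  refine ⟨subset_closure (clamp_mem x), fun h => hx ?_⟩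
  rw [mem_interior_spaceDomain] at h ⊢
  intro i
  have := h i
  simp only [clamp, Set.coe_projIcc, Set.mem_Ioo, lt_max_iff, lt_min_iff, max_lt_iff,
    min_lt_iff, lt_irrefl, false_or] at this
  exact ⟨this.1.2, by simpa using this.2⟩

end Cube

/-! ### Regular representatives of velocity fields -/

/-- The boundary condition of a velocity field that is defined on the whole space. -/
def GlobalBoundary {d : ℕ} : Setting → ((Fin d → ℝ) → (Fin d → ℝ)) → Prop
  | .cube, v => ∀ x ∉ interior (spaceDomain d), v x = 0
  | .periodic, v => IntPeriodic v

/-- A jointly measurable velocity field on the whole space that satisfies, at every time, the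
bounds that a general velocity field satisfies almost everywhere. -/
structure IsRegularVelocity {d : ℕ} (S : Setting) (v : ℝ → (Fin d → ℝ) → (Fin d → ℝ))
    (K : ℝ → ℝ≥0) : Prop where
  measurable_bound : Measurable K
  memLp_bound : MemLp (fun t => (K t : ℝ)) 2 muTime
  measurable : Measurable (Function.uncurry v)
  lipschitz : ∀ t, LipschitzWith (K t) (v t)
  norm_le : ∀ t x, ‖v t x‖ ≤ K t
  boundary : ∀ t, GlobalBoundary S (v t)

/-- A `1`-Lipschitz retraction onto the domain of the fields. -/
noncomputable def domainRetraction {d : ℕ} : Setting → (Fin d → ℝ) → (Fin d → ℝ)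
  | .cube => clamp
  | .periodic => id

section Regularization

variable {d : ℕ} {S : Setting} {u v : ℝ → (Fin d → ℝ) → (Fin d → ℝ)} {K : ℝ → ℝ≥0}

lemma domainRetraction_mem (x : Fin d → ℝ) : domainRetraction S x ∈ fieldDomain d S := by
  cases S
  · exact clamp_mem x
  · trivial

lemma domainRetraction_of_mem {x : Fin d → ℝ} (hx : x ∈ fieldDomain d S) :
    domainRetraction S x = x := by
  cases S
  · exact clamp_of_mem hx
  · rfl

lemma lipschitzWith_domainRetraction : LipschitzWith 1 (domainRetraction (d := d) S) := by
  cases S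
  · exact lipschitzWith_clamp
  · exact LipschitzWith.id

lemma spaceDomain_subset_fieldDomain : spaceDomain d ⊆ fieldDomain d S := by
  cases S
  · exact subset_rfl
  · exact Set.subset_univ _

lemma FieldBoundary.globalBoundary {w : (Fin d → ℝ) → (Fin d → ℝ)} (h : FieldBoundary S w) :
    GlobalBoundary S (w ∘ domainRetraction S) := by
  cases S
  · exact fun x hx => h _ (clamp_mem_frontier hx)
  · exact h

lemma globalBoundary_zero : GlobalBoundary S (0 : (Fin d → ℝ) → (Fin d → ℝ)) := by
  cases S
  · exact fun x _ => rfl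
  · exact fun n x => rfl

/-- The field is extended to the whole space by composition with the retraction and set to zero for
a null set of bad times. Continuity in space and measurability in time then give joint
measurability. -/
theorem IsVelocity.exists_regular (hu : IsVelocity S u) :
    ∃ v K, IsRegularVelocity S v K ∧ ∀ᵐ t ∂muTime, ∀ x ∈ fieldDomain d S, u t x = v t x := by
  obtain ⟨K, hK2, hK⟩ := hu.lipschitz
  have hKm : AEMeasurable K muTime := by
    have := hK2.1.aemeasurable.real_toNNReal
    simpa using this
  let q : ℕ → (Fin d → ℝ) := TopologicalSpace.denseSeq (Fin d → ℝ)
  have hm : ∀ n, AEStronglyMeasurable (fun t => u t (domainRetraction S (q n))) muTime :=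
    fun n => hu.measurable _ (domainRetraction_mem _)
  have hall : ∀ᵐ t ∂muTime, (∀ n, u t (domainRetraction S (q n)) = (hm n).mk _ t) ∧
      K t = hKm.mk K t ∧ LipschitzOnWith (K t) (u t) (fieldDomain d S) ∧
      (∀ x ∈ fieldDomain d S, ‖u t x‖ ≤ K t) ∧ FieldBoundary S (u t) := by
    filter_upwards [ae_all_iff.2 fun n => (hm n).ae_eq_mk, hKm.ae_eq_mk, hK] with t h1 h2 h3
    exact ⟨h1, h2, h3⟩
  -- `G` is a measurable set of good times, of full measure. On it all bounds hold and the field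
  -- agrees with measurable functions of time at countably many dense points.
  obtain ⟨G, hG, hGm, hGP⟩ := hall.exists_measurable_mem
  classical
  refine ⟨fun t => if t ∈ G then u t ∘ domainRetraction S else 0,
    fun t => if t ∈ G then hKm.mk K t else 0, ?_, ?_⟩
  · have hlip : ∀ t, LipschitzWith (if t ∈ G then hKm.mk K t else 0)
        (if t ∈ G then u t ∘ domainRetraction S else 0) := by
      intro t
      by_cases ht : t ∈ G
      · obtain ⟨-, h2, h3, -, -⟩ := hGP t ht
        simp only [ht, if_true, ← h2]
        have := h3.comp (lipschitzWith_domainRetraction (S := S)).lipschitzOnWith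
          (s := Set.univ) (fun x _ => domainRetraction_mem x)
        rw [mul_one] at this
        exact lipschitzOnWith_univ.1 this
      · simp only [ht, if_false]
        exact LipschitzWith.const' 0
    refine ⟨?_, ?_, ?_, hlip, ?_, ?_⟩
    · exact Measurable.ite hGm hKm.measurable_mk measurable_const
    · refine hK2.ae_eq ?_
      filter_upwards [hG] with t ht
      simp [ht, (hGP t ht).2.1]
    · have hdense : ∀ n, Measurable fun t =>
          (if t ∈ G then u t ∘ domainRetraction S else 0 : (Fin d → ℝ) → (Fin d → ℝ)) (q n) := by
        intro n
        have : (fun t => (if t ∈ G then u t ∘ domainRetraction S else 0 :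
            (Fin d → ℝ) → (Fin d → ℝ)) (q n)) = fun t => if t ∈ G then (hm n).mk _ t else 0 := by
          funext t
          by_cases ht : t ∈ G
          · simp [ht, (hGP t ht).1 n]
          · simp [ht]
        rw [this]
        exact Measurable.ite hGm (hm n).stronglyMeasurable_mk.measurable measurable_const
      have hpt : ∀ x, Measurable fun t =>
          (if t ∈ G then u t ∘ domainRetraction S else 0 : (Fin d → ℝ) → (Fin d → ℝ)) x := by
        intro x
        -- Continuity in space carries measurability from the dense points to every point.
        obtain ⟨y, hy, hyx⟩ := mem_closure_iff_seq_limit.1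
          ((TopologicalSpace.denseRange_denseSeq (Fin d → ℝ)) x)
        choose k hk using hy
        refine measurable_of_tendsto_metrizable (fun n => hdense (k n)) ?_
        rw [tendsto_pi_nhds]
        intro t
        have : Tendsto (fun n => q (k n)) atTop (𝓝 x) := by simpa only [q, hk] using hyx
        exact ((hlip t).continuous.tendsto x).comp this
      have := stronglyMeasurable_uncurry_of_continuous_of_stronglyMeasurable
        (u := fun x t =>
          (if t ∈ G then u t ∘ domainRetraction S else 0 : (Fin d → ℝ) → (Fin d → ℝ)) x)
        (fun t => (hlip t).continuous) (fun x => (hpt x).stronglyMeasurable)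
      exact this.measurable.comp measurable_swap
    · intro t x
      by_cases ht : t ∈ G
      · obtain ⟨-, h2, -, h4, -⟩ := hGP t ht
        simpa [ht, ← h2] using h4 _ (domainRetraction_mem x)
      · simp [ht]
    · intro t
      by_cases ht : t ∈ G
      · simpa [ht] using (hGP t ht).2.2.2.2.globalBoundary
      · simpa [ht] using globalBoundary_zero
  · filter_upwards [hG] with t ht x hx
    simp [ht, domainRetraction_of_mem hx]

/-! ### The problem depends only on the almost everywhere class of the velocity -/

section Congr

variable (h : ∀ᵐ t ∂muTime, ∀ x ∈ fieldDomain d S, u t x = v t x)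
include h

lemma classicalStreamDeriv_ae_eq (p : ℝ × (Fin d → ℝ) → ℝ) :
    classicalStreamDeriv u p =ᵐ[muSpaceTime d] classicalStreamDeriv v p := by
  filter_upwards [ae_spaceTime_of_ae_time h, ae_spaceTime_of_ae_space ae_mem_interior] with z h1 h2
  simp only [classicalStreamDeriv]
  rw [h1 _ (spaceDomain_subset_fieldDomain (interior_subset h2))]

/-- The fields agree only on the field domain. This determines their derivatives at interior points,
which is enough because the boundary is a null set. -/
lemma divergence_ae_eq :
    (fun z : ℝ × (Fin d → ℝ) => divergence (u z.1) z.2) =ᵐ[muSpaceTime d]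
      fun z => divergence (v z.1) z.2 := by
  filter_upwards [ae_spaceTime_of_ae_time h, ae_spaceTime_of_ae_space ae_mem_interior] with z h1 h2
  have : u z.1 =ᶠ[𝓝 z.2] v z.1 := by
    filter_upwards [isOpen_interior.mem_nhds h2] with x hx
    exact h1 x (spaceDomain_subset_fieldDomain (interior_subset hx))
  simp only [divergence, this.fderiv_eq]

lemma isWeakStreamDeriv_congr : IsWeakStreamDeriv S u = IsWeakStreamDeriv S v := by
  funext f g
  refine propext (forall₂_congr fun φ _ => ?_)
  rw [integral_congr_ae]
  filter_upwards [classicalStreamDeriv_ae_eq h φ, divergence_ae_eq h] with z h1 h2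
  rw [h1, h2]

lemma graphSpace_congr : graphSpace S u = graphSpace S v := by
  simp only [graphSpace, isWeakStreamDeriv_congr h]

lemma streamDeriv_congr : streamDeriv S u = streamDeriv S v := by
  funext f
  have hP : IsWeakStreamDeriv S u f = IsWeakStreamDeriv S v f :=
    congrFun (isWeakStreamDeriv_congr h) f
  -- `streamDeriv` is defined by choice, so it is not enough that the two predicates are equivalent:
  -- they are identified as one predicate, and then the chosen elements coincide.
  unfold streamDeriv
  generalize IsWeakStreamDeriv S u f = P at hP
  subst hP
  rfl

lemma hasTrace_congr : HasTrace S u = HasTrace S v := by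
  funext f h₀ h₁
  simp only [HasTrace, streamDeriv_congr h]
  refine propext (exists_congr fun p => ?_)
  have : ∀ n, eLpNorm (fun z => classicalStreamDeriv u (p n) z - streamDeriv S v f z) 2
      (muSpaceTime d) = eLpNorm (fun z => classicalStreamDeriv v (p n) z - streamDeriv S v f z) 2
      (muSpaceTime d) := fun n => eLpNorm_congr_ae <| by
    filter_upwards [classicalStreamDeriv_ae_eq h (p n)] with z h1
    rw [h1]
  simp only [this]

lemma admissible_congr : admissible S u = admissible S v := by
  funext I₀ I₁
  simp only [admissible, graphSpace_congr h, hasTrace_congr h]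

lemma objective_congr : objective S u = objective S v := by
  funext I
  simp only [objective, streamDeriv_congr h]

lemma energyInner_congr : energyInner S u = energyInner S v := by
  funext f g
  simp only [energyInner, streamDeriv_congr h]

end Congr

end Regularization

/-! ### Derivatives of Carathéodory functions -/

section Caratheodory

variable {α E F : Type*} [MeasurableSpace α] [NormedAddCommGroup E] [NormedSpace ℝ E]
  [NormedAddCommGroup F] [NormedSpace ℝ F]

omit [NormedSpace ℝ E] [NormedSpace ℝ F] in
/-- A Carathéodory function is a measurable map into the continuous functions with the
compact-open topology. -/
lemma measurable_mapsTo_of_caratheodory {f : α → E → F} [MeasurableSpace F] [BorelSpace F]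
    (hm : ∀ x, Measurable fun a => f a x) (hc : ∀ a, Continuous (f a)) {k : Set E} {U : Set F}
    (hk : IsCompact k) (hU : IsOpen U) : MeasurableSet {a | Set.MapsTo (f a) k U} := by
  obtain ⟨q, hqk, hq, hkq⟩ := hk.isSeparable.exists_countable_dense_subset
  -- On a compact set mapped into an open set the distance to the complement has a positive minimum.
  -- By continuity this lower bound only has to be tested on a countable dense subset.
  have hset : {a | Set.MapsTo (f a) k U} =
      ⋃ n : ℕ, ⋂ x ∈ q, {a | ((n : ℝ≥0∞))⁻¹ ≤ Metric.infEDist (f a x) Uᶜ} := by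
    ext a
    simp only [Set.mem_iUnion, Set.mem_iInter]
    constructor
    · intro h
      rcases k.eq_empty_or_nonempty with rfl | hne
      · exact ⟨0, fun x hx => absurd (hqk hx) (Set.notMem_empty x)⟩
      obtain ⟨x₀, hx₀, hmin⟩ := hk.exists_isMinOn hne
        (Metric.continuous_infEDist (s := Uᶜ) |>.comp (hc a)).continuousOn
      have hpos : Metric.infEDist (f a x₀) Uᶜ ≠ 0 := by
        intro h0
        rw [← Metric.mem_closure_iff_infEDist_zero, hU.isClosed_compl.closure_eq] at h0
        exact h0 (h hx₀)
      obtain ⟨n, hn⟩ := ENNReal.exists_inv_nat_lt hpos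
      exact ⟨n, fun x hx => hn.le.trans (hmin (hqk hx))⟩
    · rintro ⟨n, hn⟩ x hx
      have hcl : x ∈ closure q := hkq hx
      have hge : ((n : ℝ≥0∞))⁻¹ ≤ Metric.infEDist (f a x) Uᶜ :=
        closure_minimal (s := q) (t := {x | ((n : ℝ≥0∞))⁻¹ ≤ Metric.infEDist (f a x) Uᶜ})
          (fun y hy => hn y hy)
          (isClosed_le continuous_const (Metric.continuous_infEDist.comp (hc a))) hcl
      by_contra hxU
      have : Metric.infEDist (f a x) Uᶜ = 0 := Metric.infEDist_zero_of_mem hxU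
      rw [this, nonpos_iff_eq_zero, ENNReal.inv_eq_zero] at hge
      exact ENNReal.natCast_ne_top n hge
  rw [hset]
  refine MeasurableSet.iUnion fun n => MeasurableSet.biInter hq fun x _ => ?_
  exact measurableSet_le measurable_const (Metric.continuous_infEDist.measurable.comp (hm x))

/-- The parameter is replaced by the continuous function itself, as a point of C(E, F). Evaluation
is jointly continuous there, so the measurability of derivatives with a continuous parameter applies
and is pulled back along the measurable map `Φ`. -/
theorem measurable_fderiv_of_caratheodory [MeasurableSpace E] [BorelSpace E]
    [FiniteDimensional ℝ E] [FiniteDimensional ℝ F] {f : α → E → F}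
    [MeasurableSpace F] [BorelSpace F]
    (hm : ∀ x, Measurable fun a => f a x) (hc : ∀ a, Continuous (f a)) :
    Measurable fun z : α × E => fderiv ℝ (f z.1) z.2 := by
  have : ProperSpace E := FiniteDimensional.proper ℝ E
  have : ProperSpace F := FiniteDimensional.proper ℝ F
  let _ : MeasurableSpace C(E, F) := borel _
  have : BorelSpace C(E, F) := ⟨rfl⟩
  let Φ : α → C(E, F) := fun a => ⟨f a, hc a⟩
  have hΦ : Measurable Φ := by
    have hb : borel C(E, F) = _ := borel_eq_generateFrom_of_subbasis ContinuousMap.compactOpen_eq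
    change @Measurable _ _ _ (borel C(E, F)) Φ
    rw [hb]
    refine measurable_generateFrom ?_
    rintro _ ⟨k, hk, U, hU, rfl⟩
    exact measurable_mapsTo_of_caratheodory hm hc hk hU
  have h := measurable_fderiv_with_param ℝ (f := fun (g : C(E, F)) (x : E) => g x)
    (by exact continuous_eval)
  exact h.comp ((hΦ.comp measurable_fst).prodMk measurable_snd)

end Caratheodory

/-! ### Periodic functions -/

/-- The periodicity requirement of the setting. -/
def SpacePeriodic {d : ℕ} {F : Type*} : Setting → ((Fin d → ℝ) → F) → Prop
  | .cube, _ => True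
  | .periodic, f => IntPeriodic f

section Periodic

variable {d : ℕ} {S : Setting}

lemma isSmoothUpToBoundary_iff {p : ℝ × (Fin d → ℝ) → ℝ} :
    IsSmoothUpToBoundary S p ↔ ContDiff ℝ ∞ p ∧ ∀ t, SpacePeriodic S fun x => p (t, x) := by
  cases S <;> simp [IsSmoothUpToBoundary, SpacePeriodic]

lemma SpacePeriodic.comp {F G : Type*} {f : (Fin d → ℝ) → F} (hf : SpacePeriodic S f) (g : F → G) :
    SpacePeriodic S fun x => g (f x) := by
  cases S
  · trivial
  · exact fun n x => congrArg g (hf n x)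

lemma SpacePeriodic.comp₂ {F G H : Type*} {f₁ : (Fin d → ℝ) → F} {f₂ : (Fin d → ℝ) → G}
    (h₁ : SpacePeriodic S f₁) (h₂ : SpacePeriodic S f₂) (g : F → G → H) :
    SpacePeriodic S fun x => g (f₁ x) (f₂ x) := by
  cases S
  · trivial
  · intro n x
    simp only [h₁ n x, h₂ n x]

lemma spacePeriodic_const {F : Type*} (c : F) : SpacePeriodic S fun _ : Fin d → ℝ => c := by
  cases S
  · trivial
  · exact fun n x => rfl

/-- Subtracting the integer part maps the space onto the cube. -/
lemma fract_mem_spaceDomain (x : Fin d → ℝ) : (fun i => Int.fract (x i)) ∈ spaceDomain d :=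
  mem_spaceDomain.2 fun _ => ⟨Int.fract_nonneg _, (Int.fract_lt_one _).le⟩

lemma IntPeriodic.eq_fract {F : Type*} {f : (Fin d → ℝ) → F} (hf : IntPeriodic f)
    (x : Fin d → ℝ) : f (fun i => Int.fract (x i)) = f x := by
  have := hf (fun i => ⌊x i⌋) (fun j => Int.fract (x j))
  exact this.symm.trans (congrArg f (funext fun i => Int.fract_add_floor (x i)))

lemma IntPeriodic.exists_norm_le {F : Type*} [NormedAddCommGroup F] {f : (Fin d → ℝ) → F}
    (hf : IntPeriodic f) (hc : Continuous f) : ∃ B : ℝ≥0, ∀ x, ‖f x‖ ≤ B := by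
  obtain ⟨B, hB⟩ := isCompact_spaceDomain.exists_bound_of_continuousOn (hc.continuousOn (s := spaceDomain d))
  refine ⟨B.toNNReal, fun x => ?_⟩
  rw [← hf.eq_fract x]
  exact (hB _ (fract_mem_spaceDomain x)).trans (Real.le_coe_toNNReal B)

lemma IntPeriodic.fderiv {F : Type*} [NormedAddCommGroup F] [NormedSpace ℝ F]
    {f : (Fin d → ℝ) → F} (hf : IntPeriodic f) : IntPeriodic (fderiv ℝ f) := by
  intro n x
  rw [← fderiv_comp_add_right]
  congr 1
  funext y
  exact hf n y

lemma IntPeriodic.exists_lipschitzWith {F : Type*} [NormedAddCommGroup F] [NormedSpace ℝ F]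
    {f : (Fin d → ℝ) → F} (hf : IntPeriodic f) (hc : ContDiff ℝ ∞ f) :
    ∃ C : ℝ≥0, LipschitzWith C f := by
  obtain ⟨C, hC⟩ := hf.fderiv.exists_norm_le (hc.continuous_fderiv (by simp))
  exact ⟨C, lipschitzWith_of_nnnorm_fderiv_le (hc.differentiable (by simp)) fun x => hC x⟩

open Pointwise in
-- The cube is, up to a null set, a fundamental domain of the integer lattice, and so is each of its
-- translates. A periodic function has the same integral over all fundamental domains.
lemma IntPeriodic.setIntegral_add {f : (Fin d → ℝ) → ℝ} (hf : IntPeriodic f) (c : Fin d → ℝ) :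
    ∫ x, f (x + c) ∂(muSpace d) = ∫ x, f x ∂(muSpace d) := by
  let b := Pi.basisFun ℝ (Fin d)
  have hs := ZSpan.isAddFundamentalDomain b (volume : Measure (Fin d → ℝ))
  have hinv : ∀ (g : Submodule.span ℤ (Set.range b)) (x : Fin d → ℝ), f (g +ᵥ x) = f x := by
    rintro ⟨g, hg⟩ x
    rw [b.mem_span_iff_repr_mem ℤ] at hg
    choose n hn using hg
    have : g = fun i => (n i : ℝ) := by
      funext i
      simpa [b] using (hn i).symm
    change f (g + x) = f x
    rw [this, add_comm]
    exact hf n x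
  have hmu : muSpace d = volume.restrict (ZSpan.fundamentalDomain b) := by
    rw [muSpace, ZSpan.fundamentalDomain_pi_basisFun]
    exact (Measure.restrict_congr_set Measure.univ_pi_Ico_ae_eq_Icc).symm
  have : VAddInvariantMeasure (Submodule.span ℤ (Set.range b)) (Fin d → ℝ) volume :=
    ⟨fun g s _ => measure_preimage_add volume (g : Fin d → ℝ) s⟩
  have ht := hs.vadd_of_comm c
  have h1 := hs.setIntegral_eq ht hinv
  rw [hmu, h1]
  have hpre : ZSpan.fundamentalDomain b = (fun x => x + c) ⁻¹' (c +ᵥ ZSpan.fundamentalDomain b) := by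
    ext x
    simp [Set.mem_vadd_set_iff_neg_vadd_mem, add_comm]
  conv_lhs => rw [hpre]
  exact (measurePreserving_add_right volume c).setIntegral_preimage_emb
    (measurableEmbedding_addRight c) f _

/-- A smooth function can be changed away from the cube so that it is bounded and Lipschitz. -/
lemma SpacePeriodic.exists_lipschitz_representative {ψ : (Fin d → ℝ) → ℝ}
    (hψ : SpacePeriodic S ψ) (hc : ContDiff ℝ ∞ ψ) :
    ∃ (φ : (Fin d → ℝ) → ℝ) (B C : ℝ≥0), (∀ x, ‖φ x‖ ≤ B) ∧ LipschitzWith C φ ∧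
      SpacePeriodic S φ ∧ ∀ x ∈ spaceDomain d, φ =ᶠ[𝓝 x] ψ := by
  cases S
  -- In the sup norm the cube lies in the open ball of radius 2, on which the bump equals 1.
  · let χ : ContDiffBump (0 : Fin d → ℝ) := ⟨2, 3, by norm_num, by norm_num⟩
    have hcs : HasCompactSupport fun x => χ x * ψ x := χ.hasCompactSupport.mul_right
    have hcd : ContDiff ℝ ∞ fun x => χ x * ψ x := χ.contDiff.mul hc
    obtain ⟨B, hB⟩ := hcs.exists_bound_of_continuous hcd.continuous
    obtain ⟨C, hC⟩ := hcd.lipschitzWith_of_hasCompactSupport hcs (by simp)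
    refine ⟨fun x => χ x * ψ x, B.toNNReal, C,
      fun x => (hB x).trans (Real.le_coe_toNNReal B), hC, trivial, fun x hx => ?_⟩
    have hx2 : x ∈ Metric.ball (0 : Fin d → ℝ) 2 := by
      rw [mem_ball_zero_iff]
      refine lt_of_le_of_lt ((pi_norm_le_iff_of_nonneg zero_le_one).2 fun i => ?_) one_lt_two
      have := mem_spaceDomain.1 hx i
      rw [Real.norm_eq_abs, abs_of_nonneg this.1]
      exact this.2
    filter_upwards [Metric.isOpen_ball.mem_nhds hx2] with y hy
    rw [χ.one_of_mem_closedBall (Metric.ball_subset_closedBall hy), one_mul]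
  · obtain ⟨B, hB⟩ := IntPeriodic.exists_norm_le hψ hc.continuous
    obtain ⟨C, hC⟩ := IntPeriodic.exists_lipschitzWith hψ hc
    exact ⟨ψ, B, C, hB, hC, hψ, fun x _ => EventuallyEq.rfl⟩

end Periodic

/-! ### Integration by parts on the cube -/

section Divergence

variable {d : ℕ} {S : Setting}

lemma abs_divergence_le {w : (Fin d → ℝ) → (Fin d → ℝ)} {K : ℝ≥0} (hw : LipschitzWith K w)
    (x : Fin d → ℝ) : |divergence w x| ≤ d * K := by
  refine (Finset.abs_sum_le_sum_abs _ _).trans ?_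
  have : ∀ i ∈ Finset.univ, |fderiv ℝ w x (Pi.single i 1) i| ≤ (K : ℝ) := by
    intro i _
    calc |fderiv ℝ w x (Pi.single i 1) i| ≤ ‖fderiv ℝ w x (Pi.single i 1)‖ :=
          norm_le_pi_norm (fderiv ℝ w x (Pi.single i 1)) i
      _ ≤ ‖fderiv ℝ w x‖ * ‖(Pi.single i 1 : Fin d → ℝ)‖ := ContinuousLinearMap.le_opNorm _ _
      _ ≤ K * 1 := by
          gcongr
          · exact norm_fderiv_le_of_lipschitz ℝ hw
          · refine (pi_norm_le_iff_of_nonneg zero_le_one).2 fun j => ?_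
            by_cases hj : j = i
            · subst hj; simp
            · simp [hj]
      _ = K := mul_one _
  simpa using Finset.sum_le_sum this

/-- The boundary condition for scalar functions on the whole space. -/
def ScalarBoundary : Setting → ((Fin d → ℝ) → ℝ) → Prop
  | .cube, f => ∀ x ∉ interior (spaceDomain d), f x = 0
  | .periodic, f => IntPeriodic f

/-- On the cube f extends by zero to a compactly supported Lipschitz function and is integrated by
parts against the constant 1. In the periodic case the integral is the limit of those of difference
quotients, which vanish by translation invariance. -/
lemma integral_lineDeriv_eq_zero {f : (Fin d → ℝ) → ℝ} {C : ℝ≥0} (hf : LipschitzWith C f)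
    (hb : ScalarBoundary S f) (e : Fin d → ℝ) :
    ∫ x, lineDeriv ℝ f x e ∂(muSpace d) = 0 := by
  cases S
  · have hcs : HasCompactSupport f := by
      refine HasCompactSupport.of_support_subset_isCompact (isCompact_spaceDomain (d := d)) ?_
      intro x hx
      by_contra hxd
      exact hx (hb x fun h => hxd (interior_subset h))
    -- Integration by parts reverses the direction, hence the choice of `-e`.
    have h1 := LipschitzWith.integral_lineDeriv_mul_eq (μ := volume)
      (LipschitzWith.const (1 : ℝ) : LipschitzWith 0 fun _ : Fin d → ℝ => (1 : ℝ)) hf hcs (-e)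
    have h0 : ∀ x : Fin d → ℝ, lineDeriv ℝ (fun _ : Fin d → ℝ => (1 : ℝ)) x (-e) = 0 :=
      fun x => by simp [lineDeriv]
    simp only [h0, zero_mul, integral_zero, neg_neg, mul_one] at h1
    rw [muSpace, setIntegral_eq_integral_of_ae_compl_eq_zero, ← h1]
    refine Eventually.of_forall fun x hx => ?_
    have hev : f =ᶠ[𝓝 x] fun _ => 0 := by
      filter_upwards [isCompact_spaceDomain.isClosed.isOpen_compl.mem_nhds hx] with y hy
      exact hb y fun h => hy (interior_subset h)
    rw [hev.lineDeriv_eq]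
    simp [lineDeriv]
  · have hint : Integrable ((spaceDomain d).indicator fun _ => (1 : ℝ)) volume := by
      rw [integrable_indicator_iff measurableSet_spaceDomain]
      exact integrableOn_const (isCompact_spaceDomain.measure_lt_top.ne)
    have h1 := hf.integral_inv_smul_sub_mul_tendsto_integral_lineDeriv_mul hint e
    have hrw : ∀ g : (Fin d → ℝ) → ℝ,
        ∫ x, g x * (spaceDomain d).indicator (fun _ => (1 : ℝ)) x = ∫ x, g x ∂(muSpace d) := by
      intro g
      rw [muSpace, ← integral_indicator measurableSet_spaceDomain]
      congr 1
      funext x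
      by_cases hx : x ∈ spaceDomain d <;> simp [hx]
    simp only [hrw] at h1
    refine tendsto_nhds_unique h1 ?_
    have hz : ∀ t : ℝ, ∫ x, t⁻¹ • (f (x + t • e) - f x) ∂(muSpace d) = 0 := by
      intro t
      have hcont : ∀ g : (Fin d → ℝ) → ℝ, Continuous g → Integrable g (muSpace d) :=
        fun g hg => hg.continuousOn.integrableOn_compact isCompact_spaceDomain
      rw [integral_smul, integral_sub, IntPeriodic.setIntegral_add hb, sub_self, smul_zero]
      · exact hcont _ (hf.continuous.comp (continuous_add_const _))
      · exact hcont _ hf.continuous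
    simp only [hz]
    exact tendsto_const_nhds

lemma scalarBoundary_mul {w : (Fin d → ℝ) → (Fin d → ℝ)} {φ : (Fin d → ℝ) → ℝ}
    (hw : GlobalBoundary S w) (hφ : SpacePeriodic S φ) (i : Fin d) :
    ScalarBoundary S fun x => φ x * w x i := by
  cases S
  · intro x hx
    simp only [hw x hx, Pi.zero_apply, mul_zero]
  · intro n x
    simp only [hφ n x, hw n x]

/-- The divergence theorem on the cube for a Lipschitz field that satisfies the boundary
condition. -/
theorem integral_fderiv_add_mul_divergence {w : (Fin d → ℝ) → (Fin d → ℝ)} {K : ℝ≥0}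
    (hw : LipschitzWith K w) (hwb : ∀ x, ‖w x‖ ≤ K) (hbd : GlobalBoundary S w)
    {ψ : (Fin d → ℝ) → ℝ} (hψ : SpacePeriodic S ψ) (hc : ContDiff ℝ ∞ ψ) :
    ∫ x, (fderiv ℝ ψ x (w x) + ψ x * divergence w x) ∂(muSpace d) = 0 := by
  -- ψ need not be bounded or Lipschitz away from the cube. Its replacement φ makes each product φ
  -- wᵢ globally Lipschitz without changing ψ near the cube.
  obtain ⟨φ, B, C, hB, hC, hφ, hφψ⟩ := hψ.exists_lipschitz_representative hc
  have hF : ∀ i, LipschitzWith (B * K + C * K) fun x => φ x * w x i := by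
    intro i
    refine LipschitzWith.of_dist_le_mul fun x y => ?_
    have hwi : |w x i - w y i| ≤ K * dist x y :=
      (dist_le_pi_dist (w x) (w y) i).trans (hw.dist_le_mul x y)
    have hwi' : |w y i| ≤ K := (norm_le_pi_norm (w y) i).trans (hwb y)
    have hφl : |φ x - φ y| ≤ C * dist x y := hC.dist_le_mul x y
    have hφb : |φ x| ≤ B := hB x
    calc dist (φ x * w x i) (φ y * w y i)
        = |φ x * (w x i - w y i) + (φ x - φ y) * w y i| := by
          rw [Real.dist_eq]; congr 1; ring
      _ ≤ |φ x| * |w x i - w y i| + |φ x - φ y| * |w y i| := by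
          rw [← abs_mul, ← abs_mul]; exact abs_add_le _ _
      _ ≤ B * (K * dist x y) + (C * dist x y) * K := by gcongr
      _ = _ := by push_cast; ring
  have hzero : ∀ i, ∫ x, lineDeriv ℝ (fun x => φ x * w x i) x (Pi.single i 1) ∂(muSpace d) = 0 :=
    fun i => integral_lineDeriv_eq_zero (hF i) (scalarBoundary_mul hbd hφ i) _
  have hint : ∀ i, Integrable (fun x => lineDeriv ℝ (fun x => φ x * w x i) x (Pi.single i 1))
      (muSpace d) := fun i =>
    ((hF i).locallyIntegrable_lineDeriv (μ := volume) _).integrableOn_isCompact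
      isCompact_spaceDomain
  have hsum : ∫ x, ∑ i, lineDeriv ℝ (fun x => φ x * w x i) x (Pi.single i 1) ∂(muSpace d) = 0 := by
    rw [integral_finsetSum _ fun i _ => hint i]
    exact Finset.sum_eq_zero fun i _ => hzero i
  rw [← hsum]
  refine integral_congr_ae ?_
  have hd : ∀ᵐ x ∂(muSpace d), DifferentiableAt ℝ w x :=
    ae_restrict_of_ae hw.ae_differentiableAt
  filter_upwards [hd, ae_restrict_mem measurableSet_spaceDomain] with x hx hxd
  have hφx : HasFDerivAt φ (fderiv ℝ ψ x) x :=
    ((hc.differentiable (by simp) x).hasFDerivAt).congr_of_eventuallyEq (hφψ x hxd)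
  have hline : ∀ i, lineDeriv ℝ (fun x => φ x * w x i) x (Pi.single i 1) =
      ψ x * fderiv ℝ w x (Pi.single i 1) i + w x i * fderiv ℝ ψ x (Pi.single i 1) := by
    intro i
    have hwi : HasFDerivAt (fun x => w x i)
        ((ContinuousLinearMap.proj (R := ℝ) (φ := fun _ : Fin d => ℝ) i).comp (fderiv ℝ w x)) x :=
      (hasFDerivAt_pi'.1 hx.hasFDerivAt) i
    have : HasLineDerivAt ℝ (fun x => φ x * w x i) _ x (Pi.single i 1) := (hφx.mul hwi).hasLineDerivAt (Pi.single i 1)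
    rw [this.lineDeriv, (hφψ x hxd).eq_of_nhds]
    simp
  simp only [hline, Finset.sum_add_distrib, divergence, Finset.mul_sum]
  rw [add_comm]
  congr 1
  conv_lhs => rw [pi_eq_sum_univ' (w x)]
  rw [map_sum]
  refine Finset.sum_congr rfl fun i _ => ?_
  rw [map_smul, smul_eq_mul]

end Divergence

/-! ### Integrability of the stream derivative -/

section Measurability

variable {d : ℕ} {S : Setting} {v : ℝ → (Fin d → ℝ) → (Fin d → ℝ)} {K : ℝ → ℝ≥0}

lemma ae_mem_spaceTime : ∀ᵐ z ∂(muSpaceTime d), z ∈ spaceTime d :=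
  ae_restrict_mem isCompact_spaceTime.measurableSet

lemma Continuous.memLp_spaceTime {f : ℝ × (Fin d → ℝ) → ℝ} (hf : Continuous f) (q : ℝ≥0∞) :
    MemLp f q (muSpaceTime d) := by
  obtain ⟨B, hB⟩ := (isCompact_spaceTime (d := d)).exists_bound_of_continuousOn hf.continuousOn
  refine MemLp.of_bound hf.aestronglyMeasurable B ?_
  filter_upwards [ae_mem_spaceTime] with z hz using hB z hz

lemma Continuous.memLp_space {f : (Fin d → ℝ) → ℝ} (hf : Continuous f) (q : ℝ≥0∞) :
    MemLp f q (muSpace d) := by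
  obtain ⟨B, hB⟩ := (isCompact_spaceDomain (d := d)).exists_bound_of_continuousOn hf.continuousOn
  refine MemLp.of_bound hf.aestronglyMeasurable B ?_
  filter_upwards [ae_restrict_mem measurableSet_spaceDomain] with z hz using hB z hz

lemma IsRegularVelocity.memLp_bound_spaceTime (hv : IsRegularVelocity S v K) :
    MemLp (fun z : ℝ × (Fin d → ℝ) => (K z.1 : ℝ)) 2 (muSpaceTime d) := by
  rw [muSpaceTime_eq_prod]
  exact hv.memLp_bound.comp_fst _

lemma IsRegularVelocity.measurable_classicalStreamDeriv (hv : IsRegularVelocity S v K)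
    {p : ℝ × (Fin d → ℝ) → ℝ} (hp : ContDiff ℝ ∞ p) : Measurable (classicalStreamDeriv v p) := by
  have h1 : StronglyMeasurable (fderiv ℝ p) := (hp.continuous_fderiv (by simp)).stronglyMeasurable
  have h2 : StronglyMeasurable fun z : ℝ × (Fin d → ℝ) => ((1 : ℝ), v z.1 z.2) :=
    (measurable_const.prodMk hv.measurable).stronglyMeasurable
  exact (isBoundedBilinearMap_apply.continuous.comp_stronglyMeasurable (h1.prodMk h2)).measurable

lemma IsRegularVelocity.abs_classicalStreamDeriv_le (hv : IsRegularVelocity S v K)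
    (p : ℝ × (Fin d → ℝ) → ℝ) (z : ℝ × (Fin d → ℝ)) :
    |classicalStreamDeriv v p z| ≤ ‖fderiv ℝ p z‖ * (1 + K z.1) := by
  refine (ContinuousLinearMap.le_opNorm (fderiv ℝ p z) _).trans ?_
  gcongr
  refine max_le ?_ ?_
  · simp
  · exact (hv.norm_le _ _).trans (le_add_of_nonneg_left zero_le_one)

lemma IsRegularVelocity.memLp_classicalStreamDeriv (hv : IsRegularVelocity S v K)
    {p : ℝ × (Fin d → ℝ) → ℝ} (hp : ContDiff ℝ ∞ p) :
    MemLp (classicalStreamDeriv v p) 2 (muSpaceTime d) := by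
  obtain ⟨B, hB⟩ := (isCompact_spaceTime (d := d)).exists_bound_of_continuousOn
    (hp.continuous_fderiv (by simp)).continuousOn
  have h0 : MemLp (fun z : ℝ × (Fin d → ℝ) => 1 + (K z.1 : ℝ)) 2 (muSpaceTime d) :=
    (memLp_const (1 : ℝ)).add hv.memLp_bound_spaceTime
  have h1 : MemLp (fun z : ℝ × (Fin d → ℝ) => B * (1 + (K z.1 : ℝ))) 2 (muSpaceTime d) :=
    h0.const_mul B
  refine h1.of_le (hv.measurable_classicalStreamDeriv hp).aestronglyMeasurable ?_
  filter_upwards [ae_mem_spaceTime] with z hz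
  have h2 : ‖fderiv ℝ p z‖ * (1 + K z.1) ≤ B * (1 + K z.1) :=
    mul_le_mul_of_nonneg_right (hB z hz) (by positivity)
  rw [Real.norm_eq_abs, Real.norm_eq_abs]
  exact ((hv.abs_classicalStreamDeriv_le p z).trans h2).trans (le_abs_self _)

lemma IsRegularVelocity.measurable_divergence (hv : IsRegularVelocity S v K) :
    Measurable fun z : ℝ × (Fin d → ℝ) => divergence (v z.1) z.2 := by
  have h := measurable_fderiv_of_caratheodory (f := v)
    (fun x => hv.measurable.comp (measurable_id.prodMk measurable_const))
    (fun t => (hv.lipschitz t).continuous)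
  refine Finset.measurable_fun_sum _ fun i _ => ?_
  exact (measurable_pi_apply i).comp (h.apply_continuousLinearMap (Pi.single i 1))

lemma IsRegularVelocity.memLp_divergence (hv : IsRegularVelocity S v K) :
    MemLp (fun z : ℝ × (Fin d → ℝ) => divergence (v z.1) z.2) 2 (muSpaceTime d) := by
  refine (hv.memLp_bound_spaceTime.const_mul (d : ℝ)).of_le
    hv.measurable_divergence.aestronglyMeasurable (Eventually.of_forall fun z => ?_)
  exact (abs_divergence_le (hv.lipschitz z.1) z.2).trans (le_abs_self _)

/-- The formal adjoint `divₜ(b φ)`, up to sign, is square integrable. -/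
lemma IsRegularVelocity.memLp_adjoint (hv : IsRegularVelocity S v K)
    {p : ℝ × (Fin d → ℝ) → ℝ} (hp : ContDiff ℝ ∞ p) :
    MemLp (fun z => classicalStreamDeriv v p z + p z * divergence (v z.1) z.2) 2
      (muSpaceTime d) :=
  (hv.memLp_classicalStreamDeriv hp).add
    (hv.memLp_divergence.mul (Continuous.memLp_spaceTime hp.continuous ∞))

end Measurability

/-! ### The transport identity -/

section Transport

variable {d : ℕ} {S : Setting} {v : ℝ → (Fin d → ℝ) → (Fin d → ℝ)} {K : ℝ → ℝ≥0}

lemma classicalStreamDeriv_eq {p : ℝ × (Fin d → ℝ) → ℝ} (hp : ContDiff ℝ ∞ p) (t : ℝ)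
    (x : Fin d → ℝ) : classicalStreamDeriv v p (t, x) =
      fderiv ℝ p (t, x) (1, 0) + fderiv ℝ (fun y => p (t, y)) x (v t x) := by
  have h : HasFDerivAt (fun y => p (t, y)) ((fderiv ℝ p (t, x)).comp
      (ContinuousLinearMap.inr ℝ ℝ (Fin d → ℝ))) x :=
    ((hp.differentiable (by simp) (t, x)).hasFDerivAt).comp x (hasFDerivAt_prodMk_right t x)
  rw [h.fderiv, classicalStreamDeriv]
  simp only [ContinuousLinearMap.comp_apply, ContinuousLinearMap.inr_apply, ← map_add]
  simp

/-- The transport term and the divergence term together are the spatial divergence of p v, whose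
integral vanishes. Only the time derivative remains. -/
lemma integral_space_adjoint (hv : IsRegularVelocity S v K) {p : ℝ × (Fin d → ℝ) → ℝ}
    (hp : IsSmoothUpToBoundary S p) (t : ℝ) :
    ∫ x, (classicalStreamDeriv v p (t, x) + p (t, x) * divergence (v t) x) ∂(muSpace d) =
      ∫ x, fderiv ℝ p (t, x) (1, 0) ∂(muSpace d) := by
  obtain ⟨hc, hper⟩ := isSmoothUpToBoundary_iff.1 hp
  have hct : ContDiff ℝ ∞ fun y => p (t, y) := hc.comp (contDiff_prodMk_right t)
  have hfd : Continuous (fderiv ℝ p) := hc.continuous_fderiv (by simp)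
  have h0 := integral_fderiv_add_mul_divergence (hv.lipschitz t) (hv.norm_le t) (hv.boundary t)
    (hper t) hct
  have hint1 : Integrable (fun x => fderiv ℝ p (t, x) (1, 0)) (muSpace d) :=
    (Continuous.memLp_space (by fun_prop) 1).integrable le_rfl
  have hfx : Continuous (fderiv ℝ fun y => p (t, y)) := hct.continuous_fderiv (by simp)
  have hint2 : Integrable (fun x => fderiv ℝ (fun y => p (t, y)) x (v t x)) (muSpace d) :=
    (Continuous.memLp_space (hfx.clm_apply (hv.lipschitz t).continuous) 1).integrable le_rfl
  have hdm : Measurable fun x => divergence (v t) x :=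
    hv.measurable_divergence.comp (measurable_const.prodMk measurable_id)
  have hdiv : MemLp (fun x => divergence (v t) x) 1 (muSpace d) :=
    MemLp.of_bound hdm.aestronglyMeasurable (d * K t)
      (Eventually.of_forall fun x => abs_divergence_le (hv.lipschitz t) x)
  have hint3 : Integrable (fun x => p (t, x) * divergence (v t) x) (muSpace d) :=
    (hdiv.mul (Continuous.memLp_space hct.continuous ∞)).integrable le_rfl
  simp only [classicalStreamDeriv_eq hc, add_assoc]
  have := integral_add hint1 (hint2.add hint3)
  simp only [Pi.add_apply] at this
  rw [this, h0, add_zero]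

/-- Conservation of mass along the stream, up to the source terms. -/
theorem integral_sub_integral_eq (hv : IsRegularVelocity S v K) {p : ℝ × (Fin d → ℝ) → ℝ}
    (hp : IsSmoothUpToBoundary S p) (a b : ℝ) :
    ∫ x, p (b, x) ∂(muSpace d) - ∫ x, p (a, x) ∂(muSpace d) =
      ∫ t in a..b, ∫ x, (classicalStreamDeriv v p (t, x) + p (t, x) * divergence (v t) x)
        ∂(muSpace d) := by
  obtain ⟨hc, hper⟩ := isSmoothUpToBoundary_iff.1 hp
  have hfd : Continuous (fderiv ℝ p) := hc.continuous_fderiv (by simp)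
  simp only [integral_space_adjoint hv hp]
  have hswap : ∫ t in a..b, ∫ x, fderiv ℝ p (t, x) (1, 0) ∂(muSpace d) =
      ∫ x, (∫ t in a..b, fderiv ℝ p (t, x) (1, 0)) ∂(muSpace d) := by
    refine intervalIntegral_integral_swap ?_
    have hcont : Continuous fun z : ℝ × (Fin d → ℝ) => fderiv ℝ p z (1, 0) := by fun_prop
    have : IntegrableOn (fun z : ℝ × (Fin d → ℝ) => fderiv ℝ p z (1, 0))
        (Set.uIcc a b ×ˢ spaceDomain d) (volume.prod volume) :=
      hcont.continuousOn.integrableOn_compact (isCompact_uIcc.prod isCompact_spaceDomain)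
    have h2 := this.mono_set (Set.prod_mono_left (t := spaceDomain d) Set.uIoc_subset_uIcc)
    rw [IntegrableOn, ← Measure.prod_restrict] at h2
    exact h2
  rw [hswap, ← integral_sub]
  · refine integral_congr_ae (Eventually.of_forall fun x => ?_)
    have hder : ∀ t ∈ Set.uIcc a b, HasDerivAt (fun t => p (t, x)) (fderiv ℝ p (t, x) (1, 0)) t :=
      fun t _ => ((hc.differentiable (by simp) (t, x)).hasFDerivAt).comp_hasDerivAt t
        ((hasDerivAt_id t).prodMk (hasDerivAt_const t x))
    exact (intervalIntegral.integral_eq_sub_of_hasDerivAt hder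
      (Continuous.intervalIntegrable (by fun_prop) _ _)).symm
  · exact (Continuous.memLp_space (hc.continuous.comp (by fun_prop)) 1).integrable le_rfl
  · exact (Continuous.memLp_space (hc.continuous.comp (by fun_prop)) 1).integrable le_rfl

end Transport

/-! ### Grönwall's inequality in integral form -/

/-- The bound does not depend on t. A large c makes the weighted integral small, which allows
absorption in Grönwall's inequality. -/
lemma integral_exp_le {c t : ℝ} (hc : 0 < c) :
    ∫ r in (0 : ℝ)..t, Real.exp (c * (r - t)) ≤ c⁻¹ := by
  have hder : ∀ r ∈ Set.uIcc 0 t,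
      HasDerivAt (fun r => c⁻¹ * Real.exp (c * (r - t))) (Real.exp (c * (r - t))) r := by
    intro r _
    have h := ((((hasDerivAt_id r).sub_const t).const_mul c).exp).const_mul c⁻¹
    refine h.congr_deriv ?_
    simp only [id_eq]
    field_simp
  rw [intervalIntegral.integral_eq_sub_of_hasDerivAt hder
    (Continuous.intervalIntegrable (by fun_prop) _ _)]
  have : 0 ≤ c⁻¹ * Real.exp (c * (0 - t)) := by positivity
  simp only [sub_self, mul_zero, Real.exp_zero, mul_one]
  linarith

lemma intervalIntegrable_of_integrable_muTime {f : ℝ → ℝ} (hf : Integrable f muTime) {a b : ℝ}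
    (ha : a ∈ Set.Icc (0 : ℝ) 1) (hb : b ∈ Set.Icc (0 : ℝ) 1) :
    IntervalIntegrable f volume a b :=
  (intervalIntegrable_iff.2 (IntegrableOn.mono_set hf
    (Set.uIoc_subset_uIcc.trans (Set.uIcc_subset_Icc ha hb))))

lemma intervalIntegral_le_integral_muTime {f : ℝ → ℝ} (hf : Integrable f muTime)
    (h0 : ∀ t, 0 ≤ f t) {t : ℝ} (ht : t ∈ Set.Icc (0 : ℝ) 1) :
    ∫ r in (0 : ℝ)..t, f r ≤ ∫ r, f r ∂muTime := by
  rw [intervalIntegral.integral_of_le ht.1]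
  exact setIntegral_mono_set hf (Eventually.of_forall h0)
    (LE.le.eventuallyLE (Set.Ioc_subset_Icc_self.trans (Set.Icc_subset_Icc_right ht.2)))

/-- Grönwall's inequality in integral form, with a square integrable coefficient. -/
theorem exists_gronwall_bound {k : ℝ → ℝ} (hk : MemLp k 2 muTime) (hk0 : ∀ t, 0 ≤ k t) :
    ∃ C : ℝ, 0 ≤ C ∧ ∀ (E : ℝ → ℝ) (A : ℝ), ContinuousOn E (Set.Icc 0 1) →
      (∀ t ∈ Set.Icc (0 : ℝ) 1, 0 ≤ E t) →
      (∀ t ∈ Set.Icc (0 : ℝ) 1, E t ≤ A + ∫ r in (0 : ℝ)..t, k r * E r) →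
      ∀ t ∈ Set.Icc (0 : ℝ) 1, E t ≤ C * A := by
  have hk2 : Integrable (fun t => k t ^ 2) muTime := hk.integrable_sq
  have hk1 : Integrable k muTime := hk.integrable one_le_two
  set Q := ∫ t, k t ^ 2 ∂muTime with hQ
  have hQ0 : 0 ≤ Q := integral_nonneg fun t => sq_nonneg _
  -- This rate ensures Q / (2a) ≤ 1/8.
  set a := 4 * Q + 1 with ha
  have ha0 : 0 < a := by positivity
  refine ⟨2 * Real.exp a, by positivity, fun E A hEc hE0 hE t ht => ?_⟩
  have h00 : (0 : ℝ) ∈ Set.Icc (0 : ℝ) 1 := by simp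
  have hA0 : 0 ≤ A := by
    have := (hE0 0 h00).trans (hE 0 h00)
    simpa using this
  -- At a maximum point t₀ of exp(-a t) E(t) one has E(r) ≤ exp(a (r - t₀)) E(t₀) for all r.
  obtain ⟨t₀, ht₀, hmax⟩ := isCompact_Icc.exists_isMaxOn (Set.nonempty_Icc.2 (zero_le_one (α := ℝ)))
    (f := fun t => Real.exp (-(a * t)) * E t)
    ((Continuous.continuousOn (by fun_prop)).mul hEc)
  set s := Real.exp (-(a * t₀)) * E t₀ with hs
  have hs0 : 0 ≤ s := mul_nonneg (Real.exp_pos _).le (hE0 _ ht₀)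
  have hEs : ∀ r ∈ Set.Icc (0 : ℝ) 1, E r ≤ Real.exp (a * r) * s := by
    intro r hr
    have h1 : Real.exp (-(a * r)) * E r ≤ s := hmax hr
    calc E r = Real.exp (a * r) * (Real.exp (-(a * r)) * E r) := by
          rw [← mul_assoc, ← Real.exp_add]; simp
      _ ≤ _ := by gcongr
  have hst : Real.exp (a * t₀) * s = E t₀ := by
    rw [hs, ← mul_assoc, ← Real.exp_add]; simp
  have hsub : Set.Icc 0 t₀ ⊆ Set.Icc (0 : ℝ) 1 := Set.Icc_subset_Icc_right ht₀.2
  -- Young's inequality separates k from the exponential. Integrated over [0, t₀], the two terms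
  -- give at most 1/8 + 1/4 times E(t₀), so the integral is absorbed by the left-hand side at t₀.
  have hpt : ∀ r ∈ Set.Icc 0 t₀, k r * E r ≤
      E t₀ * ((2 * a)⁻¹ * k r ^ 2 + a / 2 * Real.exp (2 * a * (r - t₀))) := by
    intro r hr
    have h1 : k r * E r ≤ k r * (Real.exp (a * r) * s) := by
      have := hk0 r
      have := hEs r (hsub hr)
      gcongr
    have h2 : k r * (Real.exp (a * r) * s) = E t₀ * (k r * Real.exp (a * (r - t₀))) := by
      rw [← hst]
      have : Real.exp (a * r) = Real.exp (a * t₀) * Real.exp (a * (r - t₀)) := by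
        rw [← Real.exp_add]; congr 1; ring
      rw [this]; ring
    have h3 : k r * Real.exp (a * (r - t₀)) ≤
        (2 * a)⁻¹ * k r ^ 2 + a / 2 * Real.exp (2 * a * (r - t₀)) := by
      have : Real.exp (2 * a * (r - t₀)) = Real.exp (a * (r - t₀)) ^ 2 := by
        rw [← Real.exp_nat_mul]; congr 1; push_cast; ring
      rw [this]
      have h4 := sq_nonneg (k r - a * Real.exp (a * (r - t₀)))
      have h5 : (2 * a)⁻¹ * k r ^ 2 + a / 2 * Real.exp (a * (r - t₀)) ^ 2 -
          k r * Real.exp (a * (r - t₀)) =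
          (2 * a)⁻¹ * (k r - a * Real.exp (a * (r - t₀))) ^ 2 := by
        field_simp; ring
      have h6 : 0 ≤ (2 * a)⁻¹ * (k r - a * Real.exp (a * (r - t₀))) ^ 2 := by positivity
      linarith
    have := hE0 t₀ ht₀
    calc k r * E r ≤ _ := h1
      _ = _ := h2
      _ ≤ _ := by gcongr
  have hint1 : IntervalIntegrable (fun r => k r * E r) volume 0 t₀ :=
    intervalIntegrable_of_integrable_muTime
      (IntegrableOn.mul_continuousOn hk1 hEc isCompact_Icc) h00 ht₀
  have hint2 : IntervalIntegrable (fun r => (2 * a)⁻¹ * k r ^ 2) volume 0 t₀ :=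
    (intervalIntegrable_of_integrable_muTime hk2 h00 ht₀).const_mul _
  have hint3 : IntervalIntegrable (fun r => a / 2 * Real.exp (2 * a * (r - t₀))) volume 0 t₀ :=
    Continuous.intervalIntegrable (by fun_prop) _ _
  have hbound : ∫ r in (0 : ℝ)..t₀, k r * E r ≤ E t₀ * (1 / 2) := by
    refine (intervalIntegral.integral_mono_on ht₀.1 hint1
      ((hint2.add hint3).const_mul _) hpt).trans ?_
    rw [intervalIntegral.integral_const_mul, intervalIntegral.integral_add hint2 hint3,
      intervalIntegral.integral_const_mul, intervalIntegral.integral_const_mul]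
    have h1 := intervalIntegral_le_integral_muTime hk2 (fun t => sq_nonneg (k t)) ht₀
    have h2 := integral_exp_le (c := 2 * a) (t := t₀) (by positivity)
    have h3 : (2 * a)⁻¹ * ∫ r in (0 : ℝ)..t₀, k r ^ 2 ≤ 1 / 8 := by
      rw [← hQ] at h1
      calc (2 * a)⁻¹ * ∫ r in (0 : ℝ)..t₀, k r ^ 2 ≤ (2 * a)⁻¹ * Q := by gcongr
        _ ≤ 1 / 8 := by
          rw [inv_mul_le_iff₀ (by positivity)]; linarith
    have h4 : a / 2 * ∫ r in (0 : ℝ)..t₀, Real.exp (2 * a * (r - t₀)) ≤ 1 / 4 := by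
      calc _ ≤ a / 2 * (2 * a)⁻¹ := by gcongr
        _ = 1 / 4 := by field_simp; norm_num
    have := hE0 t₀ ht₀
    gcongr
    linarith
  have hEt₀ : E t₀ ≤ 2 * A := by linarith [hE t₀ ht₀]
  have hsA : s ≤ 2 * A := by
    have h1 : Real.exp (-(a * t₀)) ≤ 1 := Real.exp_le_one_iff.2 (by nlinarith [ht₀.1])
    calc s ≤ 1 * E t₀ := mul_le_mul_of_nonneg_right h1 (hE0 _ ht₀)
      _ ≤ _ := by linarith
  calc E t ≤ Real.exp (a * t) * s := hEs t ht
    _ ≤ Real.exp a * (2 * A) := by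
        gcongr
        nlinarith [ht.2]
    _ = _ := by ring

/-! ### The energy estimate -/

section Energy

variable {d : ℕ} {S : Setting} {v : ℝ → (Fin d → ℝ) → (Fin d → ℝ)} {K : ℝ → ℝ≥0}

lemma IsRegularVelocity.memLp_classicalStreamDeriv_slice (hv : IsRegularVelocity S v K)
    {p : ℝ × (Fin d → ℝ) → ℝ} (hp : ContDiff ℝ ∞ p) (t : ℝ) :
    MemLp (fun x => classicalStreamDeriv v p (t, x)) 2 (muSpace d) := by
  have hfd : Continuous (fderiv ℝ p) := hp.continuous_fderiv (by simp)
  exact Continuous.memLp_space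
    ((hfd.comp (by fun_prop)).clm_apply (continuous_const.prodMk (hv.lipschitz t).continuous)) 2

lemma IsSmoothUpToBoundary.mul {p q : ℝ × (Fin d → ℝ) → ℝ} (hp : IsSmoothUpToBoundary S p)
    (hq : IsSmoothUpToBoundary S q) : IsSmoothUpToBoundary S fun z => p z * q z := by
  rw [isSmoothUpToBoundary_iff] at hp hq ⊢
  exact ⟨hp.1.mul hq.1, fun t => (hp.2 t).comp₂ (hq.2 t) (· * ·)⟩

lemma classicalStreamDeriv_mul {p q : ℝ × (Fin d → ℝ) → ℝ} (hp : ContDiff ℝ ∞ p)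
    (hq : ContDiff ℝ ∞ q) (z : ℝ × (Fin d → ℝ)) :
    classicalStreamDeriv v (fun z => p z * q z) z =
      p z * classicalStreamDeriv v q z + classicalStreamDeriv v p z * q z := by
  have h : HasFDerivAt (fun z => p z * q z) _ z :=
    (hp.differentiable (by simp) z).hasFDerivAt.mul (hq.differentiable (by simp) z).hasFDerivAt
  rw [classicalStreamDeriv, h.fderiv]
  simp [classicalStreamDeriv, mul_comm]

/-- The energy estimate: a smooth function is controlled, uniformly in time, by its initial values
and its stream derivative. -/
theorem IsRegularVelocity.exists_energy_bound (hv : IsRegularVelocity S v K) :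
    ∃ C : ℝ, 0 ≤ C ∧ ∀ p : ℝ × (Fin d → ℝ) → ℝ, IsSmoothUpToBoundary S p →
      ∀ t ∈ Set.Icc (0 : ℝ) 1, ∫ x, p (t, x) ^ 2 ∂(muSpace d) ≤
        C * (∫ x, p (0, x) ^ 2 ∂(muSpace d) +
          ∫ z, classicalStreamDeriv v p z ^ 2 ∂(muSpaceTime d)) := by
  -- The 1 comes from 2 p Dp ≤ (Dp)² + p², and d K(t) bounds the divergence of the velocity.
  have hk : MemLp (fun t => 1 + d * (K t : ℝ)) 2 muTime :=
    (memLp_const (1 : ℝ)).add (hv.memLp_bound.const_mul (d : ℝ))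
  obtain ⟨C, hC0, hC⟩ := exists_gronwall_bound hk (fun t => by positivity)
  refine ⟨C, hC0, fun p hp => hC (fun t => ∫ x, p (t, x) ^ 2 ∂(muSpace d)) _ ?_ ?_ ?_⟩
  · have hc := (isSmoothUpToBoundary_iff.1 hp).1.continuous
    exact (continuous_parametric_integral_of_continuous
      (f := fun t x => p (t, x) ^ 2) (by fun_prop) isCompact_spaceDomain).continuousOn
  · exact fun t _ => integral_nonneg fun x => sq_nonneg _
  intro t ht
  have hc := (isSmoothUpToBoundary_iff.1 hp).1
  -- Conservation of mass is applied to p², whose stream derivative is 2 p Dp.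
  have hsq : IsSmoothUpToBoundary S fun z => p z * p z := hp.mul hp
  have hid := integral_sub_integral_eq hv hsq 0 t
  have h00 : (0 : ℝ) ∈ Set.Icc (0 : ℝ) 1 := by simp
  have hG : Integrable (fun r => ∫ x, classicalStreamDeriv v p (r, x) ^ 2 ∂(muSpace d)) muTime := by
    have := (hv.memLp_classicalStreamDeriv hc).integrable_sq
    rw [muSpaceTime_eq_prod] at this
    exact this.integral_prod_left
  have hGle : ∫ r in (0 : ℝ)..t, ∫ x, classicalStreamDeriv v p (r, x) ^ 2 ∂(muSpace d) ≤
      ∫ z, classicalStreamDeriv v p z ^ 2 ∂(muSpaceTime d) := by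
    refine (intervalIntegral_le_integral_muTime hG
      (fun r => integral_nonneg fun x => sq_nonneg _) ht).trans_eq ?_
    have := (hv.memLp_classicalStreamDeriv hc).integrable_sq
    rw [muSpaceTime_eq_prod] at this ⊢
    exact (integral_prod _ this).symm
  have hH : Integrable (fun r => ∫ x, (classicalStreamDeriv v (fun z => p z * p z) (r, x) +
      p (r, x) * p (r, x) * divergence (v r) x) ∂(muSpace d)) muTime := by
    have := (hv.memLp_adjoint (isSmoothUpToBoundary_iff.1 hsq).1).integrable one_le_two
    rw [muSpaceTime_eq_prod] at this
    exact this.integral_prod_left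
  have hE : Integrable (fun r => (1 + d * (K r : ℝ)) * ∫ x, p (r, x) ^ 2 ∂(muSpace d)) muTime := by
    have hcont := hc.continuous
    exact IntegrableOn.mul_continuousOn (hk.integrable one_le_two)
      (continuous_parametric_integral_of_continuous
        (f := fun t x => p (t, x) ^ 2) (by fun_prop) isCompact_spaceDomain).continuousOn
      isCompact_Icc
  have hmono : ∀ r ∈ Set.Icc 0 t, ∫ x, (classicalStreamDeriv v (fun z => p z * p z) (r, x) +
      p (r, x) * p (r, x) * divergence (v r) x) ∂(muSpace d) ≤
      ∫ x, classicalStreamDeriv v p (r, x) ^ 2 ∂(muSpace d) +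
        (1 + d * (K r : ℝ)) * ∫ x, p (r, x) ^ 2 ∂(muSpace d) := by
    intro r _
    have hi1 := (hv.memLp_classicalStreamDeriv_slice hc r).integrable_sq
    have hi2 : Integrable (fun x => p (r, x) ^ 2) (muSpace d) :=
      (Continuous.memLp_space (by have := hc.continuous; fun_prop) 1).integrable le_rfl
    rw [← integral_const_mul, ← integral_add hi1 (hi2.const_mul _)]
    have hdm : Measurable fun x => divergence (v r) x :=
      hv.measurable_divergence.comp (measurable_const.prodMk measurable_id)
    have hdiv : MemLp (fun x => divergence (v r) x) 1 (muSpace d) :=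
      MemLp.of_bound hdm.aestronglyMeasurable (d * K r)
        (Eventually.of_forall fun x => abs_divergence_le (hv.lipschitz r) x)
    have hi3 : Integrable (fun x => p (r, x) * p (r, x) * divergence (v r) x) (muSpace d) :=
      (hdiv.mul (Continuous.memLp_space
        (f := fun x => p (r, x) * p (r, x)) (by have := hc.continuous; fun_prop) ∞)).integrable le_rfl
    have hi4 := (hv.memLp_classicalStreamDeriv_slice (isSmoothUpToBoundary_iff.1 hsq).1 r).integrable one_le_two
    refine integral_mono (hi4.add hi3) (hi1.add (hi2.const_mul _)) fun x => ?_
    simp only [classicalStreamDeriv_mul hc hc]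
    have h1 := (abs_le.1 (abs_divergence_le (hv.lipschitz r) x)).2
    have h2 := sq_nonneg (classicalStreamDeriv v p (r, x) - p (r, x))
    have h3 := mul_le_mul_of_nonneg_left h1 (sq_nonneg (p (r, x)))
    nlinarith
  have key := intervalIntegral.integral_mono_on ht.1
    (intervalIntegrable_of_integrable_muTime hH h00 ht)
    ((intervalIntegrable_of_integrable_muTime hG h00 ht).add
      (intervalIntegrable_of_integrable_muTime hE h00 ht)) hmono
  rw [intervalIntegral.integral_add (intervalIntegrable_of_integrable_muTime hG h00 ht)
    (intervalIntegrable_of_integrable_muTime hE h00 ht), ← hid] at key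
  simp only [← pow_two] at key
  linarith

end Energy

/-! ### Periodization -/

section Periodization

variable {d : ℕ} {S : Setting}

lemma eventually_fract_notMem {k : Set ℝ} (hk : IsClosed k) (hk01 : k ⊆ Set.Ioo 0 1) {a : ℝ}
    (ha : Int.fract a = 0) : ∀ᶠ y in 𝓝 a, Int.fract y ∉ k := by
  obtain ⟨m, rfl⟩ : ∃ m : ℤ, (m : ℝ) = a := Int.fract_eq_zero_iff.1 ha
  have h0 : ∀ᶠ y in 𝓝 (0 : ℝ), y ∉ k :=
    hk.isOpen_compl.mem_nhds fun h => lt_irrefl _ (hk01 h).1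
  have h1 : ∀ᶠ y in 𝓝 (1 : ℝ), y ∉ k :=
    hk.isOpen_compl.mem_nhds fun h => lt_irrefl _ (hk01 h).2
  have t0 : Tendsto (fun y : ℝ => y - m) (𝓝 (m : ℝ)) (𝓝 0) := by
    have : Continuous fun y : ℝ => y - m := by fun_prop
    simpa using this.tendsto (m : ℝ)
  have t1 : Tendsto (fun y : ℝ => y - m + 1) (𝓝 (m : ℝ)) (𝓝 1) := by
    simpa using t0.add_const 1
  filter_upwards [t0.eventually h0, t1.eventually h1,
    Ioo_mem_nhds (sub_one_lt (m : ℝ)) (lt_add_one (m : ℝ))] with y hy0 hy1 hy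
  rcases le_or_gt (m : ℝ) y with hm | hm
  · have : ⌊y⌋ = m := Int.floor_eq_iff.2 ⟨hm, hy.2⟩
    rw [Int.fract, this]
    exact hy0
  · have : ⌊y⌋ = m - 1 := Int.floor_eq_iff.2 ⟨by push_cast; exact hy.1.le, by push_cast; linarith⟩
    rw [Int.fract, this]
    push_cast
    rwa [← sub_add]

lemma eventually_floor_eq {a : ℝ} (ha : Int.fract a ≠ 0) : ∀ᶠ y in 𝓝 a, ⌊y⌋ = ⌊a⌋ := by
  have h1 : (⌊a⌋ : ℝ) < a := lt_of_le_of_ne (Int.floor_le a) fun h => ha (by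
    rw [Int.fract, ← h]; simp)
  filter_upwards [Ioo_mem_nhds h1 (Int.lt_floor_add_one a)] with y hy
  exact Int.floor_eq_iff.2 ⟨hy.1.le, hy.2⟩

/-- Where no coordinate is an integer, the fractional part is locally a translation. Near an integer
value of a coordinate its fractional part is close to 0 or 1, hence outside the projection of `k`.
This is why periodization stays smooth across the integer grid. -/
lemma eventually_fract_cases {k : Set (Fin d → ℝ)} (hk : IsCompact k)
    (hki : k ⊆ interior (spaceDomain d)) (x₀ : Fin d → ℝ) :
    (∃ n : Fin d → ℝ, ∀ᶠ x in 𝓝 x₀, (fun i => Int.fract (x i)) = x - n) ∨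
      ∀ᶠ x in 𝓝 x₀, (fun i => Int.fract (x i)) ∉ k := by
  by_cases h : ∃ i, Int.fract (x₀ i) = 0
  · obtain ⟨i, hi⟩ := h
    right
    have hk' : IsCompact ((fun x : Fin d → ℝ => x i) '' k) := hk.image (continuous_apply i)
    have := eventually_fract_notMem hk'.isClosed (by
      rintro _ ⟨x, hx, rfl⟩
      exact mem_interior_spaceDomain.1 (hki hx) i) hi
    filter_upwards [(continuous_apply i).continuousAt.eventually this] with x hx hxk
    exact hx ⟨_, hxk, rfl⟩
  · push Not at h
    left
    refine ⟨fun i => ⌊x₀ i⌋, ?_⟩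
    have : ∀ i, ∀ᶠ x in 𝓝 x₀, ⌊x i⌋ = ⌊x₀ i⌋ := fun i =>
      (continuous_apply i).continuousAt.eventually (eventually_floor_eq (h i))
    filter_upwards [eventually_all.2 this] with x hx
    funext i
    simp [Int.fract, hx i]

/-- The periodization of a smooth function supported in the interior of the cube is smooth. -/
lemma contDiff_comp_fract {g : ℝ × (Fin d → ℝ) → ℝ} (hg : ContDiff ℝ ∞ g)
    {k : Set (Fin d → ℝ)} (hk : IsCompact k) (hki : k ⊆ interior (spaceDomain d))
    (hsupp : ∀ z, z.2 ∉ k → g z = 0) :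
    ContDiff ℝ ∞ fun z : ℝ × (Fin d → ℝ) => g (z.1, fun i => Int.fract (z.2 i)) := by
  rw [contDiff_iff_contDiffAt]
  intro z₀
  rcases eventually_fract_cases hk hki z₀.2 with ⟨n, hn⟩ | hn
  · have h1 : ContDiff ℝ ∞ fun z : ℝ × (Fin d → ℝ) => g (z.1, z.2 - n) :=
      hg.comp (contDiff_fst.prodMk (contDiff_snd.sub contDiff_const))
    refine h1.contDiffAt.congr_of_eventuallyEq ?_
    filter_upwards [continuous_snd.continuousAt.eventually hn] with z hz
    rw [hz]
  · refine (contDiffAt_const (c := (0 : ℝ))).congr_of_eventuallyEq ?_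
    filter_upwards [continuous_snd.continuousAt.eventually hn] with z hz
    exact hsupp _ hz

lemma intPeriodic_comp_fract {F : Type*} (g : (Fin d → ℝ) → F) :
    IntPeriodic fun x => g fun i => Int.fract (x i) := by
  intro n x
  simp

lemma fract_eq_self_of_mem_interior {x : Fin d → ℝ} (hx : x ∈ interior (spaceDomain d)) :
    (fun i => Int.fract (x i)) = x := by
  funext i
  have := mem_interior_spaceDomain.1 hx i
  exact Int.fract_eq_self.2 ⟨this.1.le, this.2⟩

lemma interior_spaceTime :
    interior (spaceTime d) = Set.Ioo 0 1 ×ˢ interior (spaceDomain d) := by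
  rw [spaceTime, interior_prod_eq, interior_Icc]

lemma ae_mem_interior_spaceTime : ∀ᵐ z ∂(muSpaceTime d), z ∈ interior (spaceTime d) := by
  have ht : ∀ᵐ t ∂muTime, t ∈ Set.Ioo (0 : ℝ) 1 := by
    rw [muTime, ← restrict_Ioo_eq_restrict_Icc]
    exact ae_restrict_mem measurableSet_Ioo
  filter_upwards [ae_spaceTime_of_ae_time ht, ae_spaceTime_of_ae_space ae_mem_interior]
    with z h1 h2
  rw [interior_spaceTime]
  exact ⟨h1, h2⟩

/-- A smooth function supported in the interior of the space-time domain is the restriction of a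
test function of either setting. -/
lemma exists_isTest_eq {ψ : ℝ × (Fin d → ℝ) → ℝ} (hψ : ContDiff ℝ ∞ ψ) (hc : HasCompactSupport ψ)
    (hs : tsupport ψ ⊆ interior (spaceTime d)) :
    ∃ φ, IsTest S φ ∧ ∀ z ∈ interior (spaceTime d), φ z = ψ z := by
  cases S
  · exact ⟨ψ, ⟨hψ, hc, hs⟩, fun _ _ => rfl⟩
  rw [interior_spaceTime] at hs
  have hz : ∀ z, z.2 ∉ Prod.snd '' tsupport ψ → ψ z = 0 := fun z hz =>
    image_eq_zero_of_notMem_tsupport fun h => hz ⟨z, h, rfl⟩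
  have hsm := contDiff_comp_fract hψ (hc.isCompact.image continuous_snd)
    (by rintro _ ⟨z, hz, rfl⟩; exact (hs hz).2) hz
  refine ⟨_, ⟨hsm, fun t => intPeriodic_comp_fract fun x => ψ (t, x), ?_⟩, fun z hz => ?_⟩
  · rcases (tsupport ψ).eq_empty_or_nonempty with he | hne
    · refine ⟨1 / 2, 1 / 2, by norm_num, by norm_num, fun t _ x => ?_⟩
      exact image_eq_zero_of_notMem_tsupport (by simp [he])
    · obtain ⟨z₁, hz₁, h1⟩ := hc.isCompact.exists_isMinOn hne continuous_fst.continuousOn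
      obtain ⟨z₂, hz₂, h2⟩ := hc.isCompact.exists_isMaxOn hne continuous_fst.continuousOn
      refine ⟨z₁.1, z₂.1, (hs hz₁).1.1, (hs hz₂).1.2, fun t ht x => ?_⟩
      refine image_eq_zero_of_notMem_tsupport fun h => ht ⟨h1 h, h2 h⟩
  · rw [interior_spaceTime] at hz
    simp only [fract_eq_self_of_mem_interior hz.2]

lemma IsTest.isSmoothUpToBoundary {φ : ℝ × (Fin d → ℝ) → ℝ} (h : IsTest S φ) :
    IsSmoothUpToBoundary S φ := by
  cases S
  · exact h.1
  · exact ⟨h.1, h.2.1⟩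

lemma IsTest.eq_zero_of_notMem {φ : ℝ × (Fin d → ℝ) → ℝ} (h : IsTest S φ) {t : ℝ}
    (ht : t ∉ Set.Ioo (0 : ℝ) 1) (x : Fin d → ℝ) : φ (t, x) = 0 := by
  cases S
  · refine image_eq_zero_of_notMem_tsupport fun hm => ht ?_
    have := h.2.2 hm
    rw [interior_spaceTime] at this
    exact this.1
  · obtain ⟨a, b, ha, hb, hz⟩ := h.2.2
    exact hz t (fun hm => ht ⟨ha.trans_le hm.1, hm.2.trans_lt hb⟩) x

/-- Boundary data for which the transport equation is solved approximately. -/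
def IsSmoothDatum (S : Setting) (I : (Fin d → ℝ) → ℝ) : Prop :=
  ContDiff ℝ ∞ I ∧ SpacePeriodic S I ∧ ∃ C : ℝ≥0, LipschitzWith C I

lemma exists_isSmoothDatum_eq {η : (Fin d → ℝ) → ℝ} (hη : ContDiff ℝ ∞ η)
    (hc : HasCompactSupport η) (hs : tsupport η ⊆ interior (spaceDomain d)) :
    ∃ I, IsSmoothDatum S I ∧ ∀ x ∈ interior (spaceDomain d), I x = η x := by
  cases S
  · exact ⟨η, ⟨hη, trivial, hη.lipschitzWith_of_hasCompactSupport hc (by simp)⟩, fun _ _ => rfl⟩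
  have hsm := contDiff_comp_fract (g := fun z => η z.2) (hη.comp contDiff_snd) hc.isCompact hs
    (fun z hz => image_eq_zero_of_notMem_tsupport hz)
  have hsm' : ContDiff ℝ ∞ fun x : Fin d → ℝ => η fun i => Int.fract (x i) :=
    hsm.comp (contDiff_prodMk_right 0)
  have hper := intPeriodic_comp_fract η
  exact ⟨_, ⟨hsm', hper, hper.exists_lipschitzWith hsm'⟩,
    fun x hx => by rw [fract_eq_self_of_mem_interior hx]⟩

/-- The classes in `L²` of the smooth boundary data. -/
def smoothData (d : ℕ) (S : Setting) : Submodule ℝ (L2Space d) where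
  carrier := {h | ∃ I, IsSmoothDatum S I ∧ h =ᵐ[muSpace d] I}
  add_mem' := by
    rintro f g ⟨I, ⟨h1, h2, C, h3⟩, h4⟩ ⟨J, ⟨k1, k2, D, k3⟩, k4⟩
    refine ⟨fun x => I x + J x, ⟨h1.add k1, h2.comp₂ k2 (· + ·), C + D, h3.add k3⟩, ?_⟩
    filter_upwards [Lp.coeFn_add f g, h4, k4] with x a b c
    rw [a, Pi.add_apply, b, c]
  zero_mem' := ⟨fun _ => 0, ⟨contDiff_const, spacePeriodic_const 0, 0, LipschitzWith.const 0⟩,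
    Lp.coeFn_zero _ _ _⟩
  smul_mem' := by
    rintro c f ⟨I, ⟨h1, h2, C, h3⟩, h4⟩
    refine ⟨fun x => c * I x, ⟨contDiff_const.mul h1, h2.comp (c * ·), ‖c‖₊ * C, ?_⟩, ?_⟩
    · exact (lipschitzWith_smul c).comp h3
    · filter_upwards [Lp.coeFn_smul c f, h4] with x a b
      rw [a, Pi.smul_apply, b, smul_eq_mul]

/-- An element orthogonal to all smooth data annihilates every smooth function with compact support
in the interior, so it vanishes by the fundamental lemma of the calculus of variations. -/
theorem smoothData_dense : (smoothData d S).topologicalClosure = ⊤ := by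
  rw [Submodule.topologicalClosure_eq_top_iff, Submodule.eq_bot_iff]
  intro h hh
  have hint : Integrable h (muSpace d) := (Lp.memLp h).integrable one_le_two
  have hae := isOpen_interior.ae_eq_zero_of_integral_contDiff_smul_eq_zero
    (U := interior (spaceDomain d)) (hint.locallyIntegrable.locallyIntegrableOn _) (by
      intro η hη hc hs
      obtain ⟨I, hI, hIη⟩ := exists_isSmoothDatum_eq (S := S) hη hc hs
      have hmem : MemLp I 2 (muSpace d) := Continuous.memLp_space hI.1.continuous 2
      have h0 := (Submodule.mem_orthogonal _ _).1 hh (hmem.toLp I) ⟨I, hI, hmem.coeFn_toLp⟩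
      rw [L2.inner_def] at h0
      rw [← h0]
      refine integral_congr_ae ?_
      filter_upwards [hmem.coeFn_toLp, ae_mem_interior] with x hx hxi
      rw [hx, hIη x hxi]
      simp [mul_comm])
  refine (Lp.eq_zero_iff_ae_eq_zero (f := h)).2 ?_
  filter_upwards [hae, ae_mem_interior] with x hx hxi using hx hxi

end Periodization

/-! ### Weak stream derivatives -/

section Weak

variable {d : ℕ} {S : Setting} {v : ℝ → (Fin d → ℝ) → (Fin d → ℝ)} {K : ℝ → ℝ≥0}

/-- The difference annihilates all test functions. In the periodic setting functions supported in
the interior are first periodized to become test functions, so the fundamental lemma applies in both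
settings. -/
theorem IsWeakStreamDeriv.unique {f g₁ g₂ : L2SpaceTime d} (h₁ : IsWeakStreamDeriv S v f g₁)
    (h₂ : IsWeakStreamDeriv S v f g₂) : g₁ = g₂ := by
  rw [← sub_eq_zero, Lp.eq_zero_iff_ae_eq_zero]
  have hint : Integrable (g₁ - g₂ : L2SpaceTime d) (muSpaceTime d) :=
    (Lp.memLp (g₁ - g₂)).integrable one_le_two
  have hae := isOpen_interior.ae_eq_zero_of_integral_contDiff_smul_eq_zero
    (U := interior (spaceTime d)) (hint.locallyIntegrable.locallyIntegrableOn _) (by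
      intro ψ hψ hc hs
      obtain ⟨φ, hφ, hφψ⟩ := exists_isTest_eq (S := S) hψ hc hs
      have e := (h₁ φ hφ).symm.trans (h₂ φ hφ)
      have hφm : MemLp φ 2 (muSpaceTime d) :=
        Continuous.memLp_spaceTime (isSmoothUpToBoundary_iff.1 hφ.isSmoothUpToBoundary).1.continuous 2
      have i₁ : Integrable (fun z => g₁ z * φ z) (muSpaceTime d) :=
        (Lp.memLp g₁).integrable_mul hφm
      have i₂ : Integrable (fun z => g₂ z * φ z) (muSpaceTime d) :=
        (Lp.memLp g₂).integrable_mul hφm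
      have e2 : ∫ z, (g₁ z * φ z - g₂ z * φ z) ∂(muSpaceTime d) = 0 := by
        rw [integral_sub i₁ i₂]; linarith
      rw [← e2]
      refine integral_congr_ae ?_
      filter_upwards [Lp.coeFn_sub g₁ g₂, ae_mem_interior_spaceTime] with z hz hzi
      rw [hz, ← hφψ z hzi, Pi.sub_apply, smul_eq_mul]
      ring)
  filter_upwards [hae, ae_mem_interior_spaceTime] with x hx hxi using hx hxi

theorem IsWeakStreamDeriv.streamDeriv_eq {f g : L2SpaceTime d} (h : IsWeakStreamDeriv S v f g) :
    streamDeriv S v f = g := by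
  have hex : ∃ g : L2SpaceTime d, IsWeakStreamDeriv S v f g := ⟨g, h⟩
  rw [streamDeriv, dif_pos hex]
  exact hex.choose_spec.unique h

lemma integral_adjoint_eq_zero (hv : IsRegularVelocity S v K) {p : ℝ × (Fin d → ℝ) → ℝ}
    (hp : IsSmoothUpToBoundary S p) (h0 : ∀ x, p (0, x) = 0) (h1 : ∀ x, p (1, x) = 0) :
    ∫ z, (classicalStreamDeriv v p z + p z * divergence (v z.1) z.2) ∂(muSpaceTime d) = 0 := by
  have hint := (hv.memLp_adjoint (isSmoothUpToBoundary_iff.1 hp).1).integrable one_le_two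
  have hid := integral_sub_integral_eq hv hp 0 1
  rw [muSpaceTime_eq_prod] at hint ⊢
  rw [integral_prod _ hint]
  simp only [h0, h1, sub_self] at hid
  rw [muTime, integral_Icc_eq_integral_Ioc, ← intervalIntegral.integral_of_le zero_le_one]
  exact hid.symm

/-- Conservation of mass is applied to the product of p with a test function, which vanishes at both
end times. The product rule turns it into the weak identity. -/
theorem isWeakStreamDeriv_of_smooth (hv : IsRegularVelocity S v K) {p : ℝ × (Fin d → ℝ) → ℝ}
    (hp : IsSmoothUpToBoundary S p) {f g : L2SpaceTime d} (hf : f =ᵐ[muSpaceTime d] p)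
    (hg : g =ᵐ[muSpaceTime d] classicalStreamDeriv v p) : IsWeakStreamDeriv S v f g := by
  intro φ hφ
  have hφs := hφ.isSmoothUpToBoundary
  have hpc := (isSmoothUpToBoundary_iff.1 hp).1
  have hφc := (isSmoothUpToBoundary_iff.1 hφs).1
  have h0 := integral_adjoint_eq_zero hv (hp.mul hφs)
    (fun x => by simp [hφ.eq_zero_of_notMem (t := 0) (by simp)])
    (fun x => by simp [hφ.eq_zero_of_notMem (t := 1) (by simp)])
  have hi1 : Integrable (fun z => f z * (classicalStreamDeriv v φ z +
      φ z * divergence (v z.1) z.2)) (muSpaceTime d) :=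
    (Lp.memLp f).integrable_mul (hv.memLp_adjoint hφc)
  have hi2 : Integrable (fun z => g z * φ z) (muSpaceTime d) :=
    (Lp.memLp g).integrable_mul (Continuous.memLp_spaceTime hφc.continuous 2)
  rw [eq_neg_iff_add_eq_zero, ← integral_add hi1 hi2, ← h0]
  refine integral_congr_ae ?_
  filter_upwards [hf, hg] with z h1 h2
  rw [h1, h2, classicalStreamDeriv_mul hpc hφc]
  ring

/-- The adjoint expression of a test function is square integrable because the velocity bound is in
L². So each tested identity compares inner products with fixed elements of L² and defines a closed
set. -/
theorem isClosed_isWeakStreamDeriv (hv : IsRegularVelocity S v K) :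
    IsClosed {q : L2SpaceTime d × L2SpaceTime d | IsWeakStreamDeriv S v q.1 q.2} := by
  have : {q : L2SpaceTime d × L2SpaceTime d | IsWeakStreamDeriv S v q.1 q.2} =
      ⋂ φ : {φ : ℝ × (Fin d → ℝ) → ℝ // IsTest S φ}, {q | ∫ z, q.1 z *
        (classicalStreamDeriv v φ z + φ.1 z * divergence (v z.1) z.2) ∂(muSpaceTime d) =
          - ∫ z, q.2 z * φ.1 z ∂(muSpaceTime d)} := by
    ext q
    simp [IsWeakStreamDeriv]
  rw [this]
  refine isClosed_iInter fun ⟨φ, hφ⟩ => ?_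
  have hφc := (isSmoothUpToBoundary_iff.1 hφ.isSmoothUpToBoundary).1
  have hpair : ∀ {m : ℝ × (Fin d → ℝ) → ℝ} (hm : MemLp m 2 (muSpaceTime d)) (f : L2SpaceTime d),
      ∫ z, f z * m z ∂(muSpaceTime d) = inner ℝ (hm.toLp m) f := by
    intro m hm f
    rw [L2.inner_def]
    refine integral_congr_ae ?_
    filter_upwards [hm.coeFn_toLp] with z hz
    simp [hz]
  simp only [hpair (hv.memLp_adjoint hφc), hpair (Continuous.memLp_spaceTime hφc.continuous 2)]
  exact isClosed_eq (by fun_prop) (by fun_prop)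

end Weak

/-! ### Smooth time profiles and spatial mollification -/

/-- A profile that is constant outside [0,1] lets consecutive time steps join smoothly, while moving
the points at the right speed asks for slope 1. Both are possible if the slope is close to 1 only in
L²: s is the normalized primitive of a bump that equals 1 except near the ends. -/
lemma exists_time_profile {η : ℝ} (hη : 0 < η) :
    ∃ s : ℝ → ℝ, ContDiff ℝ ∞ s ∧ (∀ t ≤ 0, s t = 0) ∧ (∀ t, 1 ≤ t → s t = 1) ∧
      (∀ t, s t ∈ Set.Icc (0 : ℝ) 1) ∧ ∫ t in (0 : ℝ)..1, (1 - deriv s t) ^ 2 ≤ η := by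
  set δ := min (1 / 8) (η / 4) with hδ
  have hδ0 : 0 < δ := by positivity
  have hδ8 : δ ≤ 1 / 8 := min_le_left _ _
  have hδη : δ ≤ η / 4 := min_le_right _ _
  let χ : ContDiffBump (1 / 2 : ℝ) := ⟨1 / 2 - δ, 1 / 2, by linarith, by linarith⟩
  have hχc : Continuous χ := χ.continuous
  have hχi : ∀ a b, IntervalIntegrable χ volume a b := fun a b => hχc.intervalIntegrable a b
  have hout : ∀ t, t ∉ Set.Ioo (0 : ℝ) 1 → χ t = 0 := by
    intro t ht
    refine χ.zero_of_le_dist ?_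
    change 1 / 2 ≤ dist t (1 / 2)
    rw [Real.dist_eq]
    by_contra h
    push Not at h
    rw [abs_lt] at h
    exact ht ⟨by linarith [h.1], by linarith [h.2]⟩
  set c := ∫ t in (0 : ℝ)..1, χ t with hc
  have hcle : c ≤ 1 := by
    have := intervalIntegral.integral_mono_on zero_le_one (hχi 0 1)
      (intervalIntegrable_const (c := (1 : ℝ))) fun t _ => χ.le_one (x := t)
    simpa using this
  have hcge : 1 - 2 * δ ≤ c := by
    have h1 : ∫ t in δ..(1 - δ), χ t = 1 - 2 * δ := by
      have : ∫ t in δ..(1 - δ), χ t = ∫ _ in δ..(1 - δ), (1 : ℝ) := by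
        refine intervalIntegral.integral_congr fun t ht => ?_
        rw [Set.uIcc_of_le (by linarith)] at ht
        refine χ.one_of_mem_closedBall ?_
        change dist t (1 / 2) ≤ 1 / 2 - δ
        rw [Real.dist_eq, abs_le]
        exact ⟨by linarith [ht.1], by linarith [ht.2]⟩
      rw [this]
      simp
      ring
    rw [← h1]
    exact intervalIntegral.integral_mono_interval hδ0.le (by linarith) (by linarith)
      (Eventually.of_forall fun t => χ.nonneg) (hχi 0 1)
  have hc0 : 0 < c := by linarith
  set s : ℝ → ℝ := fun t => c⁻¹ * ∫ r in (0 : ℝ)..t, χ r with hs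
  have hder : ∀ t, HasDerivAt s (c⁻¹ * χ t) t := fun t =>
    (intervalIntegral.integral_hasDerivAt_right (hχi 0 t)
      (hχc.stronglyMeasurableAtFilter _ _) hχc.continuousAt).const_mul _
  have hds : deriv s = fun t => c⁻¹ * χ t := funext fun t => (hder t).deriv
  have hle0 : ∀ t ≤ 0, s t = 0 := by
    intro t ht
    have : ∫ r in (0 : ℝ)..t, χ r = ∫ _ in (0 : ℝ)..t, (0 : ℝ) :=
      intervalIntegral.integral_congr fun r hr => by
        rw [Set.uIcc_of_ge ht] at hr
        exact hout r fun h => absurd h.1 (not_lt.2 hr.2)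
    simp [hs, this]
  have hge1 : ∀ t, 1 ≤ t → s t = 1 := by
    intro t ht
    have h1 : ∫ r in (1 : ℝ)..t, χ r = ∫ _ in (1 : ℝ)..t, (0 : ℝ) :=
      intervalIntegral.integral_congr fun r hr => by
        rw [Set.uIcc_of_le ht] at hr
        exact hout r fun h => absurd h.2 (not_lt.2 hr.1)
    have h2 := intervalIntegral.integral_add_adjacent_intervals (hχi 0 1) (hχi 1 t)
    simp only [hs, ← h2, h1, intervalIntegral.integral_zero, add_zero, ← hc]
    exact inv_mul_cancel₀ hc0.ne'
  have hmono : Monotone s := monotone_of_deriv_nonneg (fun t => (hder t).differentiableAt)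
    fun t => by rw [hds]; exact mul_nonneg (inv_nonneg.2 hc0.le) χ.nonneg
  refine ⟨s, ?_, hle0, hge1, fun t => ⟨?_, ?_⟩, ?_⟩
  · rw [contDiff_infty_iff_deriv, hds]
    exact ⟨fun t => (hder t).differentiableAt, contDiff_const.mul χ.contDiff⟩
  · rcases le_total t 0 with h | h
    · rw [hle0 t h]
    · rw [← hle0 0 le_rfl]; exact hmono h
  · rcases le_total t 1 with h | h
    · rw [← hge1 1 le_rfl]; exact hmono h
    · rw [hge1 t h]
  · rw [hds]
    -- Since χ² ≤ χ, the integral is at most 1 + (c⁻² - 2c⁻¹) c = c⁻¹ - 1, and 1 - 2δ ≤ c with δ ≤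
    -- 1/8 gives c⁻¹ - 1 ≤ 4δ ≤ η.
    have h1 : ∫ t in (0 : ℝ)..1, (1 - c⁻¹ * χ t) ^ 2 ≤
        ∫ t in (0 : ℝ)..1, (1 + (c⁻¹ ^ 2 - 2 * c⁻¹) * χ t) := by
      refine intervalIntegral.integral_mono_on zero_le_one
        (Continuous.intervalIntegrable (by fun_prop) _ _)
        (Continuous.intervalIntegrable (by fun_prop) _ _) fun t _ => ?_
      have h0 := χ.nonneg (x := t)
      have h1 := χ.le_one (x := t)
      have h2 : χ t ^ 2 ≤ χ t := by nlinarith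
      have h3 := mul_le_mul_of_nonneg_left h2 (sq_nonneg c⁻¹)
      nlinarith
    refine h1.trans ?_
    rw [intervalIntegral.integral_add intervalIntegrable_const ((hχi 0 1).const_mul _),
      intervalIntegral.integral_const_mul, ← hc]
    have h2 : (c⁻¹ ^ 2 - 2 * c⁻¹) * c = c⁻¹ - 2 := by field_simp
    rw [h2]
    have h3 : c⁻¹ ≤ 1 + 4 * δ := by
      rw [inv_le_iff_one_le_mul₀ hc0]
      nlinarith
    simp only [intervalIntegral.integral_const, sub_zero, smul_eq_mul, one_mul]
    linarith

/-- A bounded Lipschitz field is uniformly approximated by smooth ones with the same bounds. -/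
lemma exists_smooth_field_approx {d : ℕ} {S : Setting} {w : (Fin d → ℝ) → (Fin d → ℝ)} {κ : ℝ≥0}
    (hw : LipschitzWith κ w) (hb : ∀ x, ‖w x‖ ≤ κ) (hper : SpacePeriodic S w) {η : ℝ}
    (hη : 0 < η) :
    ∃ w' : (Fin d → ℝ) → (Fin d → ℝ), ContDiff ℝ ∞ w' ∧ LipschitzWith κ w' ∧
      (∀ x, ‖w' x‖ ≤ κ) ∧ SpacePeriodic S w' ∧ ∀ x, ‖w' x - w x‖ ≤ η := by
  -- The mollification radius: a κ-Lipschitz field varies by at most κδ ≤ η over this distance.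
  set δ := η / (κ + 1) with hδ
  have hδ0 : 0 < δ := by positivity
  have hκδ : κ * δ ≤ η := by
    rw [hδ, mul_div_assoc', div_le_iff₀ (by positivity)]
    nlinarith [κ.2]
  let χ : ContDiffBump (0 : Fin d → ℝ) := ⟨δ / 2, δ, by positivity, by linarith⟩
  let ρ := χ.normed volume
  have hρc : Continuous ρ := χ.continuous_normed
  have hρs : HasCompactSupport ρ := χ.hasCompactSupport_normed
  have hρ0 : ∀ y, 0 ≤ ρ y := χ.nonneg_normed
  have hρ1 : ∫ y, ρ y = 1 := χ.integral_normed
  have hρi : Integrable ρ := hρc.integrable_of_hasCompactSupport hρs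
  have hint : ∀ f : (Fin d → ℝ) → (Fin d → ℝ), Continuous f → Integrable fun y => ρ y • f y :=
    fun f hf => (hρc.smul hf).integrable_of_hasCompactSupport hρs.smul_right
  -- An average against the probability density ρ inherits any bound on the integrand. The sup
  -- bound, the Lipschitz constant and the error estimate all reduce to this.
  have hbound : ∀ (f : (Fin d → ℝ) → (Fin d → ℝ)) (B : ℝ), (∀ y, ‖f y‖ ≤ B) →
      ‖∫ y, ρ y • f y‖ ≤ B := by
    intro f B hf
    refine (norm_integral_le_of_norm_le (hρi.mul_const B) (Eventually.of_forall fun y => ?_)).trans ?_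
    · rw [norm_smul, Real.norm_of_nonneg (hρ0 y)]
      exact mul_le_mul_of_nonneg_left (hf y) (hρ0 y)
    · rw [integral_mul_const, hρ1, one_mul]
  have hform : ∀ x, (convolution ρ w (ContinuousLinearMap.lsmul ℝ ℝ) volume) x =
      ∫ y, ρ y • w (x - y) := fun x => rfl
  have hcx : ∀ x, Continuous fun y => w (x - y) := fun x =>
    hw.continuous.comp (continuous_const.sub continuous_id)
  refine ⟨convolution ρ w (ContinuousLinearMap.lsmul ℝ ℝ) volume, ?_, ?_, ?_, ?_, ?_⟩
  · exact hρs.contDiff_convolution_left _ χ.contDiff_normed hw.continuous.locallyIntegrable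
  · refine LipschitzWith.of_dist_le_mul fun x z => ?_
    rw [dist_eq_norm, hform, hform, ← integral_sub (hint _ (hcx x)) (hint _ (hcx z))]
    simp only [← smul_sub]
    refine hbound _ _ fun y => ?_
    rw [← dist_eq_norm]
    refine (hw.dist_le_mul _ _).trans_eq ?_
    rw [dist_sub_right]
  · exact fun x => hbound _ _ fun y => hb _
  · cases S
    · trivial
    · intro n x
      rw [hform, hform]
      congr 1
      funext y
      rw [← hper n (x - y)]
      congr 2
      abel
  · intro x
    have hwx : w x = ∫ y, ρ y • w x := by rw [integral_smul_const, hρ1, one_smul]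
    rw [hwx, hform, ← integral_sub (hint _ (hcx x)) (hint _ continuous_const)]
    simp only [← smul_sub]
    have heq : ∫ y, ρ y • (w (x - y) - w x) =
        ∫ y, ρ y • ((Metric.ball 0 δ).indicator (fun y => w (x - y) - w x) y) := by
      congr 1
      funext y
      by_cases hy : y ∈ Metric.ball (0 : Fin d → ℝ) δ
      · rw [Set.indicator_of_mem hy]
      · have : ρ y = 0 := by
          rw [← Function.notMem_support, χ.support_normed_eq]
          exact hy
        simp [this]
    rw [heq]
    refine hbound _ _ fun y => ?_
    by_cases hy : y ∈ Metric.ball (0 : Fin d → ℝ) δ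
    · rw [Set.indicator_of_mem hy, ← dist_eq_norm]
      refine (hw.dist_le_mul _ _).trans (le_trans ?_ hκδ)
      have : dist (x - y) x = ‖y‖ := by rw [dist_eq_norm]; simp
      rw [this]
      rw [mem_ball_zero_iff] at hy
      gcongr
    · rw [Set.indicator_of_notMem hy, norm_zero]
      exact hη.le

/-! ### Averages over the intervals of a uniform partition -/

/-- The mean of `f` over the `k`-th of the intervals of length `1 / N`. -/
noncomputable def stepMean (N : ℕ) (f : ℝ → ℝ) (k : ℕ) : ℝ :=
  N * ∫ r in (k / N : ℝ)..((k + 1) / N : ℝ), f r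

/-- The piecewise constant function with the values `stepMean N f`. -/
noncomputable def stepFun (N : ℕ) (f : ℝ → ℝ) (t : ℝ) : ℝ := stepMean N f ⌊N * t⌋₊

section StepMean

variable {N : ℕ} {f g : ℝ → ℝ}

lemma eLpNorm_two_eq {α : Type*} [MeasurableSpace α] {μ : Measure α} {f : α → ℝ}
    (hf : MemLp f 2 μ) : eLpNorm f 2 μ = ENNReal.ofReal (√(∫ x, f x ^ 2 ∂μ)) := by
  rw [hf.eLpNorm_eq_integral_rpow_norm two_ne_zero ENNReal.ofNat_ne_top, Real.sqrt_eq_rpow]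
  simp

lemma div_mem_Icc {k : ℕ} (hk : k ≤ N) : (k / N : ℝ) ∈ Set.Icc (0 : ℝ) 1 :=
  ⟨by positivity, div_le_one_of_le₀ (by exact_mod_cast hk) (by positivity)⟩

lemma succ_div_mem_Icc {k : ℕ} (hk : k < N) : ((k + 1) / N : ℝ) ∈ Set.Icc (0 : ℝ) 1 := by
  have := div_mem_Icc (Nat.succ_le_of_lt hk)
  push_cast at this
  exact this

lemma div_le_succ_div (N k : ℕ) : (k / N : ℝ) ≤ (k + 1) / N := by gcongr; linarith

lemma intervalIntegrable_step (hf : Integrable f muTime) {k : ℕ} (hk : k < N) :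
    IntervalIntegrable f volume (k / N) ((k + 1) / N) :=
  intervalIntegrable_of_integrable_muTime hf (div_mem_Icc hk.le) (succ_div_mem_Icc hk)

lemma stepMean_sub (hf : Integrable f muTime) (hg : Integrable g muTime) {k : ℕ} (hk : k < N) :
    stepMean N (fun t => f t - g t) k = stepMean N f k - stepMean N g k := by
  simp only [stepMean]
  rw [intervalIntegral.integral_sub (intervalIntegrable_step hf hk) (intervalIntegrable_step hg hk)]
  ring

lemma abs_stepMean_le (hg : Integrable g muTime) (hfg : ∀ t, |f t| ≤ g t) {k : ℕ}
    (hk : k < N) : |stepMean N f k| ≤ stepMean N g k := by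
  rw [stepMean, abs_mul, Nat.abs_cast]
  refine mul_le_mul_of_nonneg_left ?_ (Nat.cast_nonneg N)
  exact intervalIntegral.norm_integral_le_of_norm_le (f := f) (div_le_succ_div N k)
    (Eventually.of_forall fun t _ => hfg t) (intervalIntegrable_step hg hk)

lemma stepMean_const_mul (c : ℝ) (k : ℕ) :
    stepMean N (fun t => f t * c) k = stepMean N f k * c := by
  simp only [stepMean, intervalIntegral.integral_mul_const]
  ring

lemma stepMean_nonneg (hf : ∀ t, 0 ≤ f t) (k : ℕ) : 0 ≤ stepMean N f k :=
  mul_nonneg (Nat.cast_nonneg N)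
    (intervalIntegral.integral_nonneg (div_le_succ_div N k) fun t _ => hf t)

/-- This is nonnegativity of the variance: the integral of (f - m)² is expanded for the mean m. -/
lemma stepMean_sq_le (hf : MemLp f 2 muTime) {k : ℕ} (hk : k < N) :
    stepMean N f k ^ 2 ≤ N * ∫ r in (k / N : ℝ)..((k + 1) / N : ℝ), f r ^ 2 := by
  have hN : (0 : ℝ) < N := by exact_mod_cast (Nat.zero_le k).trans_lt hk
  set m := stepMean N f k with hm
  have h1 := intervalIntegrable_step (hf.integrable one_le_two) hk
  have h2 := intervalIntegrable_step hf.integrable_sq hk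
  have h0 : 0 ≤ ∫ r in (k / N : ℝ)..((k + 1) / N : ℝ), (f r - m) ^ 2 :=
    intervalIntegral.integral_nonneg (div_le_succ_div N k) fun t _ => sq_nonneg _
  have hexp : ∫ r in (k / N : ℝ)..((k + 1) / N : ℝ), (f r - m) ^ 2 =
      (∫ r in (k / N : ℝ)..((k + 1) / N : ℝ), f r ^ 2) -
        2 * m * (∫ r in (k / N : ℝ)..((k + 1) / N : ℝ), f r) + m ^ 2 / N := by
    have : ∀ r, (f r - m) ^ 2 = (f r ^ 2 - 2 * m * f r) + m ^ 2 := fun r => by ring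
    simp only [this]
    rw [intervalIntegral.integral_add (h2.sub (h1.const_mul _)) intervalIntegrable_const,
      intervalIntegral.integral_sub h2 (h1.const_mul _), intervalIntegral.integral_const_mul,
      intervalIntegral.integral_const, smul_eq_mul]
    congr 1
    field_simp
    ring
  have hmi : (∫ r in (k / N : ℝ)..((k + 1) / N : ℝ), f r) = m / N := by
    rw [hm, stepMean]; field_simp
  rw [hexp, hmi] at h0
  have h3 : m ^ 2 / N ≤ ∫ r in (k / N : ℝ)..((k + 1) / N : ℝ), f r ^ 2 := by
    have : 2 * m * (m / N) = 2 * (m ^ 2 / N) := by ring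
    linarith
  rwa [div_le_iff₀' hN] at h3

lemma integral_muTime_eq_sum (hf : Integrable f muTime) (hN : 0 < N) :
    ∫ t, f t ∂muTime = ∑ k ∈ Finset.range N, ∫ r in (k / N : ℝ)..((k + 1) / N : ℝ), f r := by
  have hN' : (N : ℝ) ≠ 0 := by exact_mod_cast hN.ne'
  have h := intervalIntegral.sum_integral_adjacent_intervals (f := f) (μ := volume)
    (a := fun k : ℕ => (k / N : ℝ)) (n := N) (fun k hk => by
      simpa using intervalIntegrable_step hf hk)
  simp only [Nat.cast_zero, zero_div, div_self hN', Nat.cast_add, Nat.cast_one] at h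
  rw [h, muTime, integral_Icc_eq_integral_Ioc, intervalIntegral.integral_of_le zero_le_one]

lemma floor_eq_of_mem {k : ℕ} (hN : 0 < N) {t : ℝ}
    (ht : t ∈ Set.Ioo (k / N : ℝ) ((k + 1) / N : ℝ)) : ⌊N * t⌋₊ = k := by
  have hN' : (0 : ℝ) < N := by exact_mod_cast hN
  have h1 := (div_lt_iff₀' hN').1 ht.1
  have h2 := (lt_div_iff₀' hN').1 ht.2
  exact (Nat.floor_eq_iff ((Nat.cast_nonneg k).trans h1.le)).2 ⟨h1.le, h2⟩

lemma floor_lt_of_mem (hN : 0 < N) {t : ℝ} (ht : t ∈ Set.Ico (0 : ℝ) 1) : ⌊N * t⌋₊ < N := by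
  have hN' : (0 : ℝ) < N := by exact_mod_cast hN
  rw [Nat.floor_lt (by have := ht.1; positivity)]
  nlinarith [ht.2]

/-- The endpoint t = 1 is discarded because there the index `⌊N * t⌋₊` equals N, beyond the last
interval. -/
lemma ae_mem_Ico : ∀ᵐ t ∂muTime, t ∈ Set.Ico (0 : ℝ) 1 := by
  rw [muTime, ← restrict_Ico_eq_restrict_Icc]
  exact ae_restrict_mem measurableSet_Ico

lemma measurable_comp_floor (G : ℕ → ℝ) : Measurable fun t : ℝ => G ⌊N * t⌋₊ :=
  measurable_from_top.comp (Nat.measurable_floor.comp (measurable_const.mul measurable_id))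

lemma memLp_comp_floor (hN : 0 < N) (G : ℕ → ℝ) (q : ℝ≥0∞) :
    MemLp (fun t : ℝ => G ⌊N * t⌋₊) q muTime := by
  refine MemLp.of_bound (measurable_comp_floor G).aestronglyMeasurable
    (∑ k ∈ Finset.range N, |G k|) ?_
  filter_upwards [ae_mem_Ico] with t ht
  exact Finset.single_le_sum (f := fun k => |G k|) (fun k _ => abs_nonneg _)
    (Finset.mem_range.2 (floor_lt_of_mem hN ht))

lemma memLp_stepFun (hN : 0 < N) (f : ℝ → ℝ) (q : ℝ≥0∞) : MemLp (stepFun N f) q muTime :=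
  memLp_comp_floor hN _ q

lemma integral_comp_floor {G : ℕ → ℝ} (hN : 0 < N) :
    ∫ t, G ⌊N * t⌋₊ ∂muTime = ∑ k ∈ Finset.range N, G k / N := by
  rw [integral_muTime_eq_sum ((memLp_comp_floor hN G 1).integrable le_rfl) hN]
  refine Finset.sum_congr rfl fun k _ => ?_
  have : ∫ r in (k / N : ℝ)..((k + 1) / N : ℝ), G ⌊N * r⌋₊ =
      ∫ _ in (k / N : ℝ)..((k + 1) / N : ℝ), G k := by
    rw [intervalIntegral.integral_of_le (div_le_succ_div N k),
      intervalIntegral.integral_of_le (div_le_succ_div N k), integral_Ioc_eq_integral_Ioo,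
      integral_Ioc_eq_integral_Ioo]
    exact setIntegral_congr_fun measurableSet_Ioo fun t ht => by simp only [floor_eq_of_mem hN ht]
  rw [this, intervalIntegral.integral_const, smul_eq_mul]
  ring

/-- Averaging is a contraction of L², by `stepMean_sq_le` on each interval. This makes the
approximation by step functions stable under L² limits. -/
lemma eLpNorm_stepFun_le (hN : 0 < N) (hf : MemLp f 2 muTime) :
    eLpNorm (stepFun N f) 2 muTime ≤ eLpNorm f 2 muTime := by
  rw [eLpNorm_two_eq hf, eLpNorm_two_eq (memLp_stepFun hN f 2)]
  refine ENNReal.ofReal_le_ofReal (Real.sqrt_le_sqrt ?_)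
  have hN' : (0 : ℝ) < N := by exact_mod_cast hN
  rw [integral_muTime_eq_sum hf.integrable_sq hN]
  have : ∀ t, stepFun N f t ^ 2 = (fun k => stepMean N f k ^ 2) ⌊N * t⌋₊ := fun t => rfl
  simp only [this]
  rw [integral_comp_floor (G := fun k => stepMean N f k ^ 2) hN]
  refine Finset.sum_le_sum fun k hk => ?_
  rw [div_le_iff₀' hN']
  exact stepMean_sq_le hf (Finset.mem_range.1 hk)

lemma abs_sub_stepMean_le (hf : Continuous f) (hN : 0 < N) {k : ℕ} {t B : ℝ}
    (h : ∀ r ∈ Set.Icc (k / N : ℝ) ((k + 1) / N : ℝ), |f t - f r| ≤ B) :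
    |f t - stepMean N f k| ≤ B := by
  have hN' : (0 : ℝ) < N := by exact_mod_cast hN
  have h1 : f t - stepMean N f k = N * ∫ r in (k / N : ℝ)..((k + 1) / N : ℝ), (f t - f r) := by
    rw [intervalIntegral.integral_sub intervalIntegrable_const (hf.intervalIntegrable _ _),
      intervalIntegral.integral_const, smul_eq_mul, stepMean]
    field_simp
    ring
  rw [h1, abs_mul, Nat.abs_cast]
  have h2 : |∫ r in (k / N : ℝ)..((k + 1) / N : ℝ), (f t - f r)| ≤
      B * |((k + 1) / N : ℝ) - k / N| := by
    refine intervalIntegral.norm_integral_le_of_norm_le_const (f := fun r => f t - f r)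
      fun r hr => ?_
    rw [Set.uIoc_of_le (div_le_succ_div N k)] at hr
    exact h r (Set.Ioc_subset_Icc_self hr)
  have h3 : ((k + 1) / N : ℝ) - k / N = (N : ℝ)⁻¹ := by field_simp; ring
  rw [h3, abs_of_pos (inv_pos.2 hN')] at h2
  calc _ ≤ N * (B * (N : ℝ)⁻¹) := by gcongr
    _ = B := by field_simp

lemma eventually_abs_sub_stepFun_le (hf : Continuous f) {B : ℝ} (hB : 0 < B) :
    ∀ᶠ N : ℕ in atTop, ∀ t ∈ Set.Ico (0 : ℝ) 1, |f t - stepFun N f t| ≤ B := by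
  have huc := isCompact_Icc.uniformContinuousOn_of_continuous (hf.continuousOn (s := Set.Icc (0 : ℝ) 1))
  obtain ⟨δ, hδ, h⟩ := Metric.uniformContinuousOn_iff.1 huc B hB
  obtain ⟨M, hM⟩ := exists_nat_gt (1 / δ)
  filter_upwards [eventually_ge_atTop (M + 1)] with N hN t ht
  have hN0 : 0 < N := by omega
  have hN' : (0 : ℝ) < N := by exact_mod_cast hN0
  have hk := floor_lt_of_mem hN0 ht
  refine abs_sub_stepMean_le hf hN0 fun r hr => ?_
  have h1 := Nat.floor_le (show (0 : ℝ) ≤ N * t by have := ht.1; positivity)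
  have h2 := Nat.lt_floor_add_one ((N : ℝ) * t)
  have ha : (⌊(N : ℝ) * t⌋₊ : ℝ) / N ≤ t := (div_le_iff₀' hN').2 h1
  have hb : t < (⌊(N : ℝ) * t⌋₊ + 1 : ℝ) / N := (lt_div_iff₀' hN').2 h2
  have hlen : ((⌊(N : ℝ) * t⌋₊ + 1 : ℝ) / N) - (⌊(N : ℝ) * t⌋₊ : ℝ) / N = (N : ℝ)⁻¹ := by
    field_simp; ring
  have hNδ : (N : ℝ)⁻¹ < δ := by
    rw [inv_lt_comm₀ hN' hδ, ← one_div]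
    refine hM.trans ?_
    exact_mod_cast (by omega : M < N)
  have hr01 : r ∈ Set.Icc (0 : ℝ) 1 :=
    ⟨(div_mem_Icc hk.le).1.trans hr.1, hr.2.trans (succ_div_mem_Icc hk).2⟩
  have := h t ⟨ht.1, ht.2.le⟩ r hr01 (by
    rw [Real.dist_eq, abs_lt]
    constructor <;> linarith [hr.1, hr.2])
  exact this.le

/-- Convergence is uniform for continuous functions. Density of these in L² and the contraction
property give the general case, with three errors of size ε/3. -/
theorem tendsto_eLpNorm_sub_stepFun (hf : MemLp f 2 muTime) :
    Tendsto (fun N => eLpNorm (fun t => f t - stepFun N f t) 2 muTime) atTop (𝓝 0) := by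
  refine ENNReal.tendsto_nhds_zero.2 fun ε hε => ?_
  have hε3 : 0 < ε / 3 := ENNReal.div_pos hε.ne' (by simp)
  obtain ⟨g, hg, hgm⟩ := hf.exists_boundedContinuous_eLpNorm_sub_le (by simp) hε3.ne'
  obtain ⟨r, hr0, hr⟩ := ENNReal.lt_iff_exists_nnreal_btwn.1 hε3
  have hr0' : 0 < (r : ℝ) := by exact_mod_cast hr0
  filter_upwards [eventually_abs_sub_stepFun_le g.continuous hr0', eventually_gt_atTop 0]
    with N hN hN0
  have hfg : MemLp (fun t => f t - g t) 2 muTime := hf.sub hgm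
  have h3 : eLpNorm (stepFun N fun t => f t - g t) 2 muTime ≤ ε / 3 :=
    (eLpNorm_stepFun_le hN0 hfg).trans hg
  have h2 : eLpNorm (fun t => g t - stepFun N g t) 2 muTime ≤ ε / 3 := by
    refine (eLpNorm_le_of_ae_bound (C := r) ?_).trans ?_
    · filter_upwards [ae_mem_Ico] with t ht using hN t ht
    · simpa using hr.le
  have hae : (fun t => f t - stepFun N f t) =ᵐ[muTime]
      ((f - ⇑g) + fun t => g t - stepFun N g t) - stepFun N fun t => f t - g t := by
    filter_upwards [ae_mem_Ico] with t ht
    simp only [Pi.add_apply, Pi.sub_apply, stepFun]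
    rw [stepMean_sub (hf.integrable one_le_two) (hgm.integrable one_le_two)
      (floor_lt_of_mem hN0 ht)]
    ring
  rw [eLpNorm_congr_ae hae]
  have m2 : MemLp (fun t => g t - stepFun N g t) 2 muTime := hgm.sub (memLp_stepFun hN0 g 2)
  refine (eLpNorm_sub_le ((hf.sub hgm).add m2).1 (memLp_stepFun hN0 _ 2).1 one_le_two).trans ?_
  refine (add_le_add_left (eLpNorm_add_le (hf.sub hgm).1 m2.1 one_le_two) _).trans ?_
  calc _ ≤ ε / 3 + ε / 3 + ε / 3 := by gcongr
    _ = ε := ENNReal.add_thirds ε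

end StepMean

/-! ### Approximate solutions of the transport equation -/

/-- Transport of the datum `I` through the successive time steps: in the `k`-th interval of length
`1 / N` the points are moved along the field `w k`, with the time profile `s`. -/
noncomputable def transportStep {d : ℕ} (N : ℕ) (s : ℝ → ℝ) (w : ℕ → (Fin d → ℝ) → (Fin d → ℝ))
    (I : (Fin d → ℝ) → ℝ) : ℕ → ℝ × (Fin d → ℝ) → ℝ
  | 0 => fun z => I z.2
  | k + 1 => fun z =>
      transportStep N s w I k (z.1, z.2 - ((N : ℝ)⁻¹ * s (N * z.1 - k)) • w k z.2)

section TransportStep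

variable {d : ℕ} {S : Setting} {N : ℕ} {s : ℝ → ℝ} {w : ℕ → (Fin d → ℝ) → (Fin d → ℝ)}
  {I : (Fin d → ℝ) → ℝ} {κ : ℕ → ℝ≥0} {L : ℝ≥0}

lemma transportStep_contDiff (hs : ContDiff ℝ ∞ s) (hw : ∀ k, ContDiff ℝ ∞ (w k))
    (hI : ContDiff ℝ ∞ I) (k : ℕ) : ContDiff ℝ ∞ (transportStep N s w I k) := by
  induction k with
  | zero => exact hI.comp contDiff_snd
  | succ k ih =>
    have h1 : ContDiff ℝ ∞ fun z : ℝ × (Fin d → ℝ) => (N : ℝ)⁻¹ * s (N * z.1 - k) :=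
      contDiff_const.mul (hs.comp ((contDiff_const.mul contDiff_fst).sub contDiff_const))
    have h2 : ContDiff ℝ ∞ fun z : ℝ × (Fin d → ℝ) => w k z.2 := (hw k).comp contDiff_snd
    exact ih.comp (contDiff_fst.prodMk (contDiff_snd.sub (h1.smul h2)))

lemma transportStep_spacePeriodic (hw : ∀ k, SpacePeriodic S (w k)) (hI : SpacePeriodic S I)
    (k : ℕ) (t : ℝ) : SpacePeriodic S fun x => transportStep N s w I k (t, x) := by
  cases S
  · trivial
  induction k with
  | zero => exact hI
  | succ k ih =>
    intro n x
    simp only [transportStep]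
    refine Eq.trans ?_ (ih n (x - ((N : ℝ)⁻¹ * s (N * t - k)) • w k x))
    rw [hw k n x]
    congr 2
    abel

lemma transportStep_isSmooth (hs : ContDiff ℝ ∞ s) (hw : ∀ k, ContDiff ℝ ∞ (w k))
    (hwp : ∀ k, SpacePeriodic S (w k)) (hI : ContDiff ℝ ∞ I) (hIp : SpacePeriodic S I) (k : ℕ) :
    IsSmoothUpToBoundary S (transportStep N s w I k) :=
  isSmoothUpToBoundary_iff.2
    ⟨transportStep_contDiff hs hw hI k, transportStep_spacePeriodic hwp hIp k⟩

/-- Before its own interval begins, a later step has profile 0 and acts as the identity. -/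
lemma transportStep_of_le (hs0 : ∀ t ≤ 0, s t = 0) {k m : ℕ} (hkm : k ≤ m) {t : ℝ}
    (ht : N * t ≤ k) (x : Fin d → ℝ) :
    transportStep N s w I m (t, x) = transportStep N s w I k (t, x) := by
  induction m, hkm using Nat.le_induction with
  | base => rfl
  | succ m hkm ih =>
    have hkm' : (k : ℝ) ≤ m := by exact_mod_cast hkm
    rw [← ih, transportStep]
    simp [hs0 (N * t - m) (by linarith)]

lemma transportStep_initial (hs0 : ∀ t ≤ 0, s t = 0) (k : ℕ) (x : Fin d → ℝ) :
    transportStep N s w I k (0, x) = I x :=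
  transportStep_of_le hs0 (Nat.zero_le k) (by simp) x

/-- After their intervals end, earlier steps have profile 1, so their composition no longer depends
on time. -/
lemma transportStep_const (hs1 : ∀ t, 1 ≤ t → s t = 1) (k : ℕ) {t t' : ℝ}
    (ht : k ≤ N * t) (ht' : k ≤ N * t') (x : Fin d → ℝ) :
    transportStep N s w I k (t, x) = transportStep N s w I k (t', x) := by
  induction k generalizing x with
  | zero => rfl
  | succ k ih =>
    push_cast at ht ht'
    simp only [transportStep]
    rw [hs1 (N * t - k) (by linarith), hs1 (N * t' - k) (by linarith)]
    exact ih (by linarith) (by linarith) _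

/-- The substitution x ↦ x - σ w_k(x) with 0 ≤ σ ≤ 1/N has Lipschitz constant at most 1 + κ_k/N, and
these constants multiply. -/
lemma transportStep_lipschitz (hs : ∀ t, s t ∈ Set.Icc (0 : ℝ) 1)
    (hw : ∀ k, LipschitzWith (κ k) (w k)) (hI : LipschitzWith L I) (k : ℕ) (t : ℝ) :
    LipschitzWith (L * ∏ j ∈ Finset.range k, (1 + (N : ℝ≥0)⁻¹ * κ j))
      fun x => transportStep N s w I k (t, x) := by
  induction k with
  | zero => simpa [transportStep] using hI
  | succ k ih =>
    rw [Finset.prod_range_succ, ← mul_assoc]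
    have hσ0 : 0 ≤ (N : ℝ)⁻¹ * s (N * t - k) := mul_nonneg (by positivity) (hs _).1
    have hσ1 : (N : ℝ)⁻¹ * s (N * t - k) ≤ (N : ℝ)⁻¹ := by
      have := (hs (N * t - k)).2
      have h2 : 0 ≤ (N : ℝ)⁻¹ := by positivity
      nlinarith
    have hin : LipschitzWith (1 + (N : ℝ≥0)⁻¹ * κ k)
        fun x => x - ((N : ℝ)⁻¹ * s (N * t - k)) • w k x := by
      refine LipschitzWith.of_dist_le_mul fun x y => ?_
      have h1 := (hw k).dist_le_mul x y
      rw [dist_eq_norm] at h1 ⊢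
      have : x - ((N : ℝ)⁻¹ * s (N * t - k)) • w k x - (y - ((N : ℝ)⁻¹ * s (N * t - k)) • w k y) =
          (x - y) - ((N : ℝ)⁻¹ * s (N * t - k)) • (w k x - w k y) := by
        rw [smul_sub]; abel
      rw [this]
      refine (norm_sub_le _ _).trans ?_
      rw [norm_smul, Real.norm_of_nonneg hσ0, ← dist_eq_norm x y]
      push_cast
      calc dist x y + (N : ℝ)⁻¹ * s (N * t - k) * ‖w k x - w k y‖
          ≤ dist x y + (N : ℝ)⁻¹ * (κ k * dist x y) := by gcongr
        _ = _ := by ring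
    exact ih.comp hin

/-- For κ the means of the velocity bound and m = N, the exponent is the integral of that bound. So
the Lipschitz constants of the transported data stay bounded uniformly in N. -/
lemma prod_one_add_le_exp (κ : ℕ → ℝ≥0) {k m : ℕ} (hkm : k ≤ m) :
    ((∏ j ∈ Finset.range k, (1 + (N : ℝ≥0)⁻¹ * κ j) : ℝ≥0) : ℝ) ≤
      Real.exp (∑ j ∈ Finset.range m, (N : ℝ)⁻¹ * κ j) := by
  push_cast
  refine (Finset.prod_le_prod (fun j _ => by positivity) (g := fun j => Real.exp ((N : ℝ)⁻¹ * κ j))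
    fun j _ => ?_).trans ?_
  · rw [add_comm]; exact Real.add_one_le_exp _
  · rw [← Real.exp_sum]
    refine Real.exp_le_exp.2 (Finset.sum_le_sum_of_subset_of_nonneg
      (Finset.range_mono hkm) fun j _ _ => by positivity)

/-- In the k-th interval the function is P(x - σ(t) w(x)) with P frozen in time, w = w_k and σ′ =
s′. Its stream derivative is DP applied to (v - w) + (1 - s′) w - σ Dw v. The three terms are the
approximation error of the velocity, the defect of the profile, and a term of order 1/N because σ ≤
1/N. -/
theorem abs_classicalStreamDeriv_transportStep_le (hN : 0 < N) (hsc : ContDiff ℝ ∞ s)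
    (hs0 : ∀ t ≤ 0, s t = 0) (hs1 : ∀ t, 1 ≤ t → s t = 1) (hs : ∀ t, s t ∈ Set.Icc (0 : ℝ) 1)
    (hwc : ∀ k, ContDiff ℝ ∞ (w k)) (hw : ∀ k, LipschitzWith (κ k) (w k))
    (hwb : ∀ k x, ‖w k x‖ ≤ κ k) (hIc : ContDiff ℝ ∞ I) (hI : LipschitzWith L I)
    (v : ℝ → (Fin d → ℝ) → (Fin d → ℝ)) {k : ℕ} (hk : k < N) {t : ℝ}
    (ht : t ∈ Set.Ioo (k / N : ℝ) ((k + 1) / N : ℝ)) (x : Fin d → ℝ) :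
    |classicalStreamDeriv v (transportStep N s w I N) (t, x)| ≤
      L * Real.exp (∑ j ∈ Finset.range N, (N : ℝ)⁻¹ * κ j) *
        (‖v t x - w k x‖ + |1 - deriv s (N * t - k)| * κ k + (N : ℝ)⁻¹ * κ k * ‖v t x‖) := by
  have hN' : (0 : ℝ) < N := by exact_mod_cast hN
  have hk1 : ∀ r ∈ Set.Ioo (k / N : ℝ) ((k + 1) / N : ℝ), (k : ℝ) ≤ N * r ∧ N * r ≤ k + 1 :=
    fun r hr => ⟨((div_lt_iff₀' hN').1 hr.1).le, ((lt_div_iff₀' hN').1 hr.2).le⟩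
  set P : (Fin d → ℝ) → ℝ := fun y => transportStep N s w I k (t, y) with hP
  have hPc : ContDiff ℝ ∞ P := (transportStep_contDiff hsc hwc hIc k).comp (contDiff_prodMk_right t)
  have hPl : LipschitzWith (L * ∏ j ∈ Finset.range k, (1 + (N : ℝ≥0)⁻¹ * κ j)) P :=
    transportStep_lipschitz hs hw hI k t
  have hev : transportStep N s w I N =ᶠ[𝓝 (t, x)]
      fun z => P (z.2 - ((N : ℝ)⁻¹ * s (N * z.1 - k)) • w k z.2) := by
    have : ∀ᶠ z : ℝ × (Fin d → ℝ) in 𝓝 (t, x), z.1 ∈ Set.Ioo (k / N : ℝ) ((k + 1) / N : ℝ) :=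
      continuous_fst.continuousAt.eventually (isOpen_Ioo.mem_nhds ht)
    filter_upwards [this] with z hz
    have h1 := transportStep_of_le (N := N) (w := w) (I := I) hs0 (Nat.succ_le_of_lt hk) (t := z.1)
      (by push_cast; exact (hk1 _ hz).2) z.2
    rw [Prod.mk.eta] at h1
    rw [h1, transportStep]
    exact transportStep_const hs1 k (hk1 _ hz).1 (hk1 _ ht).1 _
  have hσ : HasDerivAt (fun r : ℝ => (N : ℝ)⁻¹ * s (N * r - k)) (deriv s (N * t - k)) t := by
    have h1 : HasDerivAt (fun r : ℝ => N * r - (k : ℝ)) N t := by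
      simpa using ((hasDerivAt_id t).const_mul (N : ℝ)).sub_const (k : ℝ)
    have h2 := ((hsc.differentiable (by simp) (N * t - k)).hasDerivAt.comp t h1).const_mul (N : ℝ)⁻¹
    refine h2.congr_deriv ?_
    field_simp
  have hwd : HasFDerivAt (w k) (fderiv ℝ (w k) x) x :=
    ((hwc k).differentiable (by simp) x).hasFDerivAt
  have hσ' : HasFDerivAt (fun z : ℝ × (Fin d → ℝ) => (N : ℝ)⁻¹ * s (N * z.1 - k)) _ (t, x) :=
    HasFDerivAt.comp (g := fun r : ℝ => (N : ℝ)⁻¹ * s (N * r - k)) (t, x) hσ.hasFDerivAt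
      hasFDerivAt_fst
  have hw' : HasFDerivAt (fun z : ℝ × (Fin d → ℝ) => w k z.2) _ (t, x) :=
    hwd.comp (t, x) hasFDerivAt_snd
  have hg : HasFDerivAt (fun z : ℝ × (Fin d → ℝ) =>
      z.2 - ((N : ℝ)⁻¹ * s (N * z.1 - k)) • w k z.2) _ (t, x) :=
    hasFDerivAt_snd.sub (hσ'.smul hw')
  have hfull := ((hPc.differentiable (by simp)
    (x - ((N : ℝ)⁻¹ * s (N * t - k)) • w k x)).hasFDerivAt).comp (t, x) hg
  have hfd := (hfull.congr_of_eventuallyEq hev).fderiv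
  set y := x - ((N : ℝ)⁻¹ * s (N * t - k)) • w k x with hy
  set σ := (N : ℝ)⁻¹ * s (N * t - k) with hσdef
  have hσ0 : 0 ≤ σ := mul_nonneg (by positivity) (hs _).1
  have hσ1 : σ ≤ (N : ℝ)⁻¹ := by
    have h1 := (hs (N * t - k)).2
    have h2 : 0 ≤ (N : ℝ)⁻¹ := by positivity
    rw [hσdef]
    nlinarith
  have heq : classicalStreamDeriv v (transportStep N s w I N) (t, x) =
      fderiv ℝ P y ((v t x - w k x) + (1 - deriv s (N * t - k)) • w k x -
        σ • fderiv ℝ (w k) x (v t x)) := by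
    rw [classicalStreamDeriv, hfd]
    simp only [ContinuousLinearMap.comp_apply]
    congr 1
    simp [sub_smul]
    abel
  rw [heq]
  have hDw : ‖fderiv ℝ (w k) x (v t x)‖ ≤ κ k * ‖v t x‖ :=
    (ContinuousLinearMap.le_opNorm _ _).trans
      (mul_le_mul_of_nonneg_right (norm_fderiv_le_of_lipschitz ℝ (hw k)) (norm_nonneg _))
  have hvec : ‖(v t x - w k x) + (1 - deriv s (N * t - k)) • w k x -
      σ • fderiv ℝ (w k) x (v t x)‖ ≤
      ‖v t x - w k x‖ + |1 - deriv s (N * t - k)| * κ k + (N : ℝ)⁻¹ * κ k * ‖v t x‖ := by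
    refine (norm_sub_le _ _).trans (add_le_add ((norm_add_le _ _).trans ?_) ?_)
    · rw [norm_smul, Real.norm_eq_abs]
      gcongr
      exact hwb k x
    · rw [norm_smul, Real.norm_of_nonneg hσ0]
      exact (mul_le_mul hσ1 hDw (norm_nonneg _) (by positivity)).trans_eq (by ring)
  refine (ContinuousLinearMap.le_opNorm (fderiv ℝ P y) _).trans ?_
  have hDP : ‖fderiv ℝ P y‖ ≤ L * Real.exp (∑ j ∈ Finset.range N, (N : ℝ)⁻¹ * κ j) := by
    refine (norm_fderiv_le_of_lipschitz ℝ hPl).trans ?_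
    rw [NNReal.coe_mul]
    exact mul_le_mul_of_nonneg_left (prod_one_add_le_exp κ hk.le) L.2
  gcongr

end TransportStep

/-! ### Discretization of the velocity in time and space. -/

section Approximation

variable {N : ℕ}

lemma sub_floor_mem_Icc {t : ℝ} (ht : 0 ≤ t) : N * t - ⌊N * t⌋₊ ∈ Set.Icc (0 : ℝ) 1 :=
  ⟨sub_nonneg.2 (Nat.floor_le (by positivity)),
    by linarith [Nat.lt_floor_add_one ((N : ℝ) * t)]⟩

lemma memLp_comp_sub_floor {G : ℝ → ℝ} (hG : Continuous G) (q : ℝ≥0∞) :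
    MemLp (fun t : ℝ => G (N * t - ⌊N * t⌋₊)) q muTime := by
  obtain ⟨B, hB⟩ := (isCompact_Icc (a := (0 : ℝ)) (b := 1)).exists_bound_of_continuousOn
    hG.continuousOn
  have hm : Measurable fun t : ℝ => N * t - (⌊N * t⌋₊ : ℝ) :=
    (measurable_const.mul measurable_id).sub (measurable_comp_floor fun k => (k : ℝ))
  refine MemLp.of_bound (hG.measurable.comp hm).aestronglyMeasurable B ?_
  filter_upwards [ae_mem_Ico] with t ht using hB _ (sub_floor_mem_Icc ht.1)

lemma integral_comp_sub_floor {G : ℝ → ℝ} (hG : Continuous G) (hN : 0 < N) :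
    ∫ t, G (N * t - ⌊N * t⌋₊) ∂muTime = ∫ t in (0 : ℝ)..1, G t := by
  have hN' : (N : ℝ) ≠ 0 := by exact_mod_cast hN.ne'
  rw [integral_muTime_eq_sum ((memLp_comp_sub_floor hG 1).integrable le_rfl) hN]
  have : ∀ k ∈ Finset.range N, ∫ r in (k / N : ℝ)..((k + 1) / N : ℝ), G (N * r - ⌊N * r⌋₊) =
      (N : ℝ)⁻¹ * ∫ t in (0 : ℝ)..1, G t := by
    intro k _
    have h1 : ∫ r in (k / N : ℝ)..((k + 1) / N : ℝ), G (N * r - ⌊N * r⌋₊) =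
        ∫ r in (k / N : ℝ)..((k + 1) / N : ℝ), G (N * r - k) := by
      rw [intervalIntegral.integral_of_le (div_le_succ_div N k),
        intervalIntegral.integral_of_le (div_le_succ_div N k), integral_Ioc_eq_integral_Ioo,
        integral_Ioc_eq_integral_Ioo]
      exact setIntegral_congr_fun measurableSet_Ioo fun t ht => by
        simp only [floor_eq_of_mem hN ht]
    rw [h1, intervalIntegral.integral_comp_mul_sub G hN' (k : ℝ), smul_eq_mul]
    congr 2 <;> field_simp <;> ring
  rw [Finset.sum_congr rfl this]
  simp
  field_simp

/-- The formula for the derivative of the transported datum is local in time and is used inside the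
open intervals. The grid points form a countable, hence null, set. -/
lemma ae_mem_open_step (hN : 0 < N) :
    ∀ᵐ t : ℝ ∂muTime, ⌊N * t⌋₊ < N ∧
      t ∈ Set.Ioo ((⌊N * t⌋₊ : ℝ) / N) (((⌊N * t⌋₊ : ℝ) + 1) / N) := by
  have hN' : (0 : ℝ) < N := by exact_mod_cast hN
  have hc : (Set.range fun k : ℕ => (k / N : ℝ)).Countable := Set.countable_range _
  have hne : ∀ᵐ t ∂muTime, t ∉ Set.range fun k : ℕ => (k / N : ℝ) := hc.ae_notMem _
  filter_upwards [ae_mem_Ico, hne] with t ht htn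
  refine ⟨floor_lt_of_mem hN ht, ?_, ?_⟩
  · refine lt_of_le_of_ne ((div_le_iff₀' hN').2 (Nat.floor_le (by have := ht.1; positivity)))
      fun h => htn ⟨_, h⟩
  · exact (lt_div_iff₀' hN').2 (Nat.lt_floor_add_one _)

variable {d : ℕ} {S : Setting} {v : ℝ → (Fin d → ℝ) → (Fin d → ℝ)} {K : ℝ → ℝ≥0}
  {I : (Fin d → ℝ) → ℝ}

lemma IsRegularVelocity.measurable_apply (hv : IsRegularVelocity S v K) (x : Fin d → ℝ)
    (i : Fin d) : Measurable fun t => v t x i :=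
  (measurable_pi_apply i).comp (hv.measurable.comp (measurable_id.prodMk measurable_const))

lemma IsRegularVelocity.memLp_apply (hv : IsRegularVelocity S v K) (x : Fin d → ℝ) (i : Fin d) :
    MemLp (fun t => v t x i) 2 muTime :=
  hv.memLp_bound.of_le (hv.measurable_apply x i).aestronglyMeasurable
    (Eventually.of_forall fun t => ((norm_le_pi_norm (v t x) i).trans (hv.norm_le t x)).trans
      (le_abs_self _))

/-- The mean of the velocity over a time step. -/
noncomputable def meanField (N : ℕ) (v : ℝ → (Fin d → ℝ) → (Fin d → ℝ)) (k : ℕ)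
    (x : Fin d → ℝ) : Fin d → ℝ :=
  fun i => stepMean N (fun t => v t x i) k

/-- The mean of the bound of the velocity over a time step. -/
noncomputable def meanBound (N : ℕ) (K : ℝ → ℝ≥0) (k : ℕ) : ℝ≥0 :=
  (stepMean N (fun t => (K t : ℝ)) k).toNNReal

lemma coe_meanBound (N : ℕ) (K : ℝ → ℝ≥0) (k : ℕ) :
    (meanBound N K k : ℝ) = stepMean N (fun t => (K t : ℝ)) k :=
  Real.coe_toNNReal _ (stepMean_nonneg (fun t => (K t).2) k)

lemma IsRegularVelocity.norm_meanField_le (hv : IsRegularVelocity S v K) {k : ℕ} (hk : k < N)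
    (x : Fin d → ℝ) : ‖meanField N v k x‖ ≤ meanBound N K k := by
  refine (pi_norm_le_iff_of_nonneg (NNReal.coe_nonneg _)).2 fun i => ?_
  rw [coe_meanBound]
  exact abs_stepMean_le (hv.memLp_bound.integrable one_le_two)
    (fun t => (norm_le_pi_norm (v t x) i).trans (hv.norm_le t x)) hk

lemma IsRegularVelocity.lipschitzWith_meanField (hv : IsRegularVelocity S v K) {k : ℕ}
    (hk : k < N) : LipschitzWith (meanBound N K k) (meanField N v k) := by
  refine LipschitzWith.of_dist_le_mul fun x y => (dist_pi_le_iff (by positivity)).2 fun i => ?_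
  rw [coe_meanBound, Real.dist_eq, meanField, meanField,
    ← stepMean_sub ((hv.memLp_apply x i).integrable one_le_two)
      ((hv.memLp_apply y i).integrable one_le_two) hk, ← stepMean_const_mul]
  refine abs_stepMean_le ((hv.memLp_bound.integrable one_le_two).mul_const _) (fun t => ?_) hk
  exact (dist_le_pi_dist (v t x) (v t y) i).trans ((hv.lipschitz t).dist_le_mul x y)

lemma IsRegularVelocity.spacePeriodic_meanField (hv : IsRegularVelocity S v K) (k : ℕ) :
    SpacePeriodic S (meanField N v k) := by
  cases S
  · trivial
  · intro n x
    funext i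
    simp only [meanField, (hv.boundary _) n x]

lemma sum_meanBound (hv : IsRegularVelocity S v K) (hN : 0 < N) :
    ∑ j ∈ Finset.range N, (N : ℝ)⁻¹ * meanBound N K j = ∫ t, (K t : ℝ) ∂muTime := by
  have hN' : (N : ℝ) ≠ 0 := by exact_mod_cast hN.ne'
  rw [integral_muTime_eq_sum (hv.memLp_bound.integrable one_le_two) hN]
  refine Finset.sum_congr rfl fun j _ => ?_
  rw [coe_meanBound, stepMean]
  field_simp

/-- Smooth approximations of the means of the velocity. -/
lemma IsRegularVelocity.exists_smooth_meanField (hv : IsRegularVelocity S v K) {η : ℝ}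
    (hη : 0 < η) (N : ℕ) :
    ∃ (w : ℕ → (Fin d → ℝ) → (Fin d → ℝ)), (∀ k, ContDiff ℝ ∞ (w k)) ∧
      (∀ k, LipschitzWith (meanBound N K k) (w k)) ∧ (∀ k x, ‖w k x‖ ≤ meanBound N K k) ∧
      (∀ k, SpacePeriodic S (w k)) ∧ ∀ k < N, ∀ x, ‖w k x - meanField N v k x‖ ≤ η := by
  have : ∀ k, ∃ w : (Fin d → ℝ) → (Fin d → ℝ), ContDiff ℝ ∞ w ∧
      LipschitzWith (meanBound N K k) w ∧ (∀ x, ‖w x‖ ≤ meanBound N K k) ∧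
      SpacePeriodic S w ∧ (k < N → ∀ x, ‖w x - meanField N v k x‖ ≤ η) := by
    intro k
    by_cases hk : k < N
    · obtain ⟨w, h1, h2, h3, h4, h5⟩ := exists_smooth_field_approx
        (hv.lipschitzWith_meanField hk) (hv.norm_meanField_le hk)
        (hv.spacePeriodic_meanField k) hη
      exact ⟨w, h1, h2, h3, h4, fun _ => h5⟩
    -- Beyond the last interval the means involve times outside [0,1]. The zero field satisfies the
    -- bounds that are required for every k.
    · exact ⟨fun _ => 0, contDiff_const, LipschitzWith.const' 0, fun x => by simp,
        spacePeriodic_const 0, fun h => absurd h hk⟩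
  choose w h1 h2 h3 h4 h5 using this
  exact ⟨w, h1, h2, h3, h4, h5⟩

/-- By Cauchy–Schwarz a single mean is at most √N times the L² norm. After division by N this tends
to zero uniformly over the intervals. -/
lemma inv_mul_stepMean_le {f : ℝ → ℝ} (hf : MemLp f 2 muTime) {k : ℕ} (hk : k < N) :
    |(N : ℝ)⁻¹ * stepMean N f k| ≤ √((N : ℝ)⁻¹ * ∫ t, f t ^ 2 ∂muTime) := by
  have hN : 0 < N := (Nat.zero_le k).trans_lt hk
  have hN' : (0 : ℝ) < N := by exact_mod_cast hN
  refine Real.abs_le_sqrt ?_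
  have h1 := stepMean_sq_le hf hk
  have h2 : ∫ r in (k / N : ℝ)..((k + 1) / N : ℝ), f r ^ 2 ≤ ∫ t, f t ^ 2 ∂muTime := by
    rw [integral_muTime_eq_sum hf.integrable_sq hN]
    exact Finset.single_le_sum
      (f := fun k : ℕ => ∫ r in (k / N : ℝ)..((k + 1) / N : ℝ), f r ^ 2)
      (fun k _ => intervalIntegral.integral_nonneg (div_le_succ_div N k) fun t _ => sq_nonneg _)
      (Finset.mem_range.2 hk)
  calc ((N : ℝ)⁻¹ * stepMean N f k) ^ 2 = (N : ℝ)⁻¹ ^ 2 * stepMean N f k ^ 2 := by ring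
    _ ≤ (N : ℝ)⁻¹ ^ 2 * (N * ∫ t, f t ^ 2 ∂muTime) := by gcongr; exact h1.trans (by gcongr)
    _ = _ := by field_simp

/-- The pointwise error of the piecewise constant approximation of the velocity, as a function of
time. -/
lemma IsRegularVelocity.norm_sub_smooth_meanField_le (hv : IsRegularVelocity S v K)
    {T : Finset (Fin d → ℝ)} {δ η : ℝ}
    (hT : ∀ x ∈ spaceDomain d, ∃ y ∈ T, dist x y ≤ δ)
    {w : ℕ → (Fin d → ℝ) → (Fin d → ℝ)}
    (hw : ∀ k < N, ∀ x, ‖w k x - meanField N v k x‖ ≤ η) {t : ℝ} (hk : ⌊N * t⌋₊ < N)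
    {x : Fin d → ℝ} (hx : x ∈ spaceDomain d) :
    ‖v t x - w ⌊N * t⌋₊ x‖ ≤
      ∑ y ∈ T, ∑ i, |v t y i - stepFun N (fun r => v r y i) t| +
        (δ * (K t + stepFun N (fun t => (K t : ℝ)) t) + η) := by
  obtain ⟨y, hy, hxy⟩ := hT x hx
  set k := ⌊N * t⌋₊ with hkdef
  have hsf : stepFun N (fun t => (K t : ℝ)) t = meanBound N K k := (coe_meanBound N K k).symm
  -- The path goes from x to a nearby point y of the finite net, averages in time at y, returns to
  -- x, and mollifies. Only finitely many functions of time enter the averaging error.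
  have hdec : v t x - w k x = (v t x - v t y) + (v t y - meanField N v k y) +
      (meanField N v k y - meanField N v k x) + (meanField N v k x - w k x) := by abel
  have h1 : ‖v t x - v t y‖ ≤ K t * δ := by
    rw [← dist_eq_norm]
    exact ((hv.lipschitz t).dist_le_mul x y).trans (by gcongr)
  have h2 : ‖v t y - meanField N v k y‖ ≤
      ∑ y ∈ T, ∑ i, |v t y i - stepFun N (fun r => v r y i) t| := by
    have h3 : ‖v t y - meanField N v k y‖ ≤ ∑ i, |v t y i - stepFun N (fun r => v r y i) t| := by
      refine (pi_norm_le_iff_of_nonneg (Finset.sum_nonneg fun i _ => abs_nonneg _)).2 fun i => ?_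
      exact Finset.single_le_sum (f := fun i => |v t y i - stepFun N (fun r => v r y i) t|)
        (fun i _ => abs_nonneg _) (Finset.mem_univ i)
    exact h3.trans (Finset.single_le_sum
      (f := fun y => ∑ i, |v t y i - stepFun N (fun r => v r y i) t|)
      (fun y _ => Finset.sum_nonneg fun i _ => abs_nonneg _) hy)
  have h3 : ‖meanField N v k y - meanField N v k x‖ ≤ meanBound N K k * δ := by
    rw [← dist_eq_norm]
    refine ((hv.lipschitzWith_meanField hk).dist_le_mul y x).trans ?_
    rw [dist_comm]
    gcongr
  have h4 : ‖meanField N v k x - w k x‖ ≤ η := by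
    rw [norm_sub_rev]; exact hw k hk x
  rw [hdec, hsf]
  refine (norm_add_le _ _).trans ((add_le_add (norm_add₃_le) le_rfl).trans ?_)
  linarith

end Approximation

/-! ### Error estimates and the choice of parameters. -/

section Approximation

variable {d : ℕ} {S : Setting} {v : ℝ → (Fin d → ℝ) → (Fin d → ℝ)} {K : ℝ → ℝ≥0}
  {I : (Fin d → ℝ) → ℝ}

lemma eLpNorm_time_comp_fst (B : ℝ → ℝ) (hB : AEStronglyMeasurable B muTime) :
    eLpNorm (fun z : ℝ × (Fin d → ℝ) => B z.1) 2 (muSpaceTime d) = eLpNorm B 2 muTime := by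
  rw [muSpaceTime_eq_prod]
  exact eLpNorm_comp_measurePreserving hB measurePreserving_fst

/-- The time discretization error tends to zero. -/
lemma IsRegularVelocity.tendsto_discretization_error (hv : IsRegularVelocity S v K)
    (T : Finset (Fin d → ℝ)) :
    Tendsto (fun N => ∑ y ∈ T, ∑ i,
      eLpNorm (fun t => v t y i - stepFun N (fun r => v r y i) t) 2 muTime) atTop (𝓝 0) := by
  rw [← Finset.sum_const_zero (s := T) (M := ℝ≥0∞)]
  refine tendsto_finsetSum _ fun y _ => ?_
  rw [← Finset.sum_const_zero (s := (Finset.univ : Finset (Fin d))) (M := ℝ≥0∞)]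
  exact tendsto_finsetSum _ fun i _ => tendsto_eLpNorm_sub_stepFun (hv.memLp_apply y i)

/-- This controls the term σ Dw v. The step means of K divided by N tend to zero uniformly in time
by `inv_mul_stepMean_le`, and the remaining factor K is in L². -/
lemma IsRegularVelocity.tendsto_commutation_error (hv : IsRegularVelocity S v K) :
    Tendsto (fun N : ℕ => eLpNorm (fun t => (N : ℝ)⁻¹ * stepFun N (fun t => (K t : ℝ)) t * K t)
      2 muTime) atTop (𝓝 0) := by
  have hlim : Tendsto (fun N : ℕ => ENNReal.ofReal (√((N : ℝ)⁻¹ * ∫ t, (K t : ℝ) ^ 2 ∂muTime)) *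
      eLpNorm (fun t => (K t : ℝ)) 2 muTime) atTop (𝓝 0) := by
    have h1 : Tendsto (fun N : ℕ => √((N : ℝ)⁻¹ * ∫ t, (K t : ℝ) ^ 2 ∂muTime)) atTop (𝓝 0) := by
      have := (tendsto_inv_atTop_nhds_zero_nat (𝕜 := ℝ)).mul_const (∫ t, (K t : ℝ) ^ 2 ∂muTime)
      have h2 := (Real.continuous_sqrt.tendsto _).comp this
      simpa only [zero_mul, Real.sqrt_zero, Function.comp_def] using h2
    have h3 := ENNReal.tendsto_ofReal h1
    rw [ENNReal.ofReal_zero] at h3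
    have h4 := ENNReal.Tendsto.mul_const h3 (Or.inr hv.memLp_bound.2.ne)
    rwa [zero_mul] at h4
  refine tendsto_of_tendsto_of_tendsto_of_le_of_le' tendsto_const_nhds hlim
    (Eventually.of_forall fun _ => zero_le) ?_
  filter_upwards [eventually_gt_atTop 0] with N hN
  refine eLpNorm_le_mul_eLpNorm_of_ae_le_mul ?_ 2
  filter_upwards [ae_mem_open_step hN] with t ht
  rw [norm_mul]
  exact mul_le_mul_of_nonneg_right (inv_mul_stepMean_le hv.memLp_bound ht.1) (norm_nonneg _)

/-- The error caused by the flat ends of the time profile. -/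
lemma exists_time_profile_error_le (K : ℝ → ℝ≥0) {N : ℕ} (hN : 0 < N) {e : ℝ} (he : 0 < e) :
    ∃ s : ℝ → ℝ, ContDiff ℝ ∞ s ∧ (∀ t ≤ 0, s t = 0) ∧ (∀ t, 1 ≤ t → s t = 1) ∧
      (∀ t, s t ∈ Set.Icc (0 : ℝ) 1) ∧
      eLpNorm (fun t : ℝ => |1 - deriv s (N * t - ⌊N * t⌋₊)| * stepFun N (fun t => (K t : ℝ)) t)
        2 muTime ≤ ENNReal.ofReal e := by
  set m : ℝ := ∑ k ∈ Finset.range N, (meanBound N K k : ℝ) with hm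
  have hm0 : 0 ≤ m := Finset.sum_nonneg fun k _ => (meanBound N K k).2
  -- For fixed N the step means are bounded by their sum m, which may grow with N. The profile is
  -- therefore chosen after N.
  obtain ⟨s, hs, hs0, hs1, hs01, hsi⟩ := exists_time_profile
    (η := (e / (m + 1)) ^ 2) (by positivity)
  refine ⟨s, hs, hs0, hs1, hs01, ?_⟩
  have hsc : Continuous fun t => 1 - deriv s t :=
    continuous_const.sub (hs.continuous_deriv (by simp))
  have h1 : eLpNorm (fun t : ℝ => |1 - deriv s (N * t - ⌊N * t⌋₊)| *
      stepFun N (fun t => (K t : ℝ)) t) 2 muTime ≤ ENNReal.ofReal m *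
        eLpNorm (fun t : ℝ => 1 - deriv s (N * t - ⌊N * t⌋₊)) 2 muTime := by
    refine eLpNorm_le_mul_eLpNorm_of_ae_le_mul ?_ 2
    filter_upwards [ae_mem_open_step hN] with t ht
    rw [norm_mul, mul_comm, Real.norm_eq_abs |_|, abs_abs]
    refine mul_le_mul_of_nonneg_right ?_ (abs_nonneg _)
    rw [stepFun, ← coe_meanBound, Real.norm_of_nonneg (NNReal.coe_nonneg _)]
    exact Finset.single_le_sum (f := fun k => (meanBound N K k : ℝ))
      (fun k _ => (meanBound N K k).2) (Finset.mem_range.2 ht.1)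
  refine h1.trans ?_
  rw [eLpNorm_two_eq (memLp_comp_sub_floor hsc 2)]
  have h2 := integral_comp_sub_floor (N := N) (hsc.pow 2) hN
  simp only [Pi.pow_apply] at h2
  rw [h2, ← ENNReal.ofReal_mul hm0]
  refine ENNReal.ofReal_le_ofReal ?_
  have h3 : √(∫ t in (0 : ℝ)..1, (1 - deriv s t) ^ 2) ≤ e / (m + 1) :=
    (Real.sqrt_le_sqrt hsi).trans_eq (Real.sqrt_sq (by positivity))
  calc m * √(∫ t in (0 : ℝ)..1, (1 - deriv s t) ^ 2) ≤ (m + 1) * (e / (m + 1)) := by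
        gcongr; linarith
    _ = e := by field_simp

/-- Smooth data are the initial values of smooth functions with arbitrarily small stream
derivative. -/
theorem IsRegularVelocity.exists_approx_transport (hv : IsRegularVelocity S v K)
    (hI : IsSmoothDatum S I) {ε : ℝ≥0∞} (hε : 0 < ε) :
    ∃ p, IsSmoothUpToBoundary S p ∧ (∀ x, p (0, x) = I x) ∧
      eLpNorm (classicalStreamDeriv v p) 2 (muSpaceTime d) ≤ ε := by
  obtain ⟨hIc, hIp, L, hL⟩ := hI
  set M : ℝ := L * Real.exp (∫ t, (K t : ℝ) ∂muTime) with hM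
  have hM0 : 0 ≤ M := by positivity
  obtain ⟨r, hr0, hrε⟩ := ENNReal.lt_iff_exists_nnreal_btwn.1 hε
  have hr0' : 0 < (r : ℝ) := by exact_mod_cast hr0
  -- Five errors of size e occur: time averaging on the net, spacing of the net, mollification,
  -- profile defect, and the term of order 1/N. M bounds the Lipschitz constant of the transported
  -- datum, and M + 1 avoids division by zero.
  set e : ℝ := r / (5 * (M + 1)) with he
  have he0 : 0 < e := by positivity
  have he0' : 0 < ENNReal.ofReal e := ENNReal.ofReal_pos.2 he0
  set κ : ℝ := √(∫ t, (K t : ℝ) ^ 2 ∂muTime) with hκ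
  have hκ0 : 0 ≤ κ := Real.sqrt_nonneg _
  -- K and its step function both have L² norm at most κ, so the net spacing costs at most 2κδ ≤ e.
  set δ : ℝ := e / (2 * κ + 1) with hδ
  have hδ0 : 0 < δ := by positivity
  obtain ⟨T', hT'sub, hT'fin, hT'cov⟩ := (isCompact_spaceDomain (d := d)).finite_cover_balls hδ0
  have hT : ∀ x ∈ spaceDomain d, ∃ y ∈ hT'fin.toFinset, dist x y ≤ δ := by
    intro x hx
    obtain ⟨y, hy, hxy⟩ := Set.mem_iUnion₂.1 (hT'cov hx)
    exact ⟨y, hT'fin.mem_toFinset.2 hy, (Metric.mem_ball.1 hxy).le⟩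
  set T := hT'fin.toFinset with hTdef
  have hev1 := ENNReal.tendsto_nhds_zero.1 (hv.tendsto_discretization_error T) _ he0'
  have hev2 := ENNReal.tendsto_nhds_zero.1 hv.tendsto_commutation_error _ he0'
  -- The order matters: the net fixes finitely many functions of time, then N makes their averaging
  -- errors small, and the profile and mollified fields are chosen for that N.
  obtain ⟨N, hN1, hN2, hN⟩ := (hev1.and (hev2.and (eventually_gt_atTop 0))).exists
  obtain ⟨s, hs, hs0, hs1, hs01, hse⟩ := exists_time_profile_error_le K hN he0
  obtain ⟨w, hwc, hwl, hwb, hwp, hwm⟩ := hv.exists_smooth_meanField he0 N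
  refine ⟨transportStep N s w I N, transportStep_isSmooth hs hwc hwp hIc hIp N,
    transportStep_initial hs0 N, ?_⟩
  set B₁ : ℝ → ℝ := fun t => ∑ y ∈ T, ∑ i, |v t y i - stepFun N (fun r => v r y i) t| with hB₁
  set B₂ : ℝ → ℝ := fun t => δ * (K t + stepFun N (fun t => (K t : ℝ)) t) with hB₂
  set B₄ : ℝ → ℝ := fun t : ℝ => |1 - deriv s (N * t - ⌊N * t⌋₊)| *
    stepFun N (fun t => (K t : ℝ)) t with hB₄
  set B₅ : ℝ → ℝ := fun t => (N : ℝ)⁻¹ * stepFun N (fun t => (K t : ℝ)) t * K t with hB₅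
  have hKm : AEStronglyMeasurable (fun t => (K t : ℝ)) muTime := hv.memLp_bound.1
  have hsm : ∀ f : ℝ → ℝ, AEStronglyMeasurable (stepFun N f) muTime :=
    fun f => (memLp_stepFun hN f 2).1
  have hmd : ∀ y i, AEStronglyMeasurable
      (fun t => |v t y i - stepFun N (fun r => v r y i) t|) muTime :=
    fun y i => ((hv.memLp_apply y i).1.sub (hsm _)).norm
  have hm1 : AEStronglyMeasurable B₁ muTime :=
    Finset.aestronglyMeasurable_fun_sum _ fun y _ =>
      Finset.aestronglyMeasurable_fun_sum _ fun i _ => hmd y i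
  have hm2 : AEStronglyMeasurable B₂ muTime := (hKm.add (hsm _)).const_mul δ
  have hsc : Continuous fun t => |1 - deriv s t| :=
    (continuous_const.sub (hs.continuous_deriv (by simp))).abs
  have hm4 : AEStronglyMeasurable B₄ muTime := (memLp_comp_sub_floor hsc 2).1.mul (hsm _)
  have hm5 : AEStronglyMeasurable B₅ muTime := ((hsm _).const_mul _).mul hKm
  have hn1 : eLpNorm B₁ 2 muTime ≤ ENNReal.ofReal e := by
    refine le_trans ?_ hN1
    have e1 : B₁ = ∑ y ∈ T, fun t => ∑ i, |v t y i - stepFun N (fun r => v r y i) t| := by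
      funext t; simp [hB₁]
    rw [e1]
    refine (eLpNorm_sum_le (fun y _ => Finset.aestronglyMeasurable_fun_sum _ fun i _ => hmd y i)
      one_le_two).trans (Finset.sum_le_sum fun y _ => ?_)
    have e2 : (fun t => ∑ i, |v t y i - stepFun N (fun r => v r y i) t|) =
        ∑ i, fun t => |v t y i - stepFun N (fun r => v r y i) t| := by
      funext t; simp
    rw [e2]
    refine (eLpNorm_sum_le (fun i _ => hmd y i) one_le_two).trans
      (Finset.sum_le_sum fun i _ => ?_)
    exact (eLpNorm_norm (fun t => v t y i - stepFun N (fun r => v r y i) t)).le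
  have hn2 : eLpNorm B₂ 2 muTime ≤ ENNReal.ofReal e := by
    have h1 : eLpNorm B₂ 2 muTime =
        ‖δ‖ₑ * eLpNorm ((fun t => (K t : ℝ)) + stepFun N fun t => (K t : ℝ)) 2 muTime :=
      eLpNorm_const_smul δ ((fun t => (K t : ℝ)) + stepFun N fun t => (K t : ℝ)) 2 muTime
    have h2 : eLpNorm ((fun t => (K t : ℝ)) + stepFun N fun t => (K t : ℝ)) 2 muTime ≤
        ENNReal.ofReal (2 * κ) := by
      refine (eLpNorm_add_le hKm (hsm _) one_le_two).trans ?_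
      refine (add_le_add le_rfl (eLpNorm_stepFun_le hN hv.memLp_bound)).trans ?_
      rw [eLpNorm_two_eq hv.memLp_bound, ← ENNReal.ofReal_add hκ0 hκ0, two_mul]
    rw [h1, Real.enorm_eq_ofReal hδ0.le]
    refine (mul_le_mul' le_rfl h2).trans ?_
    rw [← ENNReal.ofReal_mul hδ0.le]
    refine ENNReal.ofReal_le_ofReal ?_
    rw [hδ, div_mul_eq_mul_div, div_le_iff₀ (by positivity)]
    nlinarith
  have hn3 : eLpNorm (fun _ : ℝ => e) 2 muTime ≤ ENNReal.ofReal e := by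
    refine (eLpNorm_le_of_ae_bound (C := e) (Eventually.of_forall fun t => ?_)).trans ?_
    · rw [Real.norm_of_nonneg he0.le]
    · simp
  set B : ℝ → ℝ := B₁ + (B₂ + fun _ => e) + B₄ + B₅ with hB
  have hsum : eLpNorm B 2 muTime ≤ ENNReal.ofReal (5 * e) := by
    have hm3 : AEStronglyMeasurable (fun _ : ℝ => e) muTime := aestronglyMeasurable_const
    have h23 := (eLpNorm_add_le hm2 hm3 one_le_two).trans (add_le_add hn2 hn3)
    have h123 := (eLpNorm_add_le hm1 (hm2.add hm3) one_le_two).trans (add_le_add hn1 h23)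
    have h1234 := (eLpNorm_add_le (hm1.add (hm2.add hm3)) hm4 one_le_two).trans
      (add_le_add h123 hse)
    have h5 := (eLpNorm_add_le ((hm1.add (hm2.add hm3)).add hm4) hm5 one_le_two).trans
      (add_le_add h1234 hN2)
    refine h5.trans_eq ?_
    rw [← ENNReal.ofReal_add he0.le he0.le, ← ENNReal.ofReal_add he0.le (by positivity),
      ← ENNReal.ofReal_add (by positivity) he0.le, ← ENNReal.ofReal_add (by positivity) he0.le]
    congr 1
    ring
  have hmB : AEStronglyMeasurable B muTime :=
    ((hm1.add (hm2.add aestronglyMeasurable_const)).add hm4).add hm5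
  have hpt : ∀ᵐ z ∂(muSpaceTime d), ‖classicalStreamDeriv v (transportStep N s w I N) z‖ ≤
      M * ‖B z.1‖ := by
    filter_upwards [ae_spaceTime_of_ae_time (ae_mem_open_step hN),
      ae_spaceTime_of_ae_space (ae_restrict_mem measurableSet_spaceDomain)] with z hz hx
    have h1 := abs_classicalStreamDeriv_transportStep_le hN hs hs0 hs1 hs01 hwc hwl hwb hIc hL v
      hz.1 hz.2 z.2
    rw [sum_meanBound hv hN, Prod.mk.eta] at h1
    refine h1.trans (mul_le_mul_of_nonneg_left (le_trans ?_ (le_abs_self _)) hM0)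
    have h2 := hv.norm_sub_smooth_meanField_le hT hwm hz.1 hx
    have h3 : (N : ℝ)⁻¹ * meanBound N K ⌊N * z.1⌋₊ * ‖v z.1 z.2‖ ≤ B₅ z.1 := by
      rw [hB₅, coe_meanBound]
      have h4 : 0 ≤ stepMean N (fun t => (K t : ℝ)) ⌊N * z.1⌋₊ := stepMean_nonneg (fun t => (K t).2) _
      exact mul_le_mul_of_nonneg_left (hv.norm_le _ _) (by positivity)
    have h4 : |1 - deriv s (N * z.1 - ⌊N * z.1⌋₊)| * meanBound N K ⌊N * z.1⌋₊ = B₄ z.1 := by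
      rw [coe_meanBound]; rfl
    rw [h4]
    simp only [hB, Pi.add_apply]
    exact add_le_add (add_le_add h2 le_rfl) h3
  refine (eLpNorm_le_mul_eLpNorm_of_ae_le_mul hpt 2).trans ?_
  rw [eLpNorm_time_comp_fst _ hmB]
  refine (mul_le_mul' le_rfl hsum).trans ?_
  rw [← ENNReal.ofReal_mul hM0]
  refine le_trans ?_ hrε.le
  rw [← ENNReal.ofReal_coe_nnreal]
  refine ENNReal.ofReal_le_ofReal ?_
  calc M * (5 * e) ≤ (M + 1) * (5 * e) := by gcongr; linarith
    _ = r := by rw [he]; field_simp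

end Approximation

/-! ### The graph of the stream derivative together with the traces -/

section Graph

variable {d : ℕ} {S : Setting} {v : ℝ → (Fin d → ℝ) → (Fin d → ℝ)} {K : ℝ → ℝ≥0}

/-- Functions, their stream derivatives, and their traces on `Γ₀` and `Γ₁`. -/
abbrev GraphSpace (d : ℕ) : Type := L2SpaceTime d × L2SpaceTime d × L2Space d × L2Space d

/-- The quadruple of classes in `L²` is that of `p`, its stream derivative and its restrictions. -/
def Represents (v : ℝ → (Fin d → ℝ) → (Fin d → ℝ)) (p : ℝ × (Fin d → ℝ) → ℝ) (q : GraphSpace d) :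
    Prop :=
  q.1 =ᵐ[muSpaceTime d] p ∧ q.2.1 =ᵐ[muSpaceTime d] classicalStreamDeriv v p ∧
    (q.2.2.1 =ᵐ[muSpace d] fun x => p (0, x)) ∧ q.2.2.2 =ᵐ[muSpace d] fun x => p (1, x)

lemma classicalStreamDeriv_add {p q : ℝ × (Fin d → ℝ) → ℝ} (hp : ContDiff ℝ ∞ p)
    (hq : ContDiff ℝ ∞ q) (z : ℝ × (Fin d → ℝ)) :
    classicalStreamDeriv v (fun z => p z + q z) z =
      classicalStreamDeriv v p z + classicalStreamDeriv v q z := by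
  have h : HasFDerivAt (fun z => p z + q z) _ z :=
    (hp.differentiable (by simp) z).hasFDerivAt.add (hq.differentiable (by simp) z).hasFDerivAt
  rw [classicalStreamDeriv, h.fderiv]
  simp [classicalStreamDeriv]

lemma classicalStreamDeriv_const_mul {p : ℝ × (Fin d → ℝ) → ℝ} (hp : ContDiff ℝ ∞ p) (c : ℝ)
    (z : ℝ × (Fin d → ℝ)) :
    classicalStreamDeriv v (fun z => c * p z) z = c * classicalStreamDeriv v p z := by
  have h : HasFDerivAt (fun z => c * p z) _ z :=
    (hp.differentiable (by simp) z).hasFDerivAt.const_mul c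
  rw [classicalStreamDeriv, h.fderiv]
  simp [classicalStreamDeriv]

/-- The graph of the stream derivative and the restrictions on smooth functions. -/
def smoothGraph (S : Setting) (v : ℝ → (Fin d → ℝ) → (Fin d → ℝ)) :
    Submodule ℝ (GraphSpace d) where
  carrier := {q | ∃ p, IsSmoothUpToBoundary S p ∧ Represents v p q}
  add_mem' := by
    rintro a b ⟨p, hp, h1, h2, h3, h4⟩ ⟨q, hq, k1, k2, k3, k4⟩
    have hp' := isSmoothUpToBoundary_iff.1 hp
    have hq' := isSmoothUpToBoundary_iff.1 hq
    refine ⟨fun z => p z + q z, isSmoothUpToBoundary_iff.2 ⟨hp'.1.add hq'.1,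
      fun t => (hp'.2 t).comp₂ (hq'.2 t) (· + ·)⟩, ?_, ?_, ?_, ?_⟩
    · filter_upwards [Lp.coeFn_add a.1 b.1, h1, k1] with z e1 e2 e3
      rw [Prod.fst_add, e1, Pi.add_apply, e2, e3]
    · filter_upwards [Lp.coeFn_add a.2.1 b.2.1, h2, k2] with z e1 e2 e3
      rw [Prod.snd_add, Prod.fst_add, e1, Pi.add_apply, e2, e3,
        classicalStreamDeriv_add hp'.1 hq'.1]
    · filter_upwards [Lp.coeFn_add a.2.2.1 b.2.2.1, h3, k3] with z e1 e2 e3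
      rw [Prod.snd_add, Prod.snd_add, Prod.fst_add, e1, Pi.add_apply, e2, e3]
    · filter_upwards [Lp.coeFn_add a.2.2.2 b.2.2.2, h4, k4] with z e1 e2 e3
      rw [Prod.snd_add, Prod.snd_add, Prod.snd_add, e1, Pi.add_apply, e2, e3]
  zero_mem' := by
    refine ⟨fun _ => 0, isSmoothUpToBoundary_iff.2 ⟨contDiff_const, fun t =>
      spacePeriodic_const 0⟩, Lp.coeFn_zero _ _ _, ?_, Lp.coeFn_zero _ _ _, Lp.coeFn_zero _ _ _⟩
    filter_upwards [Lp.coeFn_zero ℝ 2 (muSpaceTime d)] with z hz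
    simp only [Prod.snd_zero, Prod.fst_zero, hz, classicalStreamDeriv]
    simp
  smul_mem' := by
    rintro c a ⟨p, hp, h1, h2, h3, h4⟩
    have hp' := isSmoothUpToBoundary_iff.1 hp
    refine ⟨fun z => c * p z, isSmoothUpToBoundary_iff.2 ⟨contDiff_const.mul hp'.1,
      fun t => (hp'.2 t).comp (c * ·)⟩, ?_, ?_, ?_, ?_⟩
    · filter_upwards [Lp.coeFn_smul c a.1, h1] with z e1 e2
      rw [Prod.smul_fst, e1, Pi.smul_apply, e2, smul_eq_mul]
    · filter_upwards [Lp.coeFn_smul c a.2.1, h2] with z e1 e2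
      rw [Prod.smul_snd, Prod.smul_fst, e1, Pi.smul_apply, e2, smul_eq_mul,
        classicalStreamDeriv_const_mul hp'.1]
    · filter_upwards [Lp.coeFn_smul c a.2.2.1, h3] with z e1 e2
      rw [Prod.smul_snd, Prod.smul_snd, Prod.smul_fst, e1, Pi.smul_apply, e2, smul_eq_mul]
    · filter_upwards [Lp.coeFn_smul c a.2.2.2, h4] with z e1 e2
      rw [Prod.smul_snd, Prod.smul_snd, Prod.smul_snd, e1, Pi.smul_apply, e2, smul_eq_mul]

/-- The closed graph of the stream derivative and the trace. -/
noncomputable def traceGraph (S : Setting) (v : ℝ → (Fin d → ℝ) → (Fin d → ℝ)) :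
    Submodule ℝ (GraphSpace d) :=
  (smoothGraph S v).topologicalClosure

lemma IsRegularVelocity.exists_represents (hv : IsRegularVelocity S v K)
    {p : ℝ × (Fin d → ℝ) → ℝ} (hp : ContDiff ℝ ∞ p) : ∃ q : GraphSpace d, Represents v p q := by
  have h1 : MemLp p 2 (muSpaceTime d) := Continuous.memLp_spaceTime hp.continuous 2
  have h2 := hv.memLp_classicalStreamDeriv hp
  have h3 : ∀ t, MemLp (fun x => p (t, x)) 2 (muSpace d) := fun t =>
    Continuous.memLp_space (hp.continuous.comp (by fun_prop)) 2
  exact ⟨(h1.toLp p, h2.toLp _, (h3 0).toLp _, (h3 1).toLp _), h1.coeFn_toLp, h2.coeFn_toLp,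
    (h3 0).coeFn_toLp, (h3 1).coeFn_toLp⟩

/-- Smooth functions satisfy the weak identity, and it survives L² limits of the function and its
derivative. -/
theorem IsRegularVelocity.isWeakStreamDeriv_of_mem (hv : IsRegularVelocity S v K)
    {q : GraphSpace d} (hq : q ∈ traceGraph S v) : IsWeakStreamDeriv S v q.1 q.2.1 := by
  have hcl : IsClosed {q : GraphSpace d | IsWeakStreamDeriv S v q.1 q.2.1} :=
    (isClosed_isWeakStreamDeriv hv).preimage
      (f := fun q : GraphSpace d => (q.1, q.2.1)) (by fun_prop)
  refine closure_minimal ?_ hcl hq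
  rintro q ⟨p, hp, h1, h2, -, -⟩
  exact isWeakStreamDeriv_of_smooth hv hp h1 h2

lemma norm_sq_eq_integral {α : Type*} [MeasurableSpace α] {μ : Measure α} {f : Lp ℝ 2 μ}
    {p : α → ℝ} (h : f =ᵐ[μ] p) : ‖f‖ ^ 2 = ∫ x, p x ^ 2 ∂μ := by
  rw [← real_inner_self_eq_norm_sq, L2.inner_def]
  refine integral_congr_ae ?_
  filter_upwards [h] with x hx
  simp [hx, pow_two]

/-- The Poincaré inequality: functions are controlled by their traces on `Γ₀` and their stream
derivatives. -/
theorem IsRegularVelocity.exists_poincare (hv : IsRegularVelocity S v K) :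
    ∃ C : ℝ, 0 ≤ C ∧ ∀ q ∈ traceGraph S v, ‖q.1‖ ^ 2 ≤ C * (‖q.2.2.1‖ ^ 2 + ‖q.2.1‖ ^ 2) := by
  obtain ⟨C, hC0, hC⟩ := hv.exists_energy_bound
  refine ⟨C, hC0, fun q hq => ?_⟩
  have hcl : IsClosed {q : GraphSpace d | ‖q.1‖ ^ 2 ≤ C * (‖q.2.2.1‖ ^ 2 + ‖q.2.1‖ ^ 2)} :=
    isClosed_le (by fun_prop) (by fun_prop)
  refine closure_minimal ?_ hcl hq
  rintro q ⟨p, hp, h1, h2, h3, -⟩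
  have hc := (isSmoothUpToBoundary_iff.1 hp).1.continuous
  simp only [Set.mem_ofPred_eq]
  rw [norm_sq_eq_integral h1, norm_sq_eq_integral h2, norm_sq_eq_integral h3]
  have hint : Integrable (fun z => p z ^ 2) (muSpaceTime d) :=
    (Continuous.memLp_spaceTime hc 2).integrable_sq
  rw [muSpaceTime_eq_prod] at hint
  have h5 : ∫ z, p z ^ 2 ∂(muSpaceTime d) = ∫ t, ∫ x, p (t, x) ^ 2 ∂(muSpace d) ∂muTime := by
    rw [muSpaceTime_eq_prod, integral_prod _ hint]
  rw [h5]
  set c := C * (∫ x, p (0, x) ^ 2 ∂(muSpace d) +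
    ∫ z, classicalStreamDeriv v p z ^ 2 ∂(muSpaceTime d))
  have h6 : ∫ t, ∫ x, p (t, x) ^ 2 ∂(muSpace d) ∂muTime ≤ ∫ _, c ∂muTime := by
    refine integral_mono_ae hint.integral_prod_left (integrable_const c) ?_
    filter_upwards [ae_restrict_mem measurableSet_Icc] with t ht using hC p hp t ht
  simpa using h6

/-! ### Surjectivity of the trace -/

/-- Smooth data extend to smooth functions that vanish at the final time, with control of the graph
norm. -/
lemma IsRegularVelocity.exists_smooth_extension (hv : IsRegularVelocity S v K) :
    ∃ C : ℝ, 0 < C ∧ ∀ h ∈ smoothData d S, ∃ q ∈ smoothGraph S v,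
      q.2.2.1 = h ∧ q.2.2.2 = 0 ∧ ‖q‖ ≤ C * ‖h‖ := by
  obtain ⟨C, hC0, hC⟩ := hv.exists_poincare
  refine ⟨√(2 * C) + 1, by positivity, fun h hh => ?_⟩
  -- The tolerance for the stream derivative will be ‖h‖, which has to be positive.
  rcases eq_or_ne h 0 with rfl | hne
  · exact ⟨0, zero_mem _, rfl, rfl, by simp⟩
  obtain ⟨I, hI, hhI⟩ := hh
  have hpos : 0 < ‖h‖ := norm_pos_iff.2 hne
  obtain ⟨p, hp, hp0, hDp⟩ := hv.exists_approx_transport hI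
    (ε := ENNReal.ofReal ‖h‖) (ENNReal.ofReal_pos.2 hpos)
  have hp' := isSmoothUpToBoundary_iff.1 hp
  obtain ⟨q, hq1, hq2, hq3, hq4⟩ := hv.exists_represents hp'.1
  have hqmem : q ∈ smoothGraph S v := ⟨p, hp, hq1, hq2, hq3, hq4⟩
  have hq3h : q.2.2.1 = h := by
    refine Lp.ext ?_
    filter_upwards [hq3, hhI] with x e1 e2
    rw [e1, e2, hp0]
  have hn2 : ‖q.2.1‖ ≤ ‖h‖ := by
    rw [Lp.norm_def, eLpNorm_congr_ae hq2]
    exact ENNReal.toReal_le_of_le_ofReal (norm_nonneg _) hDp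
  have hn1 : ‖q.1‖ ≤ √(2 * C) * ‖h‖ := by
    have h1 := hC q (Submodule.le_topologicalClosure _ hqmem)
    rw [hq3h] at h1
    rw [← Real.sqrt_sq (norm_nonneg h), ← Real.sqrt_mul (by positivity)]
    refine Real.le_sqrt_of_sq_le (h1.trans ?_)
    have h2 : ‖q.2.1‖ ^ 2 ≤ ‖h‖ ^ 2 := by gcongr
    nlinarith [mul_le_mul_of_nonneg_left h2 hC0]
  -- The factor 1 - t keeps the initial trace and removes the final one. The extra term -p in the
  -- derivative is controlled by the Poincaré inequality.
  set r : ℝ × (Fin d → ℝ) → ℝ := fun z => (1 - z.1) * p z with hr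
  have hτ : ContDiff ℝ ∞ fun z : ℝ × (Fin d → ℝ) => 1 - z.1 := contDiff_const.sub contDiff_fst
  have hrs : IsSmoothUpToBoundary S r :=
    IsSmoothUpToBoundary.mul (isSmoothUpToBoundary_iff.2 ⟨hτ, fun t =>
      spacePeriodic_const (1 - t)⟩) hp
  have hDr : ∀ z, classicalStreamDeriv v r z = (1 - z.1) * classicalStreamDeriv v p z - p z := by
    intro z
    rw [hr, classicalStreamDeriv_mul hτ hp'.1]
    have : HasFDerivAt (fun z : ℝ × (Fin d → ℝ) => 1 - z.1) _ z :=
      (hasFDerivAt_fst (𝕜 := ℝ)).const_sub 1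
    rw [classicalStreamDeriv, classicalStreamDeriv, this.fderiv]
    simp
    ring
  obtain ⟨q', k1, k2, k3, k4⟩ := hv.exists_represents (isSmoothUpToBoundary_iff.1 hrs).1
  have hk1 : ‖q'.1‖ ≤ ‖q.1‖ := by
    refine Lp.norm_le_norm_of_ae_le ?_
    filter_upwards [k1, hq1, ae_mem_spaceTime] with z e1 e2 hz
    rw [e1, e2, hr, norm_mul]
    refine mul_le_of_le_one_left (norm_nonneg _) ?_
    rw [Real.norm_of_nonneg (sub_nonneg.2 hz.1.2)]
    linarith [hz.1.1]
  have hk2 : ‖q'.2.1‖ ≤ ‖q.2.1‖ + ‖q.1‖ := by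
    obtain ⟨g, hg⟩ : ∃ g : L2SpaceTime d, g =ᵐ[muSpaceTime d]
        fun z => (1 - z.1) * classicalStreamDeriv v p z := by
      have hm : MemLp (fun z => (1 - z.1) * classicalStreamDeriv v p z) 2 (muSpaceTime d) :=
        (hv.memLp_classicalStreamDeriv hp'.1).mul (Continuous.memLp_spaceTime hτ.continuous ∞)
      exact ⟨hm.toLp _, hm.coeFn_toLp⟩
    have e : q'.2.1 = g - q.1 := by
      refine Lp.ext ?_
      filter_upwards [k2, Lp.coeFn_sub g q.1, hg, hq1] with z e1 e2 e3 e4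
      rw [e1, e2, Pi.sub_apply, e3, e4, hDr]
    have hgn : ‖g‖ ≤ ‖q.2.1‖ := by
      refine Lp.norm_le_norm_of_ae_le ?_
      filter_upwards [hg, hq2, ae_mem_spaceTime] with z e1 e2 hz
      rw [e1, e2, norm_mul]
      refine mul_le_of_le_one_left (norm_nonneg _) ?_
      rw [Real.norm_of_nonneg (sub_nonneg.2 hz.1.2)]
      linarith [hz.1.1]
    rw [e]
    exact (norm_sub_le _ _).trans (add_le_add hgn le_rfl)
  have hk3 : q'.2.2.1 = h := by
    refine Lp.ext ?_
    filter_upwards [k3, hhI] with x e1 e2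
    rw [e1, e2, hr]
    simp [hp0]
  have hk4 : q'.2.2.2 = 0 := by
    refine Lp.ext ?_
    filter_upwards [k4, Lp.coeFn_zero ℝ 2 (muSpace d)] with x e1 e2
    rw [e1, e2, hr]
    simp
  refine ⟨q', ⟨r, hrs, k1, k2, k3, k4⟩, hk3, hk4, ?_⟩
  have hsq : 0 ≤ √(2 * C) := Real.sqrt_nonneg _
  rw [Prod.norm_def, Prod.norm_def, Prod.norm_def, hk3, hk4, norm_zero]
  refine max_le ?_ (max_le ?_ (max_le ?_ ?_))
  · nlinarith
  · nlinarith
  · nlinarith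
  · positivity

/-- Every function in `L²(Γ₀)` is the trace of a function that vanishes on `Γ₁`. -/
theorem IsRegularVelocity.exists_extension_initial (hv : IsRegularVelocity S v K)
    (h : L2Space d) : ∃ q ∈ traceGraph S v, q.2.2.1 = h ∧ q.2.2.2 = 0 := by
  obtain ⟨C, hC, hext⟩ := hv.exists_smooth_extension
  let π : GraphSpace d →L[ℝ] L2Space d :=
    (ContinuousLinearMap.snd ℝ _ _).comp ((ContinuousLinearMap.snd ℝ _ _).comp
      (ContinuousLinearMap.snd ℝ (L2SpaceTime d) (L2SpaceTime d × L2Space d × L2Space d)))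
  let π₀ : GraphSpace d →L[ℝ] L2Space d :=
    (ContinuousLinearMap.fst ℝ _ _).comp ((ContinuousLinearMap.snd ℝ _ _).comp
      (ContinuousLinearMap.snd ℝ (L2SpaceTime d) (L2SpaceTime d × L2Space d × L2Space d)))
  -- Working in the closed subspace with zero final trace preserves that condition in the limit.
  let G : Submodule ℝ (GraphSpace d) := traceGraph S v ⊓ LinearMap.ker π.toLinearMap
  have hGc : IsClosed (G : Set (GraphSpace d)) :=
    (Submodule.isClosed_topologicalClosure _).inter π.isClosed_ker
  have : CompleteSpace G := hGc.completeSpace_coe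
  let f : NormedAddGroupHom G (L2Space d) :=
    AddMonoidHom.mkNormedAddGroupHom (π₀.toLinearMap.comp G.subtype).toAddMonoidHom 1 fun q => by
      rw [one_mul]
      exact (norm_fst_le _).trans ((norm_snd_le _).trans (norm_snd_le (q : GraphSpace d)))
  have hsurj : f.SurjectiveOnWith (smoothData d S).toAddSubgroup C := by
    intro h hh
    obtain ⟨q, hq, h1, h2, h3⟩ := hext h hh
    exact ⟨⟨q, Submodule.le_topologicalClosure _ hq, h2⟩, h1, h3⟩
  -- Norm-controlled preimages of dense data can be summed as successive corrections in the complete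
  -- space `G`, so every element of the closure has a preimage.
  have hcl := controlled_closure_of_complete hC one_pos hsurj
  have hmem : h ∈ (smoothData d S).toAddSubgroup.topologicalClosure := by
    have : h ∈ (smoothData d S).topologicalClosure := by rw [smoothData_dense]; trivial
    exact this
  obtain ⟨⟨q, hq, h2⟩, h1, -⟩ := hcl h hmem
  exact ⟨q, hq, h1, h2⟩

end Graph

/-! ### Time reversal -/

section Reversal

variable {d : ℕ} {S : Setting} {v : ℝ → (Fin d → ℝ) → (Fin d → ℝ)} {K : ℝ → ℝ≥0}

lemma measurePreserving_one_sub_muTime : MeasurePreserving (fun t : ℝ => 1 - t) muTime muTime := by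
  have h := (Measure.measurePreserving_sub_left (volume : Measure ℝ) 1).restrict_preimage
    (s := Set.Icc (0 : ℝ) 1) measurableSet_Icc
  simpa using h

lemma measurePreserving_reversal :
    MeasurePreserving (fun z : ℝ × (Fin d → ℝ) => (1 - z.1, z.2)) (muSpaceTime d)
      (muSpaceTime d) := by
  rw [muSpaceTime_eq_prod]
  exact measurePreserving_one_sub_muTime.prod (MeasurePreserving.id (muSpace d))

/-- The velocity field of the time-reversed motion. -/
def reversedField (v : ℝ → (Fin d → ℝ) → (Fin d → ℝ)) (t : ℝ) (x : Fin d → ℝ) : Fin d → ℝ :=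
  -v (1 - t) x

lemma GlobalBoundary.neg {w : (Fin d → ℝ) → (Fin d → ℝ)} (h : GlobalBoundary S w) :
    GlobalBoundary S fun x => -w x := by
  cases S
  · exact fun x hx => by simp [h x hx]
  · exact fun n x => congrArg Neg.neg (h n x)

lemma IsRegularVelocity.reversedField (hv : IsRegularVelocity S v K) :
    IsRegularVelocity S (reversedField v) fun t => K (1 - t) where
  measurable_bound := hv.measurable_bound.comp (by fun_prop)
  memLp_bound := hv.memLp_bound.comp_measurePreserving measurePreserving_one_sub_muTime
  measurable := (hv.measurable.comp (f := fun z : ℝ × (Fin d → ℝ) => (1 - z.1, z.2))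
    (by fun_prop)).neg
  lipschitz t := (hv.lipschitz (1 - t)).neg
  norm_le t x := by simpa [Metamorphosis.reversedField] using hv.norm_le (1 - t) x
  boundary t := (hv.boundary (1 - t)).neg

lemma classicalStreamDeriv_reversal {p : ℝ × (Fin d → ℝ) → ℝ} (hp : ContDiff ℝ ∞ p)
    (z : ℝ × (Fin d → ℝ)) :
    classicalStreamDeriv v (fun z => p (1 - z.1, z.2)) z =
      -classicalStreamDeriv (reversedField v) p (1 - z.1, z.2) := by
  have hR : HasFDerivAt (fun z : ℝ × (Fin d → ℝ) => (1 - z.1, z.2)) _ z :=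
    ((hasFDerivAt_fst (𝕜 := ℝ)).const_sub 1).prodMk hasFDerivAt_snd
  have h := (hp.differentiable (by simp) (1 - z.1, z.2)).hasFDerivAt.comp z hR
  have h' : fderiv ℝ (fun z : ℝ × (Fin d → ℝ) => p (1 - z.1, z.2)) z = _ := h.fderiv
  rw [classicalStreamDeriv, h', classicalStreamDeriv, ← map_neg]
  simp [reversedField]

/-- Time reversal of the quadruples in the graph. -/
noncomputable def reversal (q : GraphSpace d) : GraphSpace d :=
  (Lp.compMeasurePreserving _ measurePreserving_reversal q.1,
    -Lp.compMeasurePreserving _ measurePreserving_reversal q.2.1, q.2.2.2, q.2.2.1)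

lemma continuous_reversal : Continuous (reversal (d := d)) := by
  have h : Continuous (Lp.compMeasurePreserving (E := ℝ) (p := 2) _
      (measurePreserving_reversal (d := d))) := Lp.isometry_compMeasurePreserving _ |>.continuous
  unfold reversal
  exact (h.comp (by fun_prop)).prodMk ((h.comp (by fun_prop)).neg.prodMk (by fun_prop))

lemma reversal_mem_smoothGraph {q : GraphSpace d} (hq : q ∈ smoothGraph S (reversedField v)) :
    reversal q ∈ smoothGraph S v := by
  obtain ⟨p, hp, h1, h2, h3, h4⟩ := hq
  have hp' := isSmoothUpToBoundary_iff.1 hp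
  have hq := measurePreserving_reversal (d := d) |>.quasiMeasurePreserving
  refine ⟨fun z => p (1 - z.1, z.2), isSmoothUpToBoundary_iff.2
    ⟨hp'.1.comp (by fun_prop), fun t => hp'.2 (1 - t)⟩, ?_, ?_, ?_, ?_⟩
  · exact (Lp.coeFn_compMeasurePreserving _ measurePreserving_reversal).trans (hq.ae_eq_comp h1)
  · filter_upwards [Lp.coeFn_neg (Lp.compMeasurePreserving _ measurePreserving_reversal q.2.1),
      Lp.coeFn_compMeasurePreserving q.2.1 measurePreserving_reversal, hq.ae_eq_comp h2]
      with z e1 e2 e3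
    rw [classicalStreamDeriv_reversal hp'.1]
    simp only [reversal]
    rw [e1, Pi.neg_apply, e2, e3, Function.comp_apply]
  · simpa [reversal] using h4
  · simpa [reversal] using h3

lemma reversal_mem_traceGraph {q : GraphSpace d} (hq : q ∈ traceGraph S (reversedField v)) :
    reversal q ∈ traceGraph S v :=
  map_mem_closure continuous_reversal hq fun _ => reversal_mem_smoothGraph

/-- The trace operator onto `L²(Γ₀) × L²(Γ₁)` is surjective. -/
theorem IsRegularVelocity.exists_extension (hv : IsRegularVelocity S v K) (h₀ h₁ : L2Space d) :
    ∃ q ∈ traceGraph S v, q.2.2 = (h₀, h₁) := by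
  obtain ⟨q₀, hq₀, e₀, e₀'⟩ := hv.exists_extension_initial h₀
  obtain ⟨q₁, hq₁, e₁, e₁'⟩ := hv.reversedField.exists_extension_initial h₁
  -- One summand carries the initial trace and vanishes at the end. The other, solved for the
  -- reversed motion, carries the final trace and vanishes initially.
  refine ⟨q₀ + reversal q₁, add_mem hq₀ (reversal_mem_traceGraph hq₁), ?_⟩
  ext1 <;> simp [reversal, e₀, e₀', e₁, e₁']

end Reversal

/-! ### Admissible functions -/

section Admissible

variable {d : ℕ} {S : Setting} {v : ℝ → (Fin d → ℝ) → (Fin d → ℝ)} {K : ℝ → ℝ≥0}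
  {I f g : L2SpaceTime d} {I₀ I₁ : L2Space d}

theorem IsRegularVelocity.streamDeriv_eq_of_mem (hv : IsRegularVelocity S v K)
    (h : (I, g, I₀, I₁) ∈ traceGraph S v) : streamDeriv S v I = g :=
  (hv.isWeakStreamDeriv_of_mem h).streamDeriv_eq

lemma tendsto_Lp_of_ae_eq {α : Type*} [MeasurableSpace α] {μ : Measure α} {F : ℕ → Lp ℝ 2 μ}
    {p : ℕ → α → ℝ} (h : ∀ n, F n =ᵐ[μ] p n) (f : Lp ℝ 2 μ) :
    Tendsto F atTop (𝓝 f) ↔ Tendsto (fun n => eLpNorm (fun x => p n x - f x) 2 μ) atTop (𝓝 0) := by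
  rw [Lp.tendsto_Lp_iff_tendsto_eLpNorm']
  refine tendsto_congr fun n => eLpNorm_congr_ae ?_
  filter_upwards [h n] with x hx
  simp [hx]

/-- A function is admissible if and only if it lies in the graph over the given traces. -/
theorem IsRegularVelocity.mem_admissible_iff (hv : IsRegularVelocity S v K) :
    I ∈ admissible S v I₀ I₁ ↔ (I, streamDeriv S v I, I₀, I₁) ∈ traceGraph S v := by
  constructor
  · rintro ⟨-, p, hp, h1, h2, h3, h4⟩
    choose q hq using fun n => hv.exists_represents (isSmoothUpToBoundary_iff.1 (hp n)).1
    refine mem_closure_of_tendsto (f := q) (b := atTop) ?_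
      (Eventually.of_forall fun n => ⟨p n, hp n, hq n⟩)
    refine Tendsto.prodMk_nhds ?_ (Tendsto.prodMk_nhds ?_ (Tendsto.prodMk_nhds ?_ ?_))
    · exact (tendsto_Lp_of_ae_eq (fun n => (hq n).1) _).2 h1
    · exact (tendsto_Lp_of_ae_eq (fun n => (hq n).2.1) _).2 h2
    · exact (tendsto_Lp_of_ae_eq (fun n => (hq n).2.2.1) _).2 h3
    · exact (tendsto_Lp_of_ae_eq (fun n => (hq n).2.2.2) _).2 h4
  · intro h
    refine ⟨⟨_, hv.isWeakStreamDeriv_of_mem h⟩, ?_⟩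
    obtain ⟨q, hq, hlim⟩ := mem_closure_iff_seq_limit.1 h
    choose p hp hpq using hq
    have hl := fun {E : Type} [TopologicalSpace E] (π : GraphSpace d → E) (hπ : Continuous π) =>
      (hπ.tendsto _).comp hlim
    refine ⟨p, hp, ?_, ?_, ?_, ?_⟩
    · exact (tendsto_Lp_of_ae_eq (fun n => (hpq n).1) _).1 (hl (fun q => q.1) (by fun_prop))
    · exact (tendsto_Lp_of_ae_eq (fun n => (hpq n).2.1) _).1 (hl (fun q => q.2.1) (by fun_prop))
    · exact (tendsto_Lp_of_ae_eq (fun n => (hpq n).2.2.1) _).1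
        (hl (fun q => q.2.2.1) (by fun_prop))
    · exact (tendsto_Lp_of_ae_eq (fun n => (hpq n).2.2.2) _).1
        (hl (fun q => q.2.2.2) (by fun_prop))

lemma IsRegularVelocity.admissible_of_mem (hv : IsRegularVelocity S v K)
    (h : (I, g, I₀, I₁) ∈ traceGraph S v) : I ∈ admissible S v I₀ I₁ :=
  hv.mem_admissible_iff.2 (by rwa [hv.streamDeriv_eq_of_mem h])

/-- `streamDeriv` is defined by choice and is not linear by construction. Linearity comes from the
graph being a subspace together with uniqueness of weak derivatives. -/
lemma IsRegularVelocity.admissible_add_smul (hv : IsRegularVelocity S v K)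
    (hI : I ∈ admissible S v I₀ I₁) (hf : f ∈ admissible S v 0 0) (s : ℝ) :
    I + s • f ∈ admissible S v I₀ I₁ ∧
      streamDeriv S v (I + s • f) = streamDeriv S v I + s • streamDeriv S v f := by
  have h := add_mem (hv.mem_admissible_iff.1 hI)
    (Submodule.smul_mem _ s (hv.mem_admissible_iff.1 hf))
  simp only [Prod.smul_mk, Prod.mk_add_mk, smul_zero, add_zero] at h
  exact ⟨hv.admissible_of_mem h, hv.streamDeriv_eq_of_mem h⟩

lemma IsRegularVelocity.admissible_sub (hv : IsRegularVelocity S v K)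
    (hI : I ∈ admissible S v I₀ I₁) (hf : f ∈ admissible S v I₀ I₁) :
    I - f ∈ admissible S v 0 0 ∧
      streamDeriv S v (I - f) = streamDeriv S v I - streamDeriv S v f := by
  have h := sub_mem (hv.mem_admissible_iff.1 hI) (hv.mem_admissible_iff.1 hf)
  simp only [Prod.mk_sub_mk, sub_self] at h
  exact ⟨hv.admissible_of_mem h, hv.streamDeriv_eq_of_mem h⟩

/-! ### Optimality conditions -/

theorem IsRegularVelocity.hasDerivAt_objective (hv : IsRegularVelocity S v K)
    (hI : I ∈ admissible S v I₀ I₁) (hf : f ∈ admissible S v 0 0) :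
    HasDerivAt (fun s : ℝ => objective S v (I + s • f)) (energyInner S v I f) 0 := by
  have h : HasDerivAt (fun s : ℝ => streamDeriv S v I + s • streamDeriv S v f)
      (streamDeriv S v f) 0 := by
    simpa using ((hasDerivAt_id (0 : ℝ)).smul_const (streamDeriv S v f)).const_add
      (streamDeriv S v I)
  have h2 := h.norm_sq.const_mul (1 / 2)
  simp only [objective, (hv.admissible_add_smul hI hf _).2, energyInner]
  rwa [zero_smul, add_zero, ← mul_assoc, one_div, inv_mul_cancel₀ two_ne_zero, one_mul,
    ← one_div] at h2

/-- Necessity is Fermat's rule along each line I + s f. For sufficiency, the derivative of J - I is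
orthogonal to that of I, so Pythagoras shows that the objective at J is not smaller. -/
theorem IsRegularVelocity.isMinOn_iff (hv : IsRegularVelocity S v K)
    (hI : I ∈ admissible S v I₀ I₁) :
    IsMinOn (objective S v) (admissible S v I₀ I₁) I ↔
      ∀ f ∈ admissible S v 0 0, energyInner S v I f = 0 := by
  constructor
  · intro hmin f hf
    refine IsLocalMin.hasDerivAt_eq_zero (Eventually.of_forall fun s => ?_)
      (hv.hasDerivAt_objective hI hf)
    simpa using hmin (hv.admissible_add_smul hI hf s).1
  · intro hopt J hJ
    obtain ⟨h1, h2⟩ := hv.admissible_sub hJ hI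
    have h3 := hopt _ h1
    rw [energyInner] at h3
    have h4 : streamDeriv S v J = streamDeriv S v I + streamDeriv S v (J - I) := by rw [h2]; abel
    have h5 := norm_add_sq_eq_norm_sq_add_norm_sq_of_inner_eq_zero _ _ h3
    change objective S v I ≤ objective S v J
    have h6 : ‖streamDeriv S v J‖ * ‖streamDeriv S v J‖ = _ := h4 ▸ h5
    rw [objective, objective, pow_two ‖streamDeriv S v J‖, h6]
    nlinarith [mul_self_nonneg ‖streamDeriv S v (J - I)‖]

lemma IsRegularVelocity.eq_zero_of_streamDeriv_eq_zero (hv : IsRegularVelocity S v K)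
    (hf : f ∈ admissible S v 0 0) (h : streamDeriv S v f = 0) : f = 0 := by
  obtain ⟨C, -, hC⟩ := hv.exists_poincare
  have := hC _ (hv.mem_admissible_iff.1 hf)
  simpa [h] using this

/-- The stream derivatives of the functions with vanishing trace. -/
noncomputable def zeroTraceDerivs (S : Setting) (v : ℝ → (Fin d → ℝ) → (Fin d → ℝ)) :
    Submodule ℝ (L2SpaceTime d) :=
  (traceGraph S v ⊓ (LinearMap.snd ℝ _ _ ∘ₗ LinearMap.snd ℝ (L2SpaceTime d)
    (L2SpaceTime d × L2Space d × L2Space d)).ker).map (LinearMap.fst ℝ _ _ ∘ₗ LinearMap.snd ℝ _ _)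

lemma IsRegularVelocity.mem_zeroTraceDerivs (hv : IsRegularVelocity S v K) :
    g ∈ zeroTraceDerivs S v ↔ ∃ f ∈ admissible S v 0 0, streamDeriv S v f = g := by
  constructor
  · rintro ⟨⟨f, g', h⟩, ⟨hq, h0⟩, rfl⟩
    obtain rfl : h = 0 := h0
    exact ⟨f, hv.admissible_of_mem hq, hv.streamDeriv_eq_of_mem hq⟩
  · rintro ⟨f, hf, rfl⟩
    exact ⟨_, ⟨hv.mem_admissible_iff.1 hf, rfl⟩, rfl⟩

/-- With zero trace, the Poincaré inequality makes the map from the closed graph to the derivative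
bounded below. Such a map on a complete space has closed range. -/
lemma IsRegularVelocity.isClosed_zeroTraceDerivs (hv : IsRegularVelocity S v K) :
    IsClosed (zeroTraceDerivs S v : Set (L2SpaceTime d)) := by
  obtain ⟨C, hC0, hC⟩ := hv.exists_poincare
  set G : Submodule ℝ (GraphSpace d) := traceGraph S v ⊓ (LinearMap.snd ℝ _ _ ∘ₗ
    LinearMap.snd ℝ (L2SpaceTime d) (L2SpaceTime d × L2Space d × L2Space d)).ker with hG
  have hGc : IsClosed (G : Set (GraphSpace d)) :=
    (Submodule.isClosed_topologicalClosure _).inter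
      (isClosed_singleton.preimage (f := fun q : GraphSpace d => q.2.2) (by fun_prop))
  have : CompleteSpace G := hGc.completeSpace_coe
  let φ : G →L[ℝ] L2SpaceTime d := (ContinuousLinearMap.fst ℝ _ _).comp
    ((ContinuousLinearMap.snd ℝ _ _).comp G.subtypeL)
  have hφ : AntilipschitzWith (√C + 1).toNNReal φ := by
    refine φ.antilipschitz_of_bound fun ⟨⟨f, g, h⟩, hq, h0⟩ => ?_
    obtain rfl : h = 0 := h0
    have h1 : ‖f‖ ^ 2 ≤ C * ‖g‖ ^ 2 := by simpa using hC _ hq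
    have h2 : ‖f‖ ≤ √C * ‖g‖ := by
      rw [← Real.sqrt_sq (norm_nonneg g), ← Real.sqrt_mul hC0]
      exact Real.le_sqrt_of_sq_le h1
    have h3 := mul_nonneg (Real.sqrt_nonneg C) (norm_nonneg g)
    rw [Real.coe_toNNReal _ (by positivity)]
    change ‖(f, g, (0 : L2Space d × L2Space d))‖ ≤ (√C + 1) * ‖g‖
    rw [Prod.norm_def, Prod.norm_def, norm_zero]
    refine max_le ?_ (max_le ?_ ?_)
    · nlinarith [norm_nonneg g]
    · nlinarith [norm_nonneg g]
    · positivity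
  have hr := hφ.isClosed_range φ.uniformContinuous
  convert hr using 1
  ext g
  constructor
  · rintro ⟨q, hq, rfl⟩
    exact ⟨⟨q, hq⟩, rfl⟩
  · rintro ⟨⟨q, hq⟩, rfl⟩
    exact ⟨q, hq, rfl⟩

/-- Any extension of the boundary data is corrected by a zero-trace function w whose derivative is
the orthogonal projection of the extension's derivative g. What remains, g minus its projection, is
orthogonal to all zero-trace derivatives, which is the optimality condition. -/
theorem IsRegularVelocity.existsUnique_isMinOn (hv : IsRegularVelocity S v K)
    (I₀ I₁ : L2Space d) :
    ∃! I, I ∈ admissible S v I₀ I₁ ∧ IsMinOn (objective S v) (admissible S v I₀ I₁) I := by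
  obtain ⟨⟨f, g, h⟩, hq, hh⟩ := hv.exists_extension I₀ I₁
  obtain rfl : h = (I₀, I₁) := hh
  have := hv.isClosed_zeroTraceDerivs.completeSpace_coe
  obtain ⟨w, hw, hwD⟩ := hv.mem_zeroTraceDerivs.1
    ((zeroTraceDerivs S v).starProjection_apply_mem g)
  obtain ⟨hI, hID⟩ := hv.admissible_add_smul (hv.admissible_of_mem hq) hw (-1)
  have hopt : ∀ k ∈ admissible S v 0 0, energyInner S v (f + (-1 : ℝ) • w) k = 0 := by
    intro k hk
    rw [energyInner, hID, hv.streamDeriv_eq_of_mem hq, hwD, neg_one_smul ℝ (_ : L2SpaceTime d),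
      ← sub_eq_add_neg, real_inner_comm]
    exact Submodule.inner_right_of_mem_orthogonal (hv.mem_zeroTraceDerivs.2 ⟨k, hk, rfl⟩)
      (Submodule.sub_starProjection_mem_orthogonal g)
  refine ⟨f + (-1 : ℝ) • w, ⟨hI, (hv.isMinOn_iff hI).2 hopt⟩, fun J ⟨hJ, hJmin⟩ => ?_⟩
  obtain ⟨h1, h2⟩ := hv.admissible_sub hJ hI
  have h3 := (hv.isMinOn_iff hJ).1 hJmin _ h1
  have h4 := hopt _ h1
  rw [energyInner] at h3 h4
  have h5 : streamDeriv S v (J - (f + (-1 : ℝ) • w)) = 0 := by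
    rw [← inner_self_eq_zero (𝕜 := ℝ)]
    -- Only one factor is expanded. The other stays the derivative of a zero-trace direction,
    -- against which both optimality conditions can be tested.
    nth_rw 1 [h2]
    rw [inner_sub_left, h3, h4, sub_zero]
  exact sub_eq_zero.1 (hv.eq_zero_of_streamDeriv_eq_zero h1 h5)

end Admissible

end Metamorphosis

theorem theorem4 (d : ℕ) (S : Metamorphosis.Setting)
    (u : ℝ → (Fin d → ℝ) → (Fin d → ℝ)) (hu : Metamorphosis.IsVelocity S u)
    (I₀ I₁ : Metamorphosis.L2Space d) :
    -- existence and uniqueness of the minimizer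
    (∃! I : Metamorphosis.L2SpaceTime d, I ∈ Metamorphosis.admissible S u I₀ I₁ ∧
      IsMinOn (Metamorphosis.objective S u) (Metamorphosis.admissible S u I₀ I₁) I) ∧
    -- the first variation in the directions that vanish on the two time boundaries
    (∀ I ∈ Metamorphosis.admissible S u I₀ I₁, ∀ v ∈ Metamorphosis.admissible S u 0 0,
      (∀ s : ℝ, I + s • v ∈ Metamorphosis.admissible S u I₀ I₁) ∧
      HasDerivAt (fun s : ℝ => Metamorphosis.objective S u (I + s • v))
        (Metamorphosis.energyInner S u I v) 0) ∧
    -- the first-order conditions are necessary and sufficient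
    (∀ I ∈ Metamorphosis.admissible S u I₀ I₁,
      (IsMinOn (Metamorphosis.objective S u) (Metamorphosis.admissible S u I₀ I₁) I ↔
        ∀ v ∈ Metamorphosis.admissible S u 0 0, Metamorphosis.energyInner S u I v = 0)) := by
  -- Admissibility, objective and energy depend only on the values of the velocity on the field
  -- domain at almost every time, so the regular representative may replace it.
  obtain ⟨v, K, hv, h⟩ := hu.exists_regular
  rw [Metamorphosis.admissible_congr h, Metamorphosis.objective_congr h,
    Metamorphosis.energyInner_congr h]
  exact ⟨hv.existsUnique_isMinOn I₀ I₁, fun I hI f hf =>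
    ⟨fun s => (hv.admissible_add_smul hI hf s).1, hv.hasDerivAt_objective hI hf⟩,
    fun I hI => hv.isMinOn_iff hI⟩
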